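/- Setting. Let $(M,g_{ab})$ be (an end of) a stationary, axisymmetric, vacuum spacetime: $g$ is a smooth Ricci-flat Lorentz metric of signature $(-,+,+,+)$ with a timelike Killing field $\xi=\partial/\partial t$, invariant under the rotations about an axis. Let $\lambda=-\xi^a\xi_a$, let $\omega$ be a twist potential, $\nabla_a\omega=\epsilon_{abcd}\xi^b\nabla^c\xi^d$, and let $V$ be the 3-manifold of trajectories of $\xi$ with the metric $h_{ab}=\lambda g_{ab}+\xi_a\xi_b$. Suppose that $V$ is asymptotically flat: $\widetilde V=V\cup\{\Lambda\}$ is a 3-manifold (near $\Lambda$), with a smooth function $\Omega$, positive on $V$, such that $\tilde h_{ab}=\Omega^2h_{ab}$ extends to a smooth Riemannian metric on $\widetilde V$ and $\Omega=0$, $\tilde D_a\Omega=0$, $\tilde D_a\tilde D_b\Omega=2\tilde h_{ab}$ at $\Lambda$. Suppose further that there are coordinates $x=\rho\cos\varphi$, $y=\rho\sin\varphi$, $z$ on $\widetilde V$ near $\Lambda=0$ in which the rotations act by shifts of $\varphi$ and, off the axis, $$\tilde h=e^{2\kappa}\bigl(\rho^2e^{-2\beta}d\varphi^2+d\rho^2+dz^2\bigr),$$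 where $\beta,\kappa$ are axisymmetric, $\kappa(\Lambda)=0$. For a complex potential $\phi$ on $V$ put $\tilde\phi=\phi/\sqrt\Omega$, with its limit as the value at $\Lambda$. The multipole moments produced by $\phi$ are the values at $\Lambda$ of the tensors $P_{a_1\dots a_n}$, $n=0,1,2,\dots$, defined by $P=\tilde\phi$ and $$P_{a_1\dots a_n}=C\Bigl[\tilde D_{a_1}P_{a_2\dots a_n}-\tfrac{(n-1)(2n-3)}{2}\widetilde R_{a_1a_2}P_{a_3\dots a_n}\Bigr],$$ where $\widetilde R_{ab}$ is the Ricci tensor of $\tilde h$ and $C[\cdot]$ is the totally symmetric and trace-free part. For an axisymmetric function $u$ that is real analytic near $\Lambda$, regarded as a function $u(z,\rho)$ that is even in $\rho$, its leading order function is $u_L(r)=u(r,-ir)$ for small real $r$, where $u$ is extended to small complex arguments by its power series. Let $$\phi_H=-\frac{\lambda^2-1+\omega^2+2i\omega}{4\lambda},\qquad \phi_E=\frac{1-\lambda-i\omega}{1+\lambda+i\omega}$$ be the Hansen and the Ernst potential. Theorem. Assume that $\Omega$, $\beta$, $\kappa$ and $\tilde\phi_H$ are real analytic in a neighbourhood of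 $\Lambda$ in $\widetilde V$. Then: (a) $\tilde\phi_E$ is real analytic in a neighbourhood of $\Lambda$, and $\phi_E$ and $\phi_H$ produce the same multipole moments. (b) More generally, if $\phi$ is any axisymmetric complex potential on $V$ such that $\tilde\phi$ is real analytic in a neighbourhood of $\Lambda$ and $(\tilde\phi)_L=(\tilde\phi_H)_L$ near $r=0$, then $\phi$ and $\phi_H$ produce the same multipole moments. -/

import Mathlib

open scoped Topology

namespace Multipole

noncomputable section

/-! ### Tensor calculus in a coordinate chart

A metric on an open subset of `ι → ℝ` is given by its matrix of components, a covariant tensor of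
rank `n` by its components `T (a₁, …, aₙ)`. -/

section Calculus

variable {ι : Type} [Fintype ι] [DecidableEq ι]

/-- The partial derivative `∂ᵢ f`. -/
def pd {E : Type} [NormedAddCommGroup E] [NormedSpace ℝ E] (i : ι) (f : (ι → ℝ) → E)
    (x : ι → ℝ) : E :=
  fderiv ℝ f x (Pi.single i 1)

/-- The Christoffel symbol `Γᵏᵢⱼ` of the metric `G`. -/
def christoffel (G : (ι → ℝ) → Matrix ι ι ℝ) (x : ι → ℝ) (k i j : ι) : ℝ :=
  (1 / 2) * ∑ l, (G x)⁻¹ k l *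
    (pd i (fun y => G y l j) x + pd j (fun y => G y i l) x - pd l (fun y => G y i j) x)

/-- The Ricci tensor `Rᵢⱼ` of the metric `G` (positive on round spheres). -/
def ricci (G : (ι → ℝ) → Matrix ι ι ℝ) (x : ι → ℝ) (i j : ι) : ℝ :=
  ∑ k, (pd k (fun y => christoffel G y k i j) x - pd j (fun y => christoffel G y k i k) x)
    + ∑ k, ∑ l, (christoffel G x k k l * christoffel G x l i j
        - christoffel G x k j l * christoffel G x l i k)

/-- The Hessian `DᵢDⱼ f` of a real function. -/
def hessian (G : (ι → ℝ) → Matrix ι ι ℝ) (f : (ι → ℝ) → ℝ) (x : ι → ℝ) (i j : ι) : ℝ :=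
  pd i (pd j f) x - ∑ k, christoffel G x k i j * pd k f x

/-- The covariant derivative `D_{a₀} T_{a₁ … aₙ}` of a covariant tensor field. -/
def covDeriv (G : (ι → ℝ) → Matrix ι ι ℝ) {n : ℕ} (T : (ι → ℝ) → (Fin n → ι) → ℂ)
    (x : ι → ℝ) (a : Fin (n + 1) → ι) : ℂ :=
  pd (a 0) (fun y => T y (fun m => a m.succ)) x
    - ∑ j : Fin n, ∑ k : ι, (christoffel G x k (a 0) (a j.succ) : ℂ)
        * T x (Function.update (fun m => a m.succ) j k)

/-! ### The totally symmetric and trace-free part -/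

/-- The total symmetrization `T_{(a₁ … aₙ)}`. -/
def symmetrize {n : ℕ} (T : (Fin n → ι) → ℂ) (a : Fin n → ι) : ℂ :=
  ((n.factorial : ℂ))⁻¹ * ∑ σ : Equiv.Perm (Fin n), T (a ∘ σ)

/-- The trace of `T` over the slots `i` and `j`, taken with the inverse of `h`. -/
def traceAt (h : Matrix ι ι ℝ) {n : ℕ} (i j : Fin n) (T : (Fin n → ι) → ℂ) (a : Fin n → ι) : ℂ :=
  ∑ k, ∑ l, ((h⁻¹ k l : ℝ) : ℂ) * T (Function.update (Function.update a i k) j l)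

/-- The span of all tensors `h_{aᵢ aⱼ} Q`, where `Q` carries the remaining indices. -/
def traceSpan (h : Matrix ι ι ℝ) (n : ℕ) : Submodule ℂ ((Fin n → ι) → ℂ) :=
  Submodule.span ℂ {W | ∃ i j : Fin n, i ≠ j ∧ ∃ Q : (Fin n → ι) → ℂ,
    (∀ a k l, Q (Function.update (Function.update a i k) j l) = Q a) ∧
    W = fun a => (h (a i) (a j) : ℂ) * Q a}

/-- `S` is totally symmetric, trace-free, and differs from the symmetrization of `T` by
trace terms only. -/
structure IsSTFPart (h : Matrix ι ι ℝ) {n : ℕ} (T S : (Fin n → ι) → ℂ) : Prop where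
  symmetric : ∀ (σ : Equiv.Perm (Fin n)) (a : Fin n → ι), S (a ∘ σ) = S a
  traceFree : ∀ i j : Fin n, i ≠ j → ∀ a, traceAt h i j S a = 0
  differ : (fun a => symmetrize T a - S a) ∈ traceSpan h n

/-- `C[T]`, the totally symmetric and trace-free part of `T`; it exists and is unique for a
positive definite `h`. -/
def stfPart (h : Matrix ι ι ℝ) {n : ℕ} (T : (Fin n → ι) → ℂ) : (Fin n → ι) → ℂ :=
  Classical.epsilon fun S => IsSTFPart h T S

/-! The trace-free symmetric part is well defined: existence and uniqueness. -/

section WellDefined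

set_option linter.unusedSectionVars false

/-- Change of frame. -/
def chg (B : Matrix ι ι ℝ) {n : ℕ} : ((Fin n → ι) → ℂ) →ₗ[ℂ] ((Fin n → ι) → ℂ) where
  toFun T a := ∑ c : Fin n → ι, (∏ m, (B (c m) (a m) : ℂ)) * T c
  map_add' S T := by
    funext a; simp [mul_add, Finset.sum_add_distrib]
  map_smul' r T := by
    funext a; simp [Finset.mul_sum, mul_left_comm]

lemma chg_apply (B : Matrix ι ι ℝ) {n : ℕ} (T : (Fin n → ι) → ℂ) (a : Fin n → ι) :
    chg B T a = ∑ c : Fin n → ι, (∏ m, (B (c m) (a m) : ℂ)) * T c := rfl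

lemma chg_chg (A B : Matrix ι ι ℝ) {n : ℕ} (T : (Fin n → ι) → ℂ) :
    chg B (chg A T) = chg (A * B) T := by
  funext a
  simp only [chg_apply, Finset.mul_sum]
  rw [Finset.sum_comm]
  refine Finset.sum_congr rfl fun d _ => ?_
  have : ∏ m, (((A * B) (d m) (a m) : ℝ) : ℂ)
      = ∑ c : Fin n → ι, ∏ m, ((A (d m) (c m) : ℂ) * (B (c m) (a m) : ℂ)) := by
    have e := Finset.prod_univ_sum (fun _ : Fin n => (Finset.univ : Finset ι))
      (fun m k => (A (d m) k : ℂ) * (B k (a m) : ℂ))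
    rw [Fintype.piFinset_univ] at e
    rw [← e]
    refine Finset.prod_congr rfl fun m _ => ?_
    simp [Matrix.mul_apply]
  rw [this, Finset.sum_mul]
  refine Finset.sum_congr rfl fun c _ => ?_
  rw [Finset.prod_mul_distrib]; ring

lemma chg_one {n : ℕ} (T : (Fin n → ι) → ℂ) : chg (1 : Matrix ι ι ℝ) T = T := by
  funext a
  rw [chg_apply, Finset.sum_eq_single a]
  · simp
  · intro c _ hc
    obtain ⟨m, hm⟩ := Function.ne_iff.1 hc
    rw [Finset.prod_eq_zero (Finset.mem_univ m), zero_mul]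
    simp [hm]
  · simp

lemma sum_update {n : ℕ} (i : Fin n) (F : (Fin n → ι) → ℂ) :
    ∑ c, ∑ k, F (Function.update c i k) = Fintype.card ι * ∑ c, F c := by
  let e : ((Fin n → ι) × ι) ≃ ((Fin n → ι) × ι) :=
    { toFun := fun p => (Function.update p.1 i p.2, p.1 i)
      invFun := fun p => (Function.update p.1 i p.2, p.1 i)
      left_inv := fun p => by simp
      right_inv := fun p => by simp }
  rw [← Fintype.sum_prod_type' (f := fun c k => F (Function.update c i k))]
  have hs := e.sum_comp (fun p => F p.1)
  rw [Fintype.sum_prod_type (fun p : (Fin n → ι) × ι => F p.1)] at hs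
  refine hs.trans ?_
  simp [Finset.mul_sum]

lemma sum_update₂ {n : ℕ} (i j : Fin n) (F : (Fin n → ι) → ℂ) :
    ∑ c, ∑ k, ∑ l, F (Function.update (Function.update c i k) j l)
      = Fintype.card ι * (Fintype.card ι * ∑ c, F c) := by
  rw [sum_update i (fun c => ∑ l, F (Function.update c j l)), sum_update j F]

lemma prod_split {n : ℕ} {i j : Fin n} (hij : i ≠ j) (f : Fin n → ℂ) :
    ∏ m, f m = f i * f j * ∏ m ∈ (Finset.univ.erase i).erase j, f m := by
  rw [← Finset.mul_prod_erase Finset.univ f (Finset.mem_univ i),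
    ← Finset.mul_prod_erase (Finset.univ.erase i) f (a := j) (by simp [hij.symm])]
  ring

lemma chg_mem_traceSpan [Nonempty ι] (h B : Matrix ι ι ℝ) {n : ℕ} {W : (Fin n → ι) → ℂ}
    (hW : W ∈ traceSpan h n) : chg B W ∈ traceSpan (B.transpose * h * B) n := by
  induction hW using Submodule.span_induction with
  | zero => simp
  | add x y _ _ hx hy => rw [map_add]; exact Submodule.add_mem _ hx hy
  | smul r x _ hx => rw [map_smul]; exact Submodule.smul_mem _ _ hx
  | mem W hW =>
    obtain ⟨i, j, hij, Q, hQ, rfl⟩ := hW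
    have hN : (Fintype.card ι : ℂ) ≠ 0 := by exact_mod_cast Fintype.card_ne_zero
    refine Submodule.subset_span ⟨i, j, hij, fun a => ((Fintype.card ι : ℂ)⁻¹ *
      (Fintype.card ι : ℂ)⁻¹) * ∑ c : Fin n → ι,
      (∏ m ∈ (Finset.univ.erase i).erase j, (B (c m) (a m) : ℂ)) * Q c, ?_, ?_⟩
    · intro a k l
      dsimp only
      congr 1
      refine Finset.sum_congr rfl fun c _ => ?_
      congr 1
      refine Finset.prod_congr rfl fun m hm => ?_
      simp only [Finset.mem_erase] at hm
      rw [Function.update_of_ne hm.1, Function.update_of_ne hm.2.1]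
    · funext a
      rw [chg_apply]
      have key := sum_update₂ i j (fun c : Fin n → ι =>
        (∏ m, (B (c m) (a m) : ℂ)) * ((h (c i) (c j) : ℂ) * Q c))
      have : ∀ c : Fin n → ι, ∑ k, ∑ l, (fun c : Fin n → ι =>
          (∏ m, (B (c m) (a m) : ℂ)) * ((h (c i) (c j) : ℂ) * Q c))
            (Function.update (Function.update c i k) j l)
          = (((B.transpose * h * B) (a i) (a j) : ℝ) : ℂ) *
            ((∏ m ∈ (Finset.univ.erase i).erase j, (B (c m) (a m) : ℂ)) * Q c) := by
        intro c
        simp only [Matrix.mul_apply, Matrix.transpose_apply, Finset.sum_mul, Complex.ofReal_sum]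
        rw [Finset.sum_comm]
        refine Finset.sum_congr rfl fun l _ => Finset.sum_congr rfl fun k _ => ?_
        rw [prod_split hij, hQ, Function.update_self, Function.update_of_ne hij,
          Function.update_self]
        rw [Finset.prod_congr rfl (g := fun m => (B (c m) (a m) : ℂ))]
        · push_cast; ring
        · intro m hm
          simp only [Finset.mem_erase] at hm
          rw [Function.update_of_ne hm.1, Function.update_of_ne hm.2.1]
      simp only [this] at key
      rw [← Finset.mul_sum] at key
      rw [mul_left_comm, key]
      field_simp

lemma traceAt_chg [Nonempty ι] (h B : Matrix ι ι ℝ) (hB : IsUnit B.det) {n : ℕ}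
    {S : (Fin n → ι) → ℂ} {i j : Fin n} (hij : i ≠ j) (hS : ∀ a, traceAt h i j S a = 0)
    (a : Fin n → ι) : traceAt (B.transpose * h * B) i j (chg B S) a = 0 := by
  have hN : (Fintype.card ι : ℂ) ≠ 0 := by exact_mod_cast Fintype.card_ne_zero
  have hinv : B * (B.transpose * h * B)⁻¹ * B.transpose = h⁻¹ := by
    have hBt : IsUnit B.transpose.det := by rwa [Matrix.det_transpose]
    rw [Matrix.mul_inv_rev, Matrix.mul_inv_rev, ← Matrix.mul_assoc, Matrix.mul_nonsing_inv _ hB,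
      Matrix.one_mul, Matrix.mul_assoc, Matrix.nonsing_inv_mul _ hBt, Matrix.mul_one]
  have step : traceAt (B.transpose * h * B) i j (chg B S) a
      = ∑ c : Fin n → ι, (∏ m ∈ (Finset.univ.erase i).erase j, (B (c m) (a m) : ℂ)) *
          (((h⁻¹ (c i) (c j) : ℝ) : ℂ) * S c) := by
    simp only [traceAt, chg_apply, Finset.mul_sum]
    rw [Finset.sum_congr rfl fun k _ => Finset.sum_comm, Finset.sum_comm]
    refine Finset.sum_congr rfl fun c _ => ?_
    rw [← hinv]
    simp only [Matrix.mul_apply (N := B.transpose), Matrix.mul_apply (M := B),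
      Matrix.transpose_apply, Finset.sum_mul, Finset.mul_sum, Complex.ofReal_sum]
    rw [Finset.sum_comm]
    refine Finset.sum_congr rfl fun l _ => Finset.sum_congr rfl fun k _ => ?_
    rw [prod_split hij, Function.update_self, Function.update_of_ne hij,
          Function.update_self]
    rw [Finset.prod_congr rfl (g := fun m => (B (c m) (a m) : ℂ))]
    · push_cast; ring
    · intro m hm
      simp only [Finset.mem_erase] at hm
      rw [Function.update_of_ne hm.1, Function.update_of_ne hm.2.1]
  have key := sum_update₂ i j (fun c : Fin n → ι =>
    (∏ m ∈ (Finset.univ.erase i).erase j, (B (c m) (a m) : ℂ)) *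
          (((h⁻¹ (c i) (c j) : ℝ) : ℂ) * S c))
  rw [← step] at key
  have : ∀ c : Fin n → ι, ∑ k, ∑ l, (fun c : Fin n → ι =>
      (∏ m ∈ (Finset.univ.erase i).erase j, (B (c m) (a m) : ℂ)) *
          (((h⁻¹ (c i) (c j) : ℝ) : ℂ) * S c))
            (Function.update (Function.update c i k) j l) = 0 := by
    intro c
    have h0 := hS c
    simp only [traceAt] at h0
    rw [← mul_zero (∏ m ∈ (Finset.univ.erase i).erase j, (B (c m) (a m) : ℂ)), ← h0]
    simp only [Finset.mul_sum]
    refine Finset.sum_congr rfl fun k _ => Finset.sum_congr rfl fun l _ => ?_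
    rw [Function.update_self, Function.update_of_ne hij, Function.update_self]
    congr 1
    refine Finset.prod_congr rfl fun m hm => ?_
    simp only [Finset.mem_erase] at hm
    rw [Function.update_of_ne hm.1, Function.update_of_ne hm.2.1]
  simp only [this, Finset.sum_const_zero] at key
  have := key.symm
  simpa [hN] using this

lemma sum_conj_traceSpan [Nonempty ι] {n : ℕ} {W S : (Fin n → ι) → ℂ}
    (hW : W ∈ traceSpan (1 : Matrix ι ι ℝ) n)
    (hS : ∀ i j : Fin n, i ≠ j → ∀ a, traceAt (1 : Matrix ι ι ℝ) i j S a = 0) :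
    ∑ a, star (W a) * S a = 0 := by
  induction hW using Submodule.span_induction with
  | zero => simp
  | add x y _ _ hx hy => simp [add_mul, Finset.sum_add_distrib] at hx hy ⊢; rw [hx, hy, add_zero]
  | smul r x _ hx =>
    simp only [Pi.smul_apply, smul_eq_mul, star_mul', mul_assoc]
    rw [← Finset.mul_sum, hx, mul_zero]
  | mem W hW =>
    obtain ⟨i, j, hij, Q, hQ, rfl⟩ := hW
    have hN : (Fintype.card ι : ℂ) ≠ 0 := by exact_mod_cast Fintype.card_ne_zero
    have key := sum_update₂ i j (fun a : Fin n → ι =>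
      star (((1 : Matrix ι ι ℝ) (a i) (a j) : ℂ) * Q a) * S a)
    have : ∀ a : Fin n → ι, ∑ k, ∑ l, (fun a : Fin n → ι =>
      star (((1 : Matrix ι ι ℝ) (a i) (a j) : ℂ) * Q a) * S a)
        (Function.update (Function.update a i k) j l) = 0 := by
      intro a
      have h0 := hS i j hij a
      rw [← mul_zero (star (Q a)), ← h0, traceAt]
      simp only [Finset.mul_sum]
      refine Finset.sum_congr rfl fun k _ => Finset.sum_congr rfl fun l _ => ?_
      rw [hQ, Function.update_self, Function.update_of_ne hij, Function.update_self, inv_one]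
      simp
      ring
    simp only [this, Finset.sum_const_zero] at key
    simpa [hN] using key.symm

lemma sum_star_self_eq_zero {α : Type} [Fintype α] {f : α → ℂ} (hf : ∑ a, star (f a) * f a = 0)
    (a : α) : f a = 0 := by
  have h2 : ∑ a, Complex.normSq (f a) = 0 := by
    have : ((∑ a, Complex.normSq (f a) : ℝ) : ℂ) = 0 := by
      rw [← hf]
      push_cast
      exact Finset.sum_congr rfl fun a _ => Complex.normSq_eq_conj_mul_self
    exact_mod_cast this
  have h3 := (Finset.sum_eq_zero_iff_of_nonneg fun a _ => Complex.normSq_nonneg (f a)).1 h2 a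
    (Finset.mem_univ a)
  exact Complex.normSq_eq_zero.1 h3

lemma exists_decomp [Nonempty ι] {n : ℕ} (T : (Fin n → ι) → ℂ) :
    ∃ S : (Fin n → ι) → ℂ, (∀ i j : Fin n, i ≠ j → ∀ a, traceAt (1 : Matrix ι ι ℝ) i j S a = 0) ∧
      T - S ∈ traceSpan (1 : Matrix ι ι ℝ) n := by
  let e := (WithLp.linearEquiv 2 ℂ ((Fin n → ι) → ℂ))
  let K : Submodule ℂ (EuclideanSpace ℂ (Fin n → ι)) :=
    (traceSpan (1 : Matrix ι ι ℝ) n).comap e.toLinearMap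
  obtain ⟨y, hy, z, hz, hyz⟩ := K.exists_add_mem_mem_orthogonal (e.symm T)
  refine ⟨e z, ?_, ?_⟩
  · intro i j hij a
    have hQ : ∀ (b : Fin n → ι) k l,
        traceAt (1 : Matrix ι ι ℝ) i j (e z) (Function.update (Function.update b i k) j l)
        = traceAt (1 : Matrix ι ι ℝ) i j (e z) b := by
      intro b k l
      unfold traceAt
      refine Finset.sum_congr rfl fun k' _ => Finset.sum_congr rfl fun l' _ => ?_
      congr 1
      refine congrArg (e z) ?_
      funext m
      simp only [Function.update_apply]
      split_ifs <;> rfl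
    have hmem : (e.symm fun b => (((1 : Matrix ι ι ℝ) (b i) (b j) : ℝ) : ℂ) *
        traceAt (1 : Matrix ι ι ℝ) i j (e z) b) ∈ K := by
      rw [Submodule.mem_comap, LinearEquiv.coe_coe, LinearEquiv.apply_symm_apply]
      exact Submodule.subset_span ⟨i, j, hij, _, hQ, rfl⟩
    have horth := hz _ hmem
    rw [PiLp.inner_apply] at horth
    have horth' : ∑ b, star ((((1 : Matrix ι ι ℝ) (b i) (b j) : ℝ) : ℂ) *
        traceAt (1 : Matrix ι ι ℝ) i j (e z) b) * e z b = 0 := by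
      rw [← horth]
      refine Finset.sum_congr rfl fun b _ => ?_
      rw [RCLike.inner_apply, mul_comm]
      rfl
    have key := sum_update₂ i j (fun b : Fin n → ι =>
      star ((((1 : Matrix ι ι ℝ) (b i) (b j) : ℝ) : ℂ) *
        traceAt (1 : Matrix ι ι ℝ) i j (e z) b) * e z b)
    rw [horth', mul_zero, mul_zero] at key
    have hterm : ∀ b : Fin n → ι, ∑ k, ∑ l, (fun b : Fin n → ι =>
        star ((((1 : Matrix ι ι ℝ) (b i) (b j) : ℝ) : ℂ) *
          traceAt (1 : Matrix ι ι ℝ) i j (e z) b) * e z b)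
          (Function.update (Function.update b i k) j l)
        = star (traceAt (1 : Matrix ι ι ℝ) i j (e z) b)
          * traceAt (1 : Matrix ι ι ℝ) i j (e z) b := by
      intro b
      conv_rhs => rhs; rw [traceAt]
      simp only [Finset.mul_sum]
      refine Finset.sum_congr rfl fun k _ => Finset.sum_congr rfl fun l _ => ?_
      rw [hQ, Function.update_self, Function.update_of_ne hij, Function.update_self, inv_one,
        star_mul']
      simp
      ring
    simp only [hterm] at key
    have hz0 := sum_star_self_eq_zero key
    exact hz0 a
  · have : T = e y + e z := by rw [← map_add, ← hyz, LinearEquiv.apply_symm_apply]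
    rw [this, add_sub_cancel_right]; exact hy

lemma symmetrize_symm {n : ℕ} (T : (Fin n → ι) → ℂ) (σ : Equiv.Perm (Fin n)) (a : Fin n → ι) :
    symmetrize T (a ∘ σ) = symmetrize T a := by
  unfold symmetrize
  congr 1
  exact Equiv.sum_comp (Equiv.mulLeft σ) (fun τ : Equiv.Perm (Fin n) => T (a ∘ τ))

lemma update_comp_perm {n : ℕ} (σ : Equiv.Perm (Fin n)) (a : Fin n → ι) (i j : Fin n) (k l : ι) :
    Function.update (Function.update a i k) j l ∘ σ
      = Function.update (Function.update (a ∘ σ) (σ.symm i) k) (σ.symm j) l := by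
  rw [Function.update_comp_equiv, Function.update_comp_equiv]

lemma symmetrize_mem {h : Matrix ι ι ℝ} {n : ℕ} {W : (Fin n → ι) → ℂ} (hW : W ∈ traceSpan h n) :
    symmetrize W ∈ traceSpan h n := by
  have hperm : ∀ σ : Equiv.Perm (Fin n), (fun a : Fin n → ι => W (a ∘ σ)) ∈ traceSpan h n := by
    intro σ
    induction hW using Submodule.span_induction with
    | zero => exact Submodule.zero_mem _
    | add x y _ _ hx hy => exact Submodule.add_mem _ hx hy
    | smul r x _ hx => exact Submodule.smul_mem _ r hx
    | mem W hW =>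
      obtain ⟨i, j, hij, Q, hQ, rfl⟩ := hW
      refine Submodule.subset_span ⟨σ i, σ j, fun e => hij (σ.injective e),
        fun a => Q (a ∘ σ), ?_, rfl⟩
      intro a k l
      dsimp only
      rw [update_comp_perm]
      simpa using hQ (a ∘ σ) k l
  have : symmetrize W = ((n.factorial : ℂ))⁻¹ •
      ∑ σ : Equiv.Perm (Fin n), (fun a : Fin n → ι => W (a ∘ σ)) := by
    funext a; simp [symmetrize]
  rw [this]
  exact Submodule.smul_mem _ _ (Submodule.sum_mem _ fun σ _ => hperm σ)

lemma traceAt_symmetrize {h : Matrix ι ι ℝ} {n : ℕ} {S : (Fin n → ι) → ℂ}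
    (hS : ∀ i j : Fin n, i ≠ j → ∀ a, traceAt h i j S a = 0) {i j : Fin n} (hij : i ≠ j)
    (a : Fin n → ι) : traceAt h i j (symmetrize S) a = 0 := by
  have : traceAt h i j (symmetrize S) a = ((n.factorial : ℂ))⁻¹ *
      ∑ σ : Equiv.Perm (Fin n), traceAt h (σ.symm i) (σ.symm j) S (a ∘ σ) := by
    simp only [traceAt, symmetrize, update_comp_perm, Finset.mul_sum]
    rw [Finset.sum_congr rfl fun k _ => Finset.sum_comm, Finset.sum_comm]
    refine Finset.sum_congr rfl fun σ _ => Finset.sum_congr rfl fun k _ =>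
      Finset.sum_congr rfl fun l _ => ?_
    ring
  rw [this, Finset.sum_eq_zero, mul_zero]
  intro σ _
  exact hS _ _ (fun e => hij (σ.symm.injective e)) _

lemma symmetrize_sub {n : ℕ} (T S : (Fin n → ι) → ℂ) :
    symmetrize (T - S) = symmetrize T - symmetrize S := by
  funext a; simp [symmetrize, mul_sub]

/-- For a positive definite `h` the totally symmetric trace-free part exists and is unique. -/
theorem existsUnique_stfPart [Nonempty ι] {h : Matrix ι ι ℝ} (hh : h.PosDef) {n : ℕ}
    (T : (Fin n → ι) → ℂ) : ∃! S, IsSTFPart h T S := by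
  obtain ⟨B, hB, rfl⟩ : ∃ B : Matrix ι ι ℝ, IsUnit B ∧ h = B.transpose * B := by
    open scoped MatrixOrder in
    obtain ⟨B, hB⟩ := CStarAlgebra.nonneg_iff_eq_star_mul_self.mp hh.posSemidef.nonneg
    have hB' : h = B.transpose * B := by
      rw [hB, Matrix.star_eq_conjTranspose, Matrix.conjTranspose_eq_transpose_of_trivial]
    refine ⟨B, ?_, hB'⟩
    have hu := (Matrix.isUnit_iff_isUnit_det _).1 hh.isUnit
    rw [hB', Matrix.det_mul] at hu
    exact (Matrix.isUnit_iff_isUnit_det _).2 (isUnit_of_mul_isUnit_right hu)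
  have hdet : IsUnit B.det := (Matrix.isUnit_iff_isUnit_det B).1 hB
  have hdet' : IsUnit (B⁻¹).det := by rwa [Matrix.isUnit_nonsing_inv_det_iff]
  have hto : B.transpose * 1 * B = B.transpose * B := by rw [Matrix.mul_one]
  have hback : (B⁻¹).transpose * (B.transpose * B) * B⁻¹ = 1 := by
    rw [Matrix.mul_assoc, Matrix.mul_assoc, Matrix.mul_nonsing_inv _ hdet, Matrix.mul_one,
      ← Matrix.transpose_mul, Matrix.mul_nonsing_inv _ hdet, Matrix.transpose_one]
  obtain ⟨S₀, htf, hmem⟩ := exists_decomp (chg B⁻¹ T)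
  have hT : chg B (chg B⁻¹ T) = T := by
    rw [chg_chg, Matrix.nonsing_inv_mul _ hdet, chg_one]
  have hS' : IsSTFPart (B.transpose * B) T (symmetrize (chg B S₀)) := by
    refine ⟨symmetrize_symm _, ?_, ?_⟩
    · intro i j hij a
      refine traceAt_symmetrize (fun i j hij a => ?_) hij a
      rw [← hto]
      exact traceAt_chg 1 B hdet hij (htf i j hij) a
    · have h1 := chg_mem_traceSpan 1 B hmem
      rw [hto, map_sub, hT] at h1
      have h2 := symmetrize_mem h1
      rw [symmetrize_sub] at h2
      exact h2
  refine ⟨symmetrize (chg B S₀), hS', ?_⟩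
  · intro S hS
    set S' := symmetrize (chg B S₀)
    have hD : S - S' ∈ traceSpan (B.transpose * B) n := by
      have := Submodule.sub_mem _ hS'.differ hS.differ
      convert this using 1
      funext a; simp
    have h1 := chg_mem_traceSpan _ B⁻¹ hD
    rw [hback] at h1
    have h2 : ∀ i j : Fin n, i ≠ j → ∀ a, traceAt (1 : Matrix ι ι ℝ) i j (chg B⁻¹ (S - S')) a = 0 := by
      intro i j hij a
      rw [← hback]
      refine traceAt_chg _ B⁻¹ hdet' hij (fun b => ?_) a
      have e1 := hS.traceFree i j hij b
      have e2 := hS'.traceFree i j hij b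
      simp only [traceAt] at e1 e2 ⊢
      simp only [Pi.sub_apply, mul_sub, Finset.sum_sub_distrib, e1, e2, sub_zero]
    have h3 := sum_conj_traceSpan h1 h2
    have h4 : chg B⁻¹ (S - S') = 0 := funext fun a => sum_star_self_eq_zero h3 a
    have h5 : chg B (chg B⁻¹ (S - S')) = S - S' := by
      rw [chg_chg, Matrix.nonsing_inv_mul _ hdet, chg_one]
    rw [h4, map_zero] at h5
    exact (sub_eq_zero.1 h5.symm)

lemma stfPart_spec [Nonempty ι] {h : Matrix ι ι ℝ} (hh : h.PosDef) {n : ℕ}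
    (T : (Fin n → ι) → ℂ) : IsSTFPart h T (stfPart h T) :=
  Classical.epsilon_spec (existsUnique_stfPart hh T).exists

end WellDefined

/-! ### The multipole recursion -/

/-- The tensors `P`, `P_{a₁}`, `P_{a₁a₂}`, … generated by the recursion
`P_{a₁…aₙ} = C[D_{a₁} P_{a₂…aₙ} - (n-1)(2n-3)/2 R_{a₁a₂} P_{a₃…aₙ}]` from a scalar `P`. -/
def multipoleTensor (G : (ι → ℝ) → Matrix ι ι ℝ) (P : (ι → ℝ) → ℂ) :
    (n : ℕ) → (ι → ℝ) → (Fin n → ι) → ℂ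
  | 0 => fun x _ => P x
  | 1 => fun x => stfPart (G x) (covDeriv G (multipoleTensor G P 0) x)
  | n + 2 => fun x => stfPart (G x) fun a =>
      covDeriv G (multipoleTensor G P (n + 1)) x a
        - (((n : ℂ) + 1) * (2 * (n : ℂ) + 1) / 2) * (ricci G x (a 0) (a 1) : ℂ)
          * multipoleTensor G P n x (fun k => a k.succ.succ)

end Calculus

/-! ### Stationary axisymmetric vacuum spacetimes near infinity -/

/-- Signature `(-,+,+,+)`. -/
def IsLorentzian (A : Matrix (Fin 4) (Fin 4) ℝ) : Prop :=
  ∃ E : Matrix (Fin 4) (Fin 4) ℝ, IsUnit E.det ∧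
    E.transpose * A * E = Matrix.diagonal ![-1, 1, 1, 1]

/-- Rotation of space by the angle `θ` about the `z`-axis. -/
def rot (θ : ℝ) : Matrix (Fin 3) (Fin 3) ℝ :=
  !![Real.cos θ, -Real.sin θ, 0; Real.sin θ, Real.cos θ, 0; 0, 0, 1]

/-- The same rotation acting on `(t, x, y, z)`. -/
def rotTime (θ : ℝ) : Matrix (Fin 4) (Fin 4) ℝ :=
  !![1, 0, 0, 0; 0, Real.cos θ, -Real.sin θ, 0; 0, Real.sin θ, Real.cos θ, 0; 0, 0, 0, 1]

/-- The Levi-Civita symbol. -/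
def leviCivita (p : Fin 4 → Fin 4) : ℝ :=
  Matrix.det (Matrix.of fun i j => if p i = j then (1 : ℝ) else 0)

/-- The volume form `ε_{abcd}` of `g` for the orientation `s`. -/
def volumeForm (s : ℤˣ) (g : (Fin 4 → ℝ) → Matrix (Fin 4) (Fin 4) ℝ) (x : Fin 4 → ℝ)
    (a b c d : Fin 4) : ℝ :=
  ((s : ℤ) : ℝ) * √|(g x).det| * leviCivita ![a, b, c, d]

/-- The twist covector `ε_{abcd} ξᵇ ∇ᶜ ξᵈ` of a vector field `ξ`. -/
def twistForm (s : ℤˣ) (g : (Fin 4 → ℝ) → Matrix (Fin 4) (Fin 4) ℝ)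
    (ξ : (Fin 4 → ℝ) → Fin 4 → ℝ) (x : Fin 4 → ℝ) (a : Fin 4) : ℝ :=
  ∑ b, ∑ c, ∑ d, volumeForm s g x a b c d * ξ x b *
    ∑ e, (g x)⁻¹ c e * (pd e (fun y => ξ y d) x + ∑ f, christoffel g x d e f * ξ x f)

/-- An end of a stationary, axisymmetric, vacuum spacetime.  The coordinates are `(t, x, y, z)`;
the Killing vector field `ξ = ∂/∂t` is timelike, and rotations about the `z`-axis act by
isometries.  The trajectories of `ξ` are labelled by the points `(x, y, z) ≠ 0` of `U`, where `U` is
a neighbourhood of the point at infinity `Λ = 0`. -/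
structure Spacetime where
  /-- The space of trajectories with the point at infinity added. -/
  U : Set (Fin 3 → ℝ)
  isOpen_U : IsOpen U
  zero_mem : (0 : Fin 3 → ℝ) ∈ U
  rot_mem : ∀ θ : ℝ, ∀ x ∈ U, (rot θ).mulVec x ∈ U
  /-- The spacetime metric. -/
  g : (Fin 4 → ℝ) → Matrix (Fin 4) (Fin 4) ℝ
  /-- The orientation of the spacetime relative to the coordinates `(t, x, y, z)`. -/
  orientation : ℤˣ
  smooth : ∀ a b, ContDiffOn ℝ (⊤ : ℕ∞) (fun x => g x a b)
    {x | Matrix.vecTail x ∈ U ∧ Matrix.vecTail x ≠ 0}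
  lorentzian : ∀ x, Matrix.vecTail x ∈ U → Matrix.vecTail x ≠ 0 → IsLorentzian (g x)
  stationary : ∀ x, Matrix.vecTail x ∈ U → Matrix.vecTail x ≠ 0 →
    ∀ s : ℝ, g (x + s • Pi.single 0 1) = g x
  timelike : ∀ x, Matrix.vecTail x ∈ U → Matrix.vecTail x ≠ 0 → g x 0 0 < 0
  axisymmetric : ∀ x, Matrix.vecTail x ∈ U → Matrix.vecTail x ≠ 0 →
    ∀ θ : ℝ, (rotTime θ).transpose * g ((rotTime θ).mulVec x) * rotTime θ = g x
  vacuum : ∀ x, Matrix.vecTail x ∈ U → Matrix.vecTail x ≠ 0 → ∀ a b, ricci g x a b = 0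

namespace Spacetime

/-- The 3-manifold of trajectories, `V = U \ {Λ}`. -/
def V (M : Spacetime) : Set (Fin 3 → ℝ) := M.U \ {0}

/-- The stationary Killing vector field `ξ = ∂/∂t`. -/
def xi (_M : Spacetime) : (Fin 4 → ℝ) → Fin 4 → ℝ := fun _ => Pi.single 0 1

/-- `ξₐ`. -/
def xiLower (M : Spacetime) (x : Fin 4 → ℝ) (a : Fin 4) : ℝ := ∑ b, M.g x a b * M.xi x b

/-- `-ξᵃξₐ`. -/
def normOnM (M : Spacetime) (x : Fin 4 → ℝ) : ℝ := -∑ a, M.xi x a * M.xiLower x a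

/-- The norm `λ`, as a function on the space of trajectories. -/
def lam (M : Spacetime) (x : Fin 3 → ℝ) : ℝ := M.normOnM (Matrix.vecCons 0 x)

/-- The metric `h = λ g + ξ ⊗ ξ` on the space of trajectories. -/
def h (M : Spacetime) (x : Fin 3 → ℝ) : Matrix (Fin 3) (Fin 3) ℝ :=
  Matrix.of fun i j => M.lam x * M.g (Matrix.vecCons 0 x) i.succ j.succ
    + M.xiLower (Matrix.vecCons 0 x) i.succ * M.xiLower (Matrix.vecCons 0 x) j.succ

/-- `ω` is the twist on the space of trajectories: `∇ₐ ω = ε_{abcd} ξᵇ ∇ᶜ ξᵈ`. -/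
structure IsTwist (M : Spacetime) (ω : (Fin 3 → ℝ) → ℝ) : Prop where
  smooth : ContDiffOn ℝ (⊤ : ℕ∞) ω M.V
  grad : ∀ x, Matrix.vecTail x ∈ M.V → ∀ a,
    pd a (fun y : Fin 4 → ℝ => ω (Matrix.vecTail y)) x = twistForm M.orientation M.g M.xi x a

/-- A function on the space of trajectories is axisymmetric. -/
def IsAxisymmetric {E : Type} (M : Spacetime) (f : (Fin 3 → ℝ) → E) : Prop :=
  ∀ θ : ℝ, ∀ x ∈ M.V, f ((rot θ).mulVec x) = f x

end Spacetime

/-- The components, in Cartesian coordinates `x = ρ cos φ`, `y = ρ sin φ`, `z`, of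
`e^{2κ} (ρ² e^{-2β} dφ² + dρ² + dz²)`. -/
def axialMetric (β κ : (Fin 3 → ℝ) → ℝ) (x : Fin 3 → ℝ) : Matrix (Fin 3) (Fin 3) ℝ :=
  let ρ : ℝ := √(x 0 ^ 2 + x 1 ^ 2)
  let dφ : Fin 3 → ℝ := ![-x 1 / ρ ^ 2, x 0 / ρ ^ 2, 0]
  let dρ : Fin 3 → ℝ := ![x 0 / ρ, x 1 / ρ, 0]
  let dz : Fin 3 → ℝ := ![0, 0, 1]
  Matrix.of fun i j => Real.exp (2 * κ x) *
    (ρ ^ 2 * Real.exp (-2 * β x) * dφ i * dφ j + dρ i * dρ j + dz i * dz j)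

/-- Asymptotic flatness: a conformal completion of `V` by the single point `Λ = 0`, for which the
rescaled metric has the form `e^{2κ} (ρ² e^{-2β} dφ² + dρ² + dz²)` off the axis. -/
structure Completion (M : Spacetime) where
  /-- The conformal factor. -/
  Ω : (Fin 3 → ℝ) → ℝ
  /-- The rescaled metric. -/
  hTilde : (Fin 3 → ℝ) → Matrix (Fin 3) (Fin 3) ℝ
  β : (Fin 3 → ℝ) → ℝ
  κ : (Fin 3 → ℝ) → ℝ
  smooth_factor : ContDiffOn ℝ (⊤ : ℕ∞) Ω M.U
  factor_pos : ∀ x ∈ M.V, 0 < Ω x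
  smooth_metric : ∀ i j, ContDiffOn ℝ (⊤ : ℕ∞) (fun x => hTilde x i j) M.U
  posDef : ∀ x ∈ M.U, (hTilde x).PosDef
  conformal : ∀ x ∈ M.V, hTilde x = Ω x ^ 2 • M.h x
  factor_zero : Ω 0 = 0
  factor_grad : ∀ i, pd i Ω 0 = 0
  factor_hess : ∀ i j, hessian hTilde Ω 0 i j = 2 * hTilde 0 i j
  axial_beta : M.IsAxisymmetric β
  axial_kappa : M.IsAxisymmetric κ
  kappa_zero : κ 0 = 0
  metric_form : ∀ x ∈ M.U, (x 0 ≠ 0 ∨ x 1 ≠ 0) → hTilde x = axialMetric β κ x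

/-! ### Potentials and leading order functions -/

/-- The Hansen potential `-(λ² - 1 + ω² + 2iω) / (4λ)`. -/
def hansen (lam ω : (Fin 3 → ℝ) → ℝ) (x : Fin 3 → ℝ) : ℂ :=
  -((lam x : ℂ) ^ 2 - 1 + (ω x : ℂ) ^ 2 + 2 * Complex.I * (ω x : ℂ)) / (4 * (lam x : ℂ))

/-- The Ernst potential `(1 - λ - iω) / (1 + λ + iω)`. -/
def ernst (lam ω : (Fin 3 → ℝ) → ℝ) (x : Fin 3 → ℝ) : ℂ :=
  (1 - (lam x : ℂ) - Complex.I * (ω x : ℂ)) / (1 + (lam x : ℂ) + Complex.I * (ω x : ℂ))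

/-- The rescaled potential `φ / √Ω`, with its limit as the value at `Λ = 0`. -/
def rescale (Ω : (Fin 3 → ℝ) → ℝ) (φ : (Fin 3 → ℝ) → ℂ) : (Fin 3 → ℝ) → ℂ :=
  Function.update (fun x => φ x / ((√(Ω x) : ℝ) : ℂ)) 0
    (Filter.limUnder (𝓝[≠] (0 : Fin 3 → ℝ)) fun x => φ x / ((√(Ω x) : ℝ) : ℂ))

/-- An axisymmetric function on space as a function of `(z, ρ)`, extended to all real `ρ`
as an even function. -/
def profile (f : (Fin 3 → ℝ) → ℂ) (p : ℝ × ℝ) : ℂ := f ![p.2, 0, p.1]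

/-- `y` is, near `0`, the leading order function `y(r) = u(r, -ir)` of the real analytic function
`u(z, ρ)`, where `u` is extended to complex arguments by its power series. -/
def IsLeadingOrder (u : ℝ × ℝ → ℂ) (y : ℝ → ℂ) : Prop :=
  ∃ G : ℂ × ℂ → ℂ, AnalyticAt ℂ G 0 ∧
    (∀ᶠ p : ℝ × ℝ in 𝓝 0, G ((p.1 : ℂ), (p.2 : ℂ)) = u p) ∧
    ∀ᶠ r : ℝ in 𝓝 0, y r = G ((r : ℂ), -Complex.I * (r : ℂ))

end

end Multipole

open Multipole

namespace Multipole

noncomputable section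

set_option linter.unusedSectionVars false

/-! ### Partial derivatives -/

section PartialDerivatives

variable {ι : Type} [Fintype ι] [DecidableEq ι]

section Vector

variable {E : Type} [NormedAddCommGroup E] [NormedSpace ℝ E]

/-! Everything is read off along the complex null vector `v = ∂_z - i ∂_ρ` of a meridian half-plane
(`nullDir θ`, a vector field with constant components). In the ρz-plane the rescaled metric is
`e^{2κ}` times the Euclidean one, so on the half-plane `v` is null and, up to scaling, geodesic:
`D_v v = 2 v(κ) v`. Contraction with a null vector sees neither symmetrization nor trace terms.
Hence for `f_n = P(v, …, v)`, with `P` of rank `n`, the tensor recursion becomes the scalar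
recursion `f_{n+2} = v f_{n+1} - 2(n+1) v(κ) f_{n+1} - ½(n+1)(2n+1) Ric(v,v) f_n`. So `f_n(Λ)`
depends only on the geometry and on the iterated derivatives of the rescaled potential along `v` at
`Λ`. Conversely, the metric at `Λ` is Euclidean, and a symmetric trace-free tensor annihilated by
all the null vectors `nullDir θ` is zero. This is `multipoleTensor_eq_of_jetZero`. Since `v` is the
derivative along `r ↦ (r, -ir)`, part (b) follows with `jetZero_of_leadingOrder`.

For part (a), `φ_E = 2φ_H / (1 + √(1 + 4|φ_H|²))` and `|φ_H|² = Ω |φ̃_H|²`. Thus `φ̃_E` is analytic,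
and `φ̃_E - φ̃_H` is `Ω` times an analytic function. What remains is that all derivatives of `Ω`
along `v` vanish at `Λ`, and here the vacuum equations enter. Their null-null component, rescaled
conformally, reads `Ω'' - 2κ'Ω' + Ric(v,v) Ω = Ω E'F' / (2λ²)` with `E = λ + iω`, `F = λ - iω`, a
prime denoting `v`. In terms of `ψ = φ̃_E` and its conjugate `χ` the right side is `2(½Ω'ψ +
Ωψ')(½Ω'χ + Ωχ') / (1 - Ωψχ)²`. With one factor counted as a coefficient, this is a homogeneous
linear second order equation for `Ω` with coefficients smooth at `Λ`. As `Ω` and `Ω'` vanish there,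
so do all further derivatives (`Completion.jetZero_factor_zero`).

These identities hold on a half-plane only, but its closure contains `Λ` and `v` is tangent to it in
the complexified sense. A smooth function vanishing on it therefore has vanishing jets along `v` at
`Λ` (`JetZero.of_halfPlane`). Axial symmetry carries results from azimuth 0 to every azimuth
(`JetZero.rotate`); the symmetry of `Ω` and of `ω` is itself derived. -/

lemma pd_congr {f g : (ι → ℝ) → E} {x : ι → ℝ} (h : f =ᶠ[𝓝 x] g) (i : ι) :
    pd i f x = pd i g x := by
  unfold pd; rw [h.fderiv_eq]

lemma pd_eventuallyEq {f g : (ι → ℝ) → E} {x : ι → ℝ} (h : f =ᶠ[𝓝 x] g) (i : ι) :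
    pd i f =ᶠ[𝓝 x] pd i g := by
  filter_upwards [h.eventuallyEq_nhds] with y hy using pd_congr hy i

lemma pd_const (c : E) (i : ι) (x : ι → ℝ) : pd i (fun _ => c) x = 0 := by
  simp [pd]

lemma pd_add {f g : (ι → ℝ) → E} {x : ι → ℝ} (hf : DifferentiableAt ℝ f x)
    (hg : DifferentiableAt ℝ g x) (i : ι) :
    pd i (fun y => f y + g y) x = pd i f x + pd i g x := by
  unfold pd; rw [fderiv_fun_add hf hg]; rfl

lemma pd_sub {f g : (ι → ℝ) → E} {x : ι → ℝ} (hf : DifferentiableAt ℝ f x)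
    (hg : DifferentiableAt ℝ g x) (i : ι) :
    pd i (fun y => f y - g y) x = pd i f x - pd i g x := by
  unfold pd; rw [fderiv_fun_sub hf hg]; rfl

lemma pd_neg {f : (ι → ℝ) → E} {x : ι → ℝ} (i : ι) :
    pd i (fun y => -f y) x = -pd i f x := by
  unfold pd; rw [fderiv_fun_neg]; rfl

lemma pd_sum {α : Type} (s : Finset α) {f : α → (ι → ℝ) → E} {x : ι → ℝ}
    (hf : ∀ a ∈ s, DifferentiableAt ℝ (f a) x) (i : ι) :
    pd i (fun y => ∑ a ∈ s, f a y) x = ∑ a ∈ s, pd i (f a) x := by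
  unfold pd; rw [fderiv_fun_sum hf]; simp

lemma contDiffAt_pd {f : (ι → ℝ) → E} {x : ι → ℝ} {m n : WithTop ℕ∞} (hf : ContDiffAt ℝ n f x)
    (hmn : m + 1 ≤ n) (i : ι) : ContDiffAt ℝ m (pd i f) x :=
  (hf.fderiv_right hmn).clm_apply contDiffAt_const

/-- Chain rule for the composition with a linear map. -/
lemma pd_comp_mulVec {κ : Type} [Fintype κ] [DecidableEq κ] {f : (κ → ℝ) → E} {x : ι → ℝ}
    (B : Matrix κ ι ℝ) (hf : DifferentiableAt ℝ f (B.mulVec x)) (i : ι) :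
    pd i (fun y => f (B.mulVec y)) x = ∑ j, B j i • pd j f (B.mulVec x) := by
  have hl : HasFDerivAt (fun y : ι → ℝ => B.mulVec y)
      (LinearMap.toContinuousLinearMap B.mulVecLin) x :=
    (LinearMap.toContinuousLinearMap B.mulVecLin).hasFDerivAt
  have h := (hf.hasFDerivAt.comp x hl).fderiv
  have h' : fderiv ℝ (fun y => f (B.mulVec y)) x = _ := h
  unfold pd
  rw [h']
  have e : B.mulVec (Pi.single i 1) = ∑ j, B j i • (Pi.single j (1 : ℝ) : κ → ℝ) := by
    rw [Matrix.mulVec_single_one, pi_eq_sum_univ' (B.col i)]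
    refine Finset.sum_congr rfl fun j _ => ?_
    ext k; simp [Pi.single_apply, eq_comm]
  simp only [ContinuousLinearMap.comp_apply, LinearMap.coe_toContinuousLinearMap',
    Matrix.mulVecLin_apply]
  rw [e, map_sum]
  simp

end Vector

lemma pd_mul {𝔸 : Type} [NormedCommRing 𝔸] [NormedAlgebra ℝ 𝔸] {f g : (ι → ℝ) → 𝔸} {x : ι → ℝ}
    (hf : DifferentiableAt ℝ f x) (hg : DifferentiableAt ℝ g x) (i : ι) :
    pd i (fun y => f y * g y) x = pd i f x * g x + f x * pd i g x := by
  unfold pd; rw [fderiv_fun_mul hf hg]; simp [mul_comm, add_comm]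

lemma pd_const_mul {𝔸 : Type} [NormedCommRing 𝔸] [NormedAlgebra ℝ 𝔸] {f : (ι → ℝ) → 𝔸}
    {x : ι → ℝ} (c : 𝔸) (hf : DifferentiableAt ℝ f x) (i : ι) :
    pd i (fun y => c * f y) x = c * pd i f x := by
  rw [pd_mul (differentiableAt_const c) hf, pd_const]; simp

lemma pd_ofReal {f : (ι → ℝ) → ℝ} {x : ι → ℝ} (hf : DifferentiableAt ℝ f x) (i : ι) :
    pd i (fun y => (f y : ℂ)) x = ((pd i f x : ℝ) : ℂ) := by
  have := (Complex.ofRealCLM.hasFDerivAt.comp x hf.hasFDerivAt).fderiv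
  have h' : fderiv ℝ (fun y => (f y : ℂ)) x = _ := this
  unfold pd; rw [h']; simp

lemma pd_comm {f : (ι → ℝ) → ℝ} {x : ι → ℝ} (hf : ContDiffAt ℝ 2 f x) (i j : ι) :
    pd i (pd j f) x = pd j (pd i f) x := by
  have hd : DifferentiableAt ℝ (fderiv ℝ f) x :=
    (hf.fderiv_right (m := 1) (by norm_num)).differentiableAt (by norm_num)
  have key : ∀ i j : ι, pd i (pd j f) x = fderiv ℝ (fderiv ℝ f) x (Pi.single i 1) (Pi.single j 1) := by
    intro i j
    unfold pd
    rw [fderiv_clm_apply hd (differentiableAt_const _)]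
    simp
  rw [key, key]
  exact (hf.isSymmSndFDerivAt (by simp)) _ _

end PartialDerivatives

/-! ### Christoffel symbols and the Ricci tensor in terms of the 2-jet of the metric -/

section Jets

variable {ι : Type} [Fintype ι] [DecidableEq ι]

lemma contDiffAt_det {m : WithTop ℕ∞} {G : (ι → ℝ) → Matrix ι ι ℝ} {x : ι → ℝ}
    (hG : ∀ i j, ContDiffAt ℝ m (fun y => G y i j) x) :
    ContDiffAt ℝ m (fun y => (G y).det) x := by
  simp only [Matrix.det_apply]
  refine ContDiffAt.sum fun σ _ => ContDiffAt.const_smul _ ?_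
  exact contDiffAt_prod fun i _ => hG _ _

lemma contDiffAt_inv {m : WithTop ℕ∞} {G : (ι → ℝ) → Matrix ι ι ℝ} {x : ι → ℝ}
    (hG : ∀ i j, ContDiffAt ℝ m (fun y => G y i j) x) (hx : (G x).det ≠ 0) (i j : ι) :
    ContDiffAt ℝ m (fun y => (G y)⁻¹ i j) x := by
  simp only [Matrix.inv_def, Matrix.smul_apply, Ring.inverse_eq_inv', smul_eq_mul,
    Matrix.adjugate_apply]
  refine ((contDiffAt_det hG).inv hx).mul (contDiffAt_det fun k l => ?_)
  by_cases h : k = j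
  · subst h; simp only [Matrix.updateRow_self]; exact contDiffAt_const
  · simp only [Matrix.updateRow_ne h]; exact hG k l

lemma contDiffAt_christoffel {m n : WithTop ℕ∞} {G : (ι → ℝ) → Matrix ι ι ℝ} {x : ι → ℝ}
    (hG : ∀ i j, ContDiffAt ℝ n (fun y => G y i j) x) (hmn : m + 1 ≤ n) (hx : (G x).det ≠ 0)
    (k i j : ι) : ContDiffAt ℝ m (fun y => christoffel G y k i j) x := by
  unfold christoffel
  refine contDiffAt_const.mul (ContDiffAt.sum fun l _ => ?_)
  exact (contDiffAt_inv (fun i j => (hG i j).of_le (le_self_add.trans hmn)) hx k l).mul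
    (((contDiffAt_pd (hG _ _) hmn _).add (contDiffAt_pd (hG _ _) hmn _)).sub
      (contDiffAt_pd (hG _ _) hmn _))

lemma contDiffAt_ricci {G : (ι → ℝ) → Matrix ι ι ℝ} {x : ι → ℝ}
    (hG : ∀ i j, ContDiffAt ℝ (⊤ : ℕ∞) (fun y => G y i j) x) (hx : (G x).det ≠ 0)
    (i j : ι) : ContDiffAt ℝ (⊤ : ℕ∞) (fun y => ricci G y i j) x := by
  have hC := contDiffAt_christoffel (m := (⊤ : ℕ∞)) hG (by simp) hx
  unfold ricci
  refine (ContDiffAt.sum fun k _ => ?_).add (ContDiffAt.sum fun k _ => ContDiffAt.sum fun l _ => ?_)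
  · exact (contDiffAt_pd (hC _ _ _) (by simp) _).sub (contDiffAt_pd (hC _ _ _) (by simp) _)
  · exact ((hC _ _ _).mul (hC _ _ _)).sub ((hC _ _ _).mul (hC _ _ _))

/-- The derivative of the inverse metric. -/
lemma pd_inv {G : (ι → ℝ) → Matrix ι ι ℝ} {x : ι → ℝ}
    (hG : ∀ i j, ContDiffAt ℝ 1 (fun y => G y i j) x) (hx : (G x).det ≠ 0) (m k l : ι) :
    pd m (fun y => (G y)⁻¹ k l) x
      = -∑ a, ∑ b, (G x)⁻¹ k a * pd m (fun y => G y a b) x * (G x)⁻¹ b l := by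
  have hdG : ∀ i j, DifferentiableAt ℝ (fun y => G y i j) x :=
    fun i j => (hG i j).differentiableAt (by norm_num)
  have hdH : ∀ i j, DifferentiableAt ℝ (fun y => (G y)⁻¹ i j) x :=
    fun i j => (contDiffAt_inv hG hx i j).differentiableAt (by norm_num)
  have hne : ∀ᶠ y in 𝓝 x, (G y).det ≠ 0 :=
    (contDiffAt_det hG).continuousAt.eventually_ne hx
  -- The identity `G⁻¹ G = 1` holds near `x` because the determinant stays nonzero. Differentiating
  -- it and multiplying by `G⁻¹` from the right gives the formula.
  have hprod : ∀ b, ∑ a, (pd m (fun y => (G y)⁻¹ k a) x * G x a b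
      + (G x)⁻¹ k a * pd m (fun y => G y a b) x) = 0 := by
    intro b
    have h1 : pd m (fun y => ∑ a, (G y)⁻¹ k a * G y a b) x = 0 := by
      rw [pd_congr (g := fun _ => (1 : Matrix ι ι ℝ) k b), pd_const]
      filter_upwards [hne] with y hy
      rw [← Matrix.mul_apply, Matrix.nonsing_inv_mul _ (isUnit_iff_ne_zero.2 hy)]
    rw [pd_sum _ fun a _ => (hdH k a).fun_mul (hdG a b)] at h1
    rw [← h1]
    exact Finset.sum_congr rfl fun a _ => (pd_mul (hdH k a) (hdG a b) m).symm
  set M : Matrix ι ι ℝ := Matrix.of fun k a => pd m (fun y => (G y)⁻¹ k a) x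
  set N : Matrix ι ι ℝ := Matrix.of fun a b => pd m (fun y => G y a b) x
  have e1 : ∀ b, (M * G x + (G x)⁻¹ * N) k b = 0 := by
    intro b
    rw [Matrix.add_apply, Matrix.mul_apply, Matrix.mul_apply, ← Finset.sum_add_distrib]
    exact hprod b
  have e2 : ((M * G x + (G x)⁻¹ * N) * (G x)⁻¹) k l = 0 := by
    rw [Matrix.mul_apply]; simp [e1]
  rw [Matrix.add_mul, Matrix.mul_assoc, Matrix.mul_nonsing_inv _ (isUnit_iff_ne_zero.2 hx),
    Matrix.mul_one, Matrix.add_apply, Matrix.mul_apply] at e2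
  have e3 : M k l = pd m (fun y => (G y)⁻¹ k l) x := rfl
  rw [← e3, eq_neg_of_add_eq_zero_left e2, Finset.sum_comm]
  simp only [Matrix.mul_apply, Finset.sum_mul]
  rfl

/-- The Ricci tensor at a point where the inverse metric is `diag e`, in terms of the first
derivatives `D` and the second derivatives `DD` of the metric. -/
def ricciJet (e : ι → ℝ) (D : ι → ι → ι → ℝ) (DD : ι → ι → ι → ι → ℝ) (i j : ι) : ℝ :=
  let L : ι → ι → ι → ℝ := fun l i j => D i l j + D j i l - D l i j
  let Γ : ι → ι → ι → ℝ := fun k i j => (1 / 2) * (e k * L k i j)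
  -- The subtracted sum is the derivative of the inverse metric, `∂G⁻¹ = -G⁻¹ (∂G) G⁻¹`.
  let dΓ : ι → ι → ι → ι → ℝ := fun m k i j => (1 / 2) *
    (e k * (DD m i k j + DD m j i k - DD m k i j) - ∑ l, e k * D m k l * e l * L l i j)
  ∑ k, (dΓ k k i j - dΓ j k i k) + ∑ k, ∑ l, (Γ k k l * Γ l i j - Γ k j l * Γ l i k)

/-- With a diagonal inverse metric the contractions collapse and the Ricci tensor becomes an
explicit polynomial in finitely many numbers. The reduction by the Killing field and the conformal
rescaling then turn into identities that `field_simp` and `ring` can settle. -/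
lemma ricci_eq_ricciJet {G : (ι → ℝ) → Matrix ι ι ℝ} {x : ι → ℝ} {e : ι → ℝ}
    (hG : ∀ i j, ContDiffAt ℝ 2 (fun y => G y i j) x) (hx : (G x).det ≠ 0)
    (he : (G x)⁻¹ = Matrix.diagonal e) (i j : ι) :
    ricci G x i j = ricciJet e (fun a b c => pd a (fun y => G y b c) x)
      (fun a b c d => pd a (pd b (fun y => G y c d)) x) i j := by
  have hG1 : ∀ i j, ContDiffAt ℝ 1 (fun y => G y i j) x := fun i j => (hG i j).of_le (by norm_num)
  have hΓ : ∀ k i j, christoffel G x k i j = (1 / 2) * (e k *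
      (pd i (fun y => G y k j) x + pd j (fun y => G y i k) x - pd k (fun y => G y i j) x)) := by
    intro k i j
    unfold christoffel
    rw [he, Finset.sum_eq_single k (fun l _ hl => by simp [Matrix.diagonal_apply_ne' _ hl])
      (by simp), Matrix.diagonal_apply_eq]
  have hpd : ∀ a b c, DifferentiableAt ℝ (pd a (fun y => G y b c)) x := fun a b c =>
    (contDiffAt_pd (m := 1) (hG b c) (by norm_num) a).differentiableAt (by norm_num)
  have hdH : ∀ i j, DifferentiableAt ℝ (fun y => (G y)⁻¹ i j) x :=
    fun i j => (contDiffAt_inv hG1 hx i j).differentiableAt (by norm_num)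
  have hdΓ : ∀ m k i j, pd m (fun y => christoffel G y k i j) x = (1 / 2) *
      (e k * (pd m (pd i (fun y => G y k j)) x + pd m (pd j (fun y => G y i k)) x
        - pd m (pd k (fun y => G y i j)) x) - ∑ l, e k * pd m (fun y => G y k l) x * e l *
      (pd i (fun y => G y l j) x + pd j (fun y => G y i l) x - pd l (fun y => G y i j) x)) := by
    intro m k i j
    unfold christoffel
    have hs : ∀ l, DifferentiableAt ℝ (fun y => pd i (fun y => G y l j) y
        + pd j (fun y => G y i l) y - pd l (fun y => G y i j) y) x := fun l =>
      ((hpd _ _ _).fun_add (hpd _ _ _)).fun_sub (hpd _ _ _)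
    rw [pd_const_mul _ (DifferentiableAt.fun_sum fun l _ => (hdH k l).fun_mul (hs l)),
      pd_sum _ (fun l _ => (hdH k l).fun_mul (hs l))]
    congr 1
    have : ∀ l, pd m (fun y => (G y)⁻¹ k l * (pd i (fun y => G y l j) y
        + pd j (fun y => G y i l) y - pd l (fun y => G y i j) y)) x
        = (Matrix.diagonal e k l) * (pd m (pd i (fun y => G y l j)) x
          + pd m (pd j (fun y => G y i l)) x - pd m (pd l (fun y => G y i j)) x)
          - e k * pd m (fun y => G y k l) x * e l *
      (pd i (fun y => G y l j) x + pd j (fun y => G y i l) x - pd l (fun y => G y i j) x) := by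
      intro l
      rw [pd_mul (hdH k l) (hs l), pd_inv hG1 hx, he]
      rw [Finset.sum_eq_single k (fun a _ ha => Finset.sum_eq_zero fun b _ => by
          simp [Matrix.diagonal_apply_ne' _ ha]) (by simp),
        Finset.sum_eq_single l (fun b _ hb => by simp [Matrix.diagonal_apply_ne _ hb]) (by simp),
        Matrix.diagonal_apply_eq, Matrix.diagonal_apply_eq,
        pd_sub ((hpd _ _ _).fun_add (hpd _ _ _)) (hpd _ _ _), pd_add (hpd _ _ _) (hpd _ _ _)]
      ring
    rw [Finset.sum_congr rfl fun l _ => this l, Finset.sum_sub_distrib,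
      Finset.sum_eq_single k (fun l _ hl => by simp [Matrix.diagonal_apply_ne' _ hl])
      (by simp), Matrix.diagonal_apply_eq]
  unfold ricci ricciJet
  simp only [hΓ, hdΓ]

end Jets

/-! ### Reduction of the Ricci tensor by a Killing field and under conformal rescaling -/

section JetIdentities

/-- The 2-jet of `h = λ g + ξ ⊗ ξ` in terms of that of a stationary metric `g` which is
`diag (-λ, a/λ, b/λ, a/λ)` at the point considered. -/
structure IsQuotientJet (lam a b : ℝ) (D : Fin 4 → Fin 4 → Fin 4 → ℝ)
    (DD : Fin 4 → Fin 4 → Fin 4 → Fin 4 → ℝ) (E : Fin 3 → Fin 3 → Fin 3 → ℝ)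
    (EE : Fin 3 → Fin 3 → Fin 3 → Fin 3 → ℝ) : Prop where
  symm₁ : ∀ m i j, D m i j = D m j i
  stat₁ : ∀ i j, D 0 i j = 0
  symm₂ : ∀ m n i j, DD m n i j = DD m n j i
  comm₂ : ∀ m n i j, DD m n i j = DD n m i j
  stat₂ : ∀ m i j, DD 0 m i j = 0
  first : ∀ m i j, E m i j = -D m.succ 0 0 * (if i = j then ![a, b, a] i / lam else 0)
    + lam * D m.succ i.succ j.succ
  second : ∀ m n i j, EE m n i j
    = -DD m.succ n.succ 0 0 * (if i = j then ![a, b, a] i / lam else 0)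
      - D m.succ 0 0 * D n.succ i.succ j.succ - D n.succ 0 0 * D m.succ i.succ j.succ
      + lam * DD m.succ n.succ i.succ j.succ + D m.succ 0 i.succ * D n.succ 0 j.succ
      + D n.succ 0 i.succ * D m.succ 0 j.succ

variable {lam a b : ℝ} {D : Fin 4 → Fin 4 → Fin 4 → ℝ} {DD : Fin 4 → Fin 4 → Fin 4 → Fin 4 → ℝ}
  {E : Fin 3 → Fin 3 → Fin 3 → ℝ} {EE : Fin 3 → Fin 3 → Fin 3 → Fin 3 → ℝ}

set_option linter.unusedSimpArgs false
set_option maxHeartbeats 1000000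

/-- Reduction along `∂/∂t`: besides the Ricci tensor of `g` there survive only the gradient of `g₀₀
= -λ` and the antisymmetrized derivatives of `g₀ᵢ`, which make up the twist. On the half-plane of
azimuth 0 the slots 0 and 2 are `∂_ρ` and `∂_z`. -/
lemma IsQuotientJet.ricciJet_offDiag (hJ : IsQuotientJet lam a b D DD E EE) (hl : lam ≠ 0)
    (ha : a ≠ 0) (hb : b ≠ 0) :
    ricciJet ![1 / a, 1 / b, 1 / a] E EE 0 2
      = ricciJet ![-1 / lam, lam / a, lam / b, lam / a] D DD 1 3 + 1 / (2 * lam ^ 2) *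
        (D 1 0 0 * D 3 0 0 + lam ^ 2 / b * (D 2 0 3 - D 3 0 2) * (D 1 0 2 - D 2 0 1)) := by
  obtain ⟨Ds, D0, DDs, DDc, DD0, hE, hEE⟩ := hJ
  simp [ricciJet, Fin.sum_univ_succ, hE, hEE, D0, DD0]
  simp only [Ds 1 1 0, Ds 1 2 0, Ds 1 3 0, Ds 1 2 1, Ds 1 3 1, Ds 1 3 2,
    Ds 2 1 0, Ds 2 2 0, Ds 2 3 0, Ds 2 2 1, Ds 2 3 1, Ds 2 3 2,
    Ds 3 1 0, Ds 3 2 0, Ds 3 3 0, Ds 3 2 1, Ds 3 3 1, Ds 3 3 2, DDc 2 1, DDc 3 1, DDc 3 2]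
  field_simp
  ring

/-- This difference and the off-diagonal component are exactly what `Ric(v, v) = R₂₂ - R₀₀ - 2i R₀₂`
requires for `v = (-i, 0, 1)`. Any multiple of `h` drops out of the difference, since `h` has equal
entries in the two slots. -/
lemma IsQuotientJet.ricciJet_diag (hJ : IsQuotientJet lam a b D DD E EE) (hl : lam ≠ 0)
    (ha : a ≠ 0) (hb : b ≠ 0) :
    ricciJet ![1 / a, 1 / b, 1 / a] E EE 2 2 - ricciJet ![1 / a, 1 / b, 1 / a] E EE 0 0
      = ricciJet ![-1 / lam, lam / a, lam / b, lam / a] D DD 3 3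
        - ricciJet ![-1 / lam, lam / a, lam / b, lam / a] D DD 1 1 + 1 / (2 * lam ^ 2) *
        (D 3 0 0 ^ 2 - D 1 0 0 ^ 2 + lam ^ 2 / b * ((D 1 0 2 - D 2 0 1) ^ 2
          - (D 2 0 3 - D 3 0 2) ^ 2)) := by
  obtain ⟨Ds, D0, DDs, DDc, DD0, hE, hEE⟩ := hJ
  simp [ricciJet, Fin.sum_univ_succ, hE, hEE, D0, DD0]
  simp only [Ds 1 1 0, Ds 1 2 0, Ds 1 3 0, Ds 1 2 1, Ds 1 3 1, Ds 1 3 2,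
    Ds 2 1 0, Ds 2 2 0, Ds 2 3 0, Ds 2 2 1, Ds 2 3 1, Ds 2 3 2,
    Ds 3 1 0, Ds 3 2 0, Ds 3 3 0, Ds 3 2 1, Ds 3 3 1, Ds 3 3 2, DDc 2 1, DDc 3 1, DDc 3 2,
    DDs 1 1 1 0, DDs 1 1 2 0, DDs 1 1 3 0, DDs 1 1 2 1, DDs 1 1 3 1, DDs 1 1 3 2,
    DDs 2 2 1 0, DDs 2 2 2 0, DDs 2 2 3 0, DDs 2 2 2 1, DDs 2 2 3 1, DDs 2 2 3 2,
    DDs 3 3 1 0, DDs 3 3 2 0, DDs 3 3 3 0, DDs 3 3 2 1, DDs 3 3 3 1, DDs 3 3 3 2,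
    DDs 1 2 1 0, DDs 1 2 2 0, DDs 1 2 3 0, DDs 1 2 2 1, DDs 1 2 3 1, DDs 1 2 3 2,
    DDs 1 3 1 0, DDs 1 3 2 0, DDs 1 3 3 0, DDs 1 3 2 1, DDs 1 3 3 1, DDs 1 3 3 2,
    DDs 2 3 1 0, DDs 2 3 2 0, DDs 2 3 3 0, DDs 2 3 2 1, DDs 2 3 3 1, DDs 2 3 3 2]
  field_simp
  ring

/-- The 2-jet of `f² h` in terms of the 2-jets of `f` and of a metric `h` which is `diag (a, b, a)`
at the point considered. -/
structure IsConformalJet (a b f : ℝ) (f₁ : Fin 3 → ℝ) (f₂ : Fin 3 → Fin 3 → ℝ)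
    (E : Fin 3 → Fin 3 → Fin 3 → ℝ) (EE : Fin 3 → Fin 3 → Fin 3 → Fin 3 → ℝ)
    (F : Fin 3 → Fin 3 → Fin 3 → ℝ) (FF : Fin 3 → Fin 3 → Fin 3 → Fin 3 → ℝ) : Prop where
  symm₁ : ∀ m i j, E m i j = E m j i
  symm₂ : ∀ m n i j, EE m n i j = EE m n j i
  comm₂ : ∀ m n i j, EE m n i j = EE n m i j
  comm : ∀ m n, f₂ m n = f₂ n m
  first : ∀ m i j, F m i j = 2 * f * f₁ m * (if i = j then ![a, b, a] i else 0) + f ^ 2 * E m i j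
  second : ∀ m n i j, FF m n i j = (2 * f₁ n * f₁ m + 2 * f * f₂ m n)
      * (if i = j then ![a, b, a] i else 0)
    + 2 * f * f₁ m * E n i j + 2 * f * f₁ n * E m i j + f ^ 2 * EE m n i j

variable {f : ℝ} {f₁ : Fin 3 → ℝ} {f₂ : Fin 3 → Fin 3 → ℝ}
  {F : Fin 3 → Fin 3 → Fin 3 → ℝ} {FF : Fin 3 → Fin 3 → Fin 3 → Fin 3 → ℝ}

/-- The Christoffel symbol of a metric with inverse `diag e` and first derivatives `D`. -/
def christoffelJet {ι : Type} (e : ι → ℝ) (D : ι → ι → ι → ℝ) (k i j : ι) : ℝ :=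
  (1 / 2) * (e k * (D i k j + D j i k - D k i j))

/-- In dimension three `Ric(h) - Ric(f²h)` is `1/f` times the Hessian of `f` for the metric `f²h`,
up to a multiple of the metric. That multiple is absent off the diagonal and cancels in the
difference taken in `IsConformalJet.ricciJet_diag`. -/
lemma IsConformalJet.ricciJet_offDiag (hJ : IsConformalJet a b f f₁ f₂ E EE F FF) (hf : f ≠ 0)
    (ha : a ≠ 0) (hb : b ≠ 0) :
    f * ricciJet ![1 / a, 1 / b, 1 / a] E EE 0 2
      = f * ricciJet ![1 / (f ^ 2 * a), 1 / (f ^ 2 * b), 1 / (f ^ 2 * a)] F FF 0 2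
        + (f₂ 0 2 - ∑ k, christoffelJet ![1 / (f ^ 2 * a), 1 / (f ^ 2 * b), 1 / (f ^ 2 * a)]
            F k 0 2 * f₁ k) := by
  obtain ⟨Es, EEs, EEc, fc, hF, hFF⟩ := hJ
  simp [ricciJet, christoffelJet, Fin.sum_univ_succ, hF, hFF]
  simp only [Es 0 1 0, Es 0 2 0, Es 0 2 1, Es 1 1 0, Es 1 2 0, Es 1 2 1, Es 2 1 0, Es 2 2 0,
    Es 2 2 1, EEc 1 0, EEc 2 0, EEc 2 1, fc 1 0, fc 2 0, fc 2 1]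
  field_simp
  ring

lemma IsConformalJet.ricciJet_diag (hJ : IsConformalJet a b f f₁ f₂ E EE F FF) (hf : f ≠ 0)
    (ha : a ≠ 0) (hb : b ≠ 0) :
    f * (ricciJet ![1 / a, 1 / b, 1 / a] E EE 2 2 - ricciJet ![1 / a, 1 / b, 1 / a] E EE 0 0)
      = f * (ricciJet ![1 / (f ^ 2 * a), 1 / (f ^ 2 * b), 1 / (f ^ 2 * a)] F FF 2 2
          - ricciJet ![1 / (f ^ 2 * a), 1 / (f ^ 2 * b), 1 / (f ^ 2 * a)] F FF 0 0)
        + (f₂ 2 2 - ∑ k, christoffelJet ![1 / (f ^ 2 * a), 1 / (f ^ 2 * b), 1 / (f ^ 2 * a)]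
            F k 2 2 * f₁ k)
        - (f₂ 0 0 - ∑ k, christoffelJet ![1 / (f ^ 2 * a), 1 / (f ^ 2 * b), 1 / (f ^ 2 * a)]
            F k 0 0 * f₁ k) := by
  obtain ⟨Es, EEs, EEc, fc, hF, hFF⟩ := hJ
  simp [ricciJet, christoffelJet, Fin.sum_univ_succ, hF, hFF]
  simp only [Es 0 1 0, Es 0 2 0, Es 0 2 1, Es 1 1 0, Es 1 2 0, Es 1 2 1, Es 2 1 0, Es 2 2 0,
    Es 2 2 1, EEc 1 0, EEc 2 0, EEc 2 1, fc 1 0, fc 2 0, fc 2 1,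
    EEs 0 0 1 0, EEs 0 0 2 0, EEs 0 0 2 1, EEs 1 1 1 0, EEs 1 1 2 0, EEs 1 1 2 1,
    EEs 2 2 1 0, EEs 2 2 2 0, EEs 2 2 2 1, EEs 0 1 1 0, EEs 0 1 2 0, EEs 0 1 2 1,
    EEs 0 2 1 0, EEs 0 2 2 0, EEs 0 2 2 1, EEs 1 2 1 0, EEs 1 2 2 0, EEs 1 2 2 1]
  field_simp
  ring

end JetIdentities

/-! ### Covariance under linear changes of coordinates -/

section LinearCovariance

variable {ι : Type} [Fintype ι] [DecidableEq ι]

/-- The pull-back of a metric by the linear map `B`. -/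
def pullback (B : Matrix ι ι ℝ) (G : (ι → ℝ) → Matrix ι ι ℝ) (x : ι → ℝ) : Matrix ι ι ℝ :=
  B.transpose * G (B.mulVec x) * B

lemma pullback_apply (B : Matrix ι ι ℝ) (G : (ι → ℝ) → Matrix ι ι ℝ) (x : ι → ℝ) (i j : ι) :
    pullback B G x i j = ∑ a, ∑ b, B a i * B b j * G (B.mulVec x) a b := by
  simp only [pullback, Matrix.mul_apply, Matrix.transpose_apply, Finset.sum_mul]
  rw [Finset.sum_comm]
  exact Finset.sum_congr rfl fun a _ => Finset.sum_congr rfl fun b _ => by ring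

lemma pullback_inv (B : Matrix ι ι ℝ) (G : (ι → ℝ) → Matrix ι ι ℝ) (x : ι → ℝ) :
    (pullback B G x)⁻¹ = B⁻¹ * (G (B.mulVec x))⁻¹ * B⁻¹.transpose := by
  rw [pullback, Matrix.mul_inv_rev, Matrix.mul_inv_rev, Matrix.transpose_nonsing_inv,
    Matrix.mul_assoc]

/-- The Christoffel symbol `Γᵏᵢⱼ` as the matrix indexed by `k` and `j`. -/
def connMatrix (G : (ι → ℝ) → Matrix ι ι ℝ) (x : ι → ℝ) (i : ι) : Matrix ι ι ℝ :=
  Matrix.of fun k j => christoffel G x k i j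

lemma pd_pullback {B : Matrix ι ι ℝ} {G : (ι → ℝ) → Matrix ι ι ℝ} {x : ι → ℝ}
    (hG : ∀ i j, DifferentiableAt ℝ (fun y => G y i j) (B.mulVec x)) (m i j : ι) :
    pd m (fun y => pullback B G y i j) x
      = ∑ a, ∑ b, ∑ c, B c m * B a i * B b j * pd c (fun y => G y a b) (B.mulVec x) := by
  have hc : ∀ a b, DifferentiableAt ℝ (fun y => G (B.mulVec y) a b) x := fun a b =>
    (hG a b).comp x (LinearMap.toContinuousLinearMap B.mulVecLin).differentiableAt
  simp only [pullback_apply]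
  rw [pd_sum _ fun a _ => DifferentiableAt.fun_sum fun b _ => (hc a b).const_mul _]
  refine Finset.sum_congr rfl fun a _ => ?_
  rw [pd_sum _ fun b _ => (hc a b).const_mul _]
  refine Finset.sum_congr rfl fun b _ => ?_
  rw [pd_const_mul _ (hc a b), pd_comp_mulVec (f := fun y => G y a b) B (hG a b), Finset.mul_sum]
  refine Finset.sum_congr rfl fun c _ => ?_
  rw [smul_eq_mul]; ring

/-- A linear change of coordinates has no second derivatives, so the inhomogeneous term of the
transformation law is missing: the matrices `Γ_i` are conjugated by `B` and mixed by `B` in the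
index `i`. -/
lemma christoffel_pullback {B : Matrix ι ι ℝ} (hB : IsUnit B.det)
    {G : (ι → ℝ) → Matrix ι ι ℝ} {x : ι → ℝ}
    (hG : ∀ i j, DifferentiableAt ℝ (fun y => G y i j) (B.mulVec x)) (i : ι) :
    connMatrix (pullback B G) x i
      = ∑ p, B p i • (B⁻¹ * connMatrix G (B.mulVec x) p * B) := by
  ext k j
  set w : ι → ℝ := fun a => ∑ c, ∑ b, B c i * B b j *
    (pd c (fun y => G y a b) (B.mulVec x) + pd b (fun y => G y c a) (B.mulVec x)
      - pd a (fun y => G y c b) (B.mulVec x)) with hw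
  have hlow : (fun l => pd i (fun y => pullback B G y l j) x + pd j (fun y => pullback B G y i l) x
      - pd l (fun y => pullback B G y i j) x) = B.transpose.mulVec w := by
    funext l
    simp only [pd_pullback hG, Matrix.mulVec, dotProduct, Matrix.transpose_apply, hw,
      Finset.mul_sum]
    have e1 : ∑ a, ∑ b, ∑ c, B c i * B a l * B b j * pd c (fun y => G y a b) (B.mulVec x)
        = ∑ a, ∑ c, ∑ b, B c i * B a l * B b j * pd c (fun y => G y a b) (B.mulVec x) :=
      Finset.sum_congr rfl fun a _ => Finset.sum_comm
    have e2 : ∑ a, ∑ b, ∑ c, B c j * B a i * B b l * pd c (fun y => G y a b) (B.mulVec x)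
        = ∑ a, ∑ c, ∑ b, B b j * B c i * B a l * pd b (fun y => G y c a) (B.mulVec x) :=
      Finset.sum_comm
    have e3 : ∑ a, ∑ b, ∑ c, B c l * B a i * B b j * pd c (fun y => G y a b) (B.mulVec x)
        = ∑ a, ∑ c, ∑ b, B a l * B c i * B b j * pd a (fun y => G y c b) (B.mulVec x) := by
      rw [Finset.sum_congr rfl fun a _ => Finset.sum_comm, Finset.sum_comm]
    rw [e1, e2, e3, ← Finset.sum_add_distrib, ← Finset.sum_sub_distrib]
    refine Finset.sum_congr rfl fun a _ => ?_
    rw [← Finset.sum_add_distrib, ← Finset.sum_sub_distrib]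
    refine Finset.sum_congr rfl fun c _ => ?_
    rw [← Finset.sum_add_distrib, ← Finset.sum_sub_distrib]
    exact Finset.sum_congr rfl fun b _ => by ring
  have hl : connMatrix (pullback B G) x i k j
      = (1 / 2) * ((pullback B G x)⁻¹.mulVec (B.transpose.mulVec w)) k := by
    rw [← hlow]; rfl
  have hBt : B⁻¹.transpose * B.transpose = 1 := by
    rw [← Matrix.transpose_mul, Matrix.mul_nonsing_inv _ hB, Matrix.transpose_one]
  rw [hl, Matrix.mulVec_mulVec, pullback_inv, Matrix.mul_assoc, hBt, Matrix.mul_one]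
  have hr : (∑ p, B p i • (B⁻¹ * connMatrix G (B.mulVec x) p * B)) k j
      = ∑ m, B⁻¹ k m * ∑ p, ∑ q, B p i * (connMatrix G (B.mulVec x) p m q * B q j) := by
    simp only [Matrix.sum_apply, Matrix.smul_apply, Matrix.mul_assoc, Matrix.mul_apply (M := B⁻¹),
      smul_eq_mul]
    simp only [Matrix.mul_apply, Finset.mul_sum]
    rw [Finset.sum_comm]
    refine Finset.sum_congr rfl fun m _ => Finset.sum_congr rfl fun p _ =>
      Finset.sum_congr rfl fun q _ => by ring
  rw [hr, ← Matrix.mulVec_mulVec]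
  simp only [Matrix.mulVec, dotProduct, Finset.mul_sum]
  refine Finset.sum_congr rfl fun m _ => ?_
  simp only [hw, connMatrix, Matrix.of_apply, christoffel, Finset.mul_sum, Finset.sum_mul]
  rw [Finset.sum_comm]
  refine Finset.sum_congr rfl fun p _ => ?_
  rw [Finset.sum_comm]
  refine Finset.sum_congr rfl fun q _ => Finset.sum_congr rfl fun l _ => by ring

/-- Grouped as `∂_m Γ_i + Γ_m Γ_i`, the terms form matrices that are conjugated by `B` as a whole.
The trace does not see the conjugation, and the other contraction absorbs one factor `B⁻¹`; this
yields the covariance of the Ricci tensor. -/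
lemma ricci_eq_connMatrix (G : (ι → ℝ) → Matrix ι ι ℝ) (x : ι → ℝ) (i j : ι) :
    ricci G x i j
      = ∑ k, (Matrix.of (fun a b => pd k (fun y => connMatrix G y i a b) x)
          + connMatrix G x k * connMatrix G x i) k j
        - (Matrix.of (fun a b => pd j (fun y => connMatrix G y i a b) x)
          + connMatrix G x j * connMatrix G x i).trace := by
  simp only [ricci, Matrix.trace, Matrix.diag, Matrix.add_apply, Matrix.of_apply, Matrix.mul_apply,
    Finset.sum_add_distrib, Finset.sum_sub_distrib, connMatrix]
  ring

/-- The Ricci tensor of the pull-back of a metric by a linear map. -/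
lemma ricci_pullback {B : Matrix ι ι ℝ} (hB : IsUnit B.det)
    {G : (ι → ℝ) → Matrix ι ι ℝ} {x : ι → ℝ}
    (hG : ∀ i j, ContDiffAt ℝ 2 (fun y => G y i j) (B.mulVec x)) (hx : (G (B.mulVec x)).det ≠ 0)
    (i j : ι) :
    ricci (pullback B G) x i j = ∑ q, ∑ r, B q i * B r j * ricci G (B.mulVec x) q r := by
  have hcont : Continuous fun y : ι → ℝ => B.mulVec y :=
    (LinearMap.toContinuousLinearMap B.mulVecLin).continuous
  have hev : ∀ᶠ y in 𝓝 x, ∀ i j, DifferentiableAt ℝ (fun y => G y i j) (B.mulVec y) := by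
    have : ∀ i j, ∀ᶠ y in 𝓝 (B.mulVec x), DifferentiableAt ℝ (fun y => G y i j) y := fun i j => by
      filter_upwards [(hG i j).eventually (by simp)] with y hy
      exact hy.differentiableAt (by norm_num)
    have h2 := hcont.continuousAt.tendsto.eventually
      (Filter.eventually_all.2 fun i => Filter.eventually_all.2 fun j => this i j)
    exact h2
  have hΓd : ∀ k i j, DifferentiableAt ℝ (fun y => connMatrix G y i k j) (B.mulVec x) :=
    fun k i j => (contDiffAt_christoffel (m := 1) hG (by norm_num) hx k i j).differentiableAt
      (by norm_num)
  have hΓc : ∀ k i j, DifferentiableAt ℝ (fun y => connMatrix G (B.mulVec y) i k j) x :=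
    fun k i j => (hΓd k i j).comp x (LinearMap.toContinuousLinearMap B.mulVecLin).differentiableAt
  have hT : ∀ m i, Matrix.of (fun a b => pd m (fun y => connMatrix (pullback B G) y i a b) x)
      = ∑ p, ∑ q, (B p m * B q i) • (B⁻¹ * Matrix.of (fun a b =>
        pd p (fun y => connMatrix G y q a b) (B.mulVec x)) * B) := by
    intro m i
    ext a b
    have e1 : (fun y => connMatrix (pullback B G) y i a b)
        =ᶠ[𝓝 x] fun y => ∑ q, ∑ d, ∑ c, B q i * (B⁻¹ a c * B d b) *
          connMatrix G (B.mulVec y) q c d := by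
      filter_upwards [hev] with y hy
      rw [christoffel_pullback hB hy]
      simp only [Matrix.sum_apply, Matrix.smul_apply, Matrix.mul_apply, smul_eq_mul,
        Finset.mul_sum, Finset.sum_mul]
      refine Finset.sum_congr rfl fun q _ => Finset.sum_congr rfl fun d _ =>
        Finset.sum_congr rfl fun c _ => by ring
    rw [Matrix.of_apply, pd_congr e1]
    have hd := fun q d c => (hΓc c q d).const_mul (B q i * (B⁻¹ a c * B d b))
    rw [pd_sum _ fun q _ => DifferentiableAt.fun_sum fun d _ => DifferentiableAt.fun_sum fun c _ =>
      hd q d c]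
    simp only [Matrix.sum_apply]
    rw [Finset.sum_comm]
    refine Finset.sum_congr rfl fun q _ => ?_
    rw [pd_sum _ fun d _ => DifferentiableAt.fun_sum fun c _ => hd q d c]
    simp only [Matrix.smul_apply, Matrix.mul_apply, Matrix.of_apply, smul_eq_mul, Finset.mul_sum,
      Finset.sum_mul]
    rw [Finset.sum_comm]
    refine Finset.sum_congr rfl fun d _ => ?_
    rw [pd_sum _ fun c _ => hd q d c, Finset.sum_comm]
    refine Finset.sum_congr rfl fun c _ => ?_
    rw [pd_const_mul _ (hΓc c q d), pd_comp_mulVec (f := fun y => connMatrix G y q c d) B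
      (hΓd c q d), Finset.mul_sum]
    refine Finset.sum_congr rfl fun p _ => ?_
    rw [smul_eq_mul]; ring
  set S : ι → ι → Matrix ι ι ℝ := fun p q =>
    Matrix.of (fun a b => pd p (fun y => connMatrix G y q a b) (B.mulVec x))
      + connMatrix G (B.mulVec x) p * connMatrix G (B.mulVec x) q with hS
  have hS' : ∀ m i, Matrix.of (fun a b => pd m (fun y => connMatrix (pullback B G) y i a b) x)
      + connMatrix (pullback B G) x m * connMatrix (pullback B G) x i
      = ∑ p, ∑ q, (B p m * B q i) • (B⁻¹ * S p q * B) := by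
    intro m i
    rw [hT, christoffel_pullback hB hev.self_of_nhds, christoffel_pullback hB hev.self_of_nhds,
      Finset.sum_mul, ← Finset.sum_add_distrib]
    refine Finset.sum_congr rfl fun p _ => ?_
    rw [Finset.mul_sum, ← Finset.sum_add_distrib]
    refine Finset.sum_congr rfl fun q _ => ?_
    rw [hS, Matrix.mul_add, Matrix.add_mul, smul_add, Matrix.smul_mul, Matrix.mul_smul, smul_smul]
    congr 2
    have : B * (B⁻¹ * (connMatrix G (B.mulVec x) q * B)) = connMatrix G (B.mulVec x) q * B := by
      rw [← Matrix.mul_assoc, Matrix.mul_nonsing_inv _ hB, Matrix.one_mul]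
    simp only [Matrix.mul_assoc, this]
  have hR : ∀ q r, ricci G (B.mulVec x) q r = ∑ p, S p q p r - (S r q).trace := fun q r =>
    ricci_eq_connMatrix G _ q r
  rw [ricci_eq_connMatrix]
  simp only [hS', hR]
  have htr : ∀ p q, (B⁻¹ * S p q * B).trace = (S p q).trace := fun p q => by
    rw [Matrix.trace_mul_comm, ← Matrix.mul_assoc, Matrix.mul_nonsing_inv _ hB, Matrix.one_mul]
  have h1 : ∑ k, (∑ p, ∑ q, (B p k * B q i) • (B⁻¹ * S p q * B)) k j
      = ∑ q, ∑ r, B q i * B r j * ∑ p, S p q p r := by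
    have : ∀ p q, ∑ k, B p k * (B⁻¹ * S p q * B) k j = ∑ r, S p q p r * B r j := by
      intro p q
      rw [← Matrix.mul_apply, ← Matrix.mul_apply, ← Matrix.mul_assoc, ← Matrix.mul_assoc,
        Matrix.mul_nonsing_inv _ hB, Matrix.one_mul]
    simp only [Matrix.sum_apply, Matrix.smul_apply, smul_eq_mul]
    rw [Finset.sum_comm]
    rw [Finset.sum_congr rfl fun p _ => Finset.sum_comm, Finset.sum_comm]
    refine Finset.sum_congr rfl fun q _ => ?_
    have e : ∀ p, ∑ k, B p k * B q i * (B⁻¹ * S p q * B) k j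
        = ∑ r, B q i * (S p q p r * B r j) := by
      intro p
      rw [← Finset.mul_sum, ← this, Finset.mul_sum]
      exact Finset.sum_congr rfl fun k _ => by ring
    rw [Finset.sum_congr rfl fun p _ => e p, Finset.sum_comm]
    refine Finset.sum_congr rfl fun r _ => ?_
    rw [Finset.mul_sum]
    exact Finset.sum_congr rfl fun p _ => by ring
  rw [h1]
  simp only [Matrix.trace_sum, Matrix.trace_smul, htr, smul_eq_mul]
  rw [Finset.sum_comm (f := fun p q => B p j * B q i * (S p q).trace), ← Finset.sum_sub_distrib]
  refine Finset.sum_congr rfl fun q _ => ?_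
  rw [← Finset.sum_sub_distrib]
  exact Finset.sum_congr rfl fun r _ => by ring

lemma christoffel_congr {G G' : (ι → ℝ) → Matrix ι ι ℝ} {x : ι → ℝ} (h : G =ᶠ[𝓝 x] G')
    (k i j : ι) : christoffel G x k i j = christoffel G' x k i j := by
  have : ∀ a b m, pd m (fun y => G y a b) x = pd m (fun y => G' y a b) x := fun a b m =>
    pd_congr (h.mono fun y hy => by simp [hy]) m
  unfold christoffel
  simp only [this, h.self_of_nhds]

end LinearCovariance

/-! ### The twist of the stationary Killing field -/

section Twist

/-- The contraction of `ε_{a0cd}` with a matrix. -/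
def timeCurl (X : Matrix (Fin 4) (Fin 4) ℝ) (a : Fin 4) : ℝ :=
  ∑ c, ∑ d, leviCivita ![a, 0, c, d] * X c d

lemma timeCurl_eq (X : Matrix (Fin 4) (Fin 4) ℝ) :
    timeCurl X = ![0, X 3 2 - X 2 3, X 1 3 - X 3 1, X 2 1 - X 1 2] := by
  funext a
  fin_cases a <;>
    simp [timeCurl, leviCivita, Fin.sum_univ_succ, Matrix.det_succ_row_zero] <;>
    simp [Fin.succAbove, Fin.ext_iff] <;> ring

/-- `∇ᶜ ξᵈ` for `ξ = ∂/∂t`. -/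
def killingGrad (g : (Fin 4 → ℝ) → Matrix (Fin 4) (Fin 4) ℝ) (x : Fin 4 → ℝ) :
    Matrix (Fin 4) (Fin 4) ℝ :=
  (g x)⁻¹ * (Matrix.of fun d e => christoffel g x d e 0).transpose

lemma twistForm_eq (s : ℤˣ) (g : (Fin 4 → ℝ) → Matrix (Fin 4) (Fin 4) ℝ) (x : Fin 4 → ℝ)
    (a : Fin 4) :
    twistForm s g (fun _ => Pi.single 0 1) x a
      = ((s : ℤ) : ℝ) * √|(g x).det| * timeCurl (killingGrad g x) a := by
  have h1 : ∀ c d, ∑ e, (g x)⁻¹ c e * (pd e (fun _ : Fin 4 → ℝ =>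
      (Pi.single 0 1 : Fin 4 → ℝ) d) x + ∑ f, christoffel g x d e f *
      (Pi.single 0 1 : Fin 4 → ℝ) f) = killingGrad g x c d := by
    intro c d
    simp only [pd_const, zero_add, killingGrad, Matrix.mul_apply, Matrix.transpose_apply,
      Matrix.of_apply]
    refine Finset.sum_congr rfl fun e _ => ?_
    congr 1
    rw [Finset.sum_eq_single 0 (fun f _ hf => by simp [hf]) (by simp)]
    simp
  simp only [twistForm, h1, timeCurl, Finset.mul_sum]
  rw [Finset.sum_eq_single 0 (fun b _ hb => by simp [hb]) (by simp)]
  refine Finset.sum_congr rfl fun c _ => Finset.sum_congr rfl fun d _ => ?_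
  simp [volumeForm]
  ring

variable {B : Matrix (Fin 4) (Fin 4) ℝ} {g : (Fin 4 → ℝ) → Matrix (Fin 4) (Fin 4) ℝ}
  {x : Fin 4 → ℝ}

/-- `∇ᶜξᵈ` is a tensor, and the condition on the first column says that `B` fixes `∂/∂t`, so both
sides refer to the same vector field. -/
lemma killingGrad_pullback (hB : IsUnit B.det) (hB0 : ∀ i, B i 0 = if i = 0 then 1 else 0)
    (hg : ∀ i j, DifferentiableAt ℝ (fun y => g y i j) (B.mulVec x)) :
    killingGrad g (B.mulVec x) = B * killingGrad (pullback B g) x * B.transpose := by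
  have hN : (Matrix.of fun d e => christoffel (pullback B g) x d e 0)
      = B⁻¹ * (Matrix.of fun d e => christoffel g (B.mulVec x) d e 0) * B := by
    ext d e
    have h1 : (Matrix.of fun d e => christoffel (pullback B g) x d e 0) d e
      = connMatrix (pullback B g) x e d 0 := rfl
    rw [h1, christoffel_pullback hB hg]
    simp only [Matrix.sum_apply, Matrix.smul_apply, Matrix.mul_apply (N := B), hB0, smul_eq_mul]
    refine Finset.sum_congr rfl fun p _ => ?_
    simp only [mul_ite, mul_one, mul_zero, Finset.sum_ite_eq', Finset.mem_univ, if_true]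
    rw [mul_comm]
    rfl
  have hBt : B⁻¹.transpose * B.transpose = 1 := by
    rw [← Matrix.transpose_mul, Matrix.mul_nonsing_inv _ hB, Matrix.transpose_one]
  have hBB := Matrix.mul_nonsing_inv _ hB
  unfold killingGrad
  rw [hN, pullback_inv, Matrix.transpose_mul, Matrix.transpose_mul]
  simp only [Matrix.mul_assoc]
  rw [hBt, Matrix.mul_one, ← Matrix.mul_assoc B⁻¹.transpose, hBt, Matrix.one_mul,
    ← Matrix.mul_assoc B, hBB, Matrix.one_mul]

/-- The twist covector of the pull-back of a metric by a linear map preserving `∂/∂t` and the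
volume. -/
lemma twistForm_pullback (s : ℤˣ) (hdet : B.det = 1)
    (hB0 : ∀ i, B i 0 = if i = 0 then 1 else 0)
    (hg : ∀ i j, DifferentiableAt ℝ (fun y => g y i j) (B.mulVec x)) (a : Fin 4) :
    twistForm s (pullback B g) (fun _ => Pi.single 0 1) x a
      = ∑ b, B b a * twistForm s g (fun _ => Pi.single 0 1) (B.mulVec x) b := by
  have hdg : (pullback B g x).det = (g (B.mulVec x)).det := by
    simp [pullback, Matrix.det_mul, hdet]
  simp only [twistForm_eq, hdg]
  rw [killingGrad_pullback (by rw [hdet]; exact isUnit_one) hB0 hg]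
  set X := killingGrad (pullback B g) x
  -- The curl is a cross product in the spatial indices, hence transforms by the cofactors of the
  -- spatial block of `B`. Contracting with `B` produces the determinant of that block, which is
  -- `1`.
  have key : timeCurl X a = ∑ b, B b a * timeCurl (B * X * B.transpose) b := by
    have h00 : B 0 0 = 1 := by rw [hB0]; rfl
    have h10 : B 1 0 = 0 := by rw [hB0]; rfl
    have h20 : B 2 0 = 0 := by rw [hB0]; rfl
    have h30 : B 3 0 = 0 := by rw [hB0]; rfl
    have h3 : B 1 1 * (B 2 2 * B 3 3 - B 2 3 * B 3 2) - B 1 2 * (B 2 1 * B 3 3 - B 2 3 * B 3 1)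
        + B 1 3 * (B 2 1 * B 3 2 - B 2 2 * B 3 1) = 1 := by
      rw [← hdet, Matrix.det_succ_column_zero, Fin.sum_univ_four, h00, h10, h20, h30,
        Matrix.det_fin_three]
      simp
      ring
    rw [timeCurl_eq, timeCurl_eq]
    fin_cases a <;>
      simp [Matrix.mul_apply, Fin.sum_univ_four, h10, h20, h30]
    · linear_combination (-(X 3 2 - X 2 3)) * h3
    · linear_combination (-(X 1 3 - X 3 1)) * h3
    · linear_combination (-(X 2 1 - X 1 2)) * h3
  rw [key, Finset.mul_sum]
  exact Finset.sum_congr rfl fun b _ => by ring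

lemma twistForm_congr (s : ℤˣ) {g' : (Fin 4 → ℝ) → Matrix (Fin 4) (Fin 4) ℝ}
    (h : g =ᶠ[𝓝 x] g') (a : Fin 4) :
    twistForm s g (fun _ => Pi.single 0 1) x a = twistForm s g' (fun _ => Pi.single 0 1) x a := by
  simp only [twistForm_eq, killingGrad, h.self_of_nhds, fun k i j => christoffel_congr h k i j]

end Twist

/-! ### Space of trajectories -/

lemma vecTail_add_time (y : Fin 4 → ℝ) (s : ℝ) :
    Matrix.vecTail (y + s • Pi.single 0 1) = Matrix.vecTail y := by
  funext i; simp [Matrix.vecTail]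

lemma vecCons_zero_vecTail (y : Fin 4 → ℝ) :
    Matrix.vecCons 0 (Matrix.vecTail y) = y + (-y 0) • Pi.single 0 1 := by
  funext i
  refine Fin.cases ?_ (fun i => ?_) i
  · simp
  · simp [Matrix.vecTail]

lemma hasFDerivAt_vecTail (y : Fin 4 → ℝ) :
    HasFDerivAt (fun y : Fin 4 → ℝ => Matrix.vecTail y)
      (ContinuousLinearMap.pi fun i : Fin 3 => ContinuousLinearMap.proj (R := ℝ) i.succ) y :=
  (ContinuousLinearMap.pi fun i : Fin 3 =>
    ContinuousLinearMap.proj (R := ℝ) (φ := fun _ : Fin 4 => ℝ) i.succ).hasFDerivAt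

lemma contDiff_vecTail {n : WithTop ℕ∞} : ContDiff ℝ n fun y : Fin 4 → ℝ => Matrix.vecTail y :=
  (ContinuousLinearMap.pi fun i : Fin 3 =>
    ContinuousLinearMap.proj (R := ℝ) (φ := fun _ : Fin 4 => ℝ) i.succ).contDiff

lemma pd_succ_comp_vecTail {f : (Fin 3 → ℝ) → ℝ} {y : Fin 4 → ℝ}
    (hf : DifferentiableAt ℝ f (Matrix.vecTail y)) (i : Fin 3) :
    pd i.succ (fun y => f (Matrix.vecTail y)) y = pd i f (Matrix.vecTail y) := by
  have h := (hf.hasFDerivAt.comp y (hasFDerivAt_vecTail y)).fderiv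
  have h' : fderiv ℝ (fun y => f (Matrix.vecTail y)) y = _ := h
  unfold pd
  rw [h', ContinuousLinearMap.comp_apply]
  congr 1
  funext j
  simp [Pi.single_apply]

/-- Partial derivatives of a function which does not depend on the time. -/
lemma pd_zero_of_stationary {f : (Fin 4 → ℝ) → ℝ} {y : Fin 4 → ℝ}
    (hf : DifferentiableAt ℝ f y) (h : ∀ s : ℝ, f (y + s • Pi.single 0 1) = f y) :
    pd 0 f y = 0 := by
  have h1 : HasDerivAt (fun s : ℝ => f (y + s • Pi.single 0 1)) (fderiv ℝ f y (Pi.single 0 1)) 0 := by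
    have hl : HasDerivAt (fun s : ℝ => y + s • (Pi.single 0 1 : Fin 4 → ℝ)) (Pi.single 0 1) 0 := by
      simpa using ((hasDerivAt_id (0 : ℝ)).smul_const (Pi.single 0 1 : Fin 4 → ℝ)).const_add y
    have hf' : HasFDerivAt f (fderiv ℝ f y) (y + (0 : ℝ) • (Pi.single 0 1 : Fin 4 → ℝ)) := by
      simpa using hf.hasFDerivAt
    exact hf'.comp_hasDerivAt (0 : ℝ) hl
  have h2 : (fun s : ℝ => f (y + s • Pi.single 0 1)) = fun _ => f y := funext h
  rw [h2] at h1
  exact h1.unique (hasDerivAt_const 0 (f y))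

namespace Spacetime

variable (M : Spacetime)

lemma isOpen_V : IsOpen M.V := M.isOpen_U.sdiff isClosed_singleton

/-- The part of the coordinate space on which the metric lives. -/
def dom : Set (Fin 4 → ℝ) := {y | Matrix.vecTail y ∈ M.V}

lemma isOpen_dom : IsOpen M.dom :=
  M.isOpen_V.preimage (contDiff_vecTail (n := 0)).continuous

variable {M}

lemma contDiffAt_g {y : Fin 4 → ℝ} (hy : y ∈ M.dom) (a b : Fin 4) :
    ContDiffAt ℝ (⊤ : ℕ∞) (fun x => M.g x a b) y :=
  (M.smooth a b).contDiffAt (M.isOpen_dom.mem_nhds hy)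

/-- Symmetry is not a field of `Spacetime`; it is inherited from the diagonal matrix to which the
metric is congruent. -/
lemma g_symm {y : Fin 4 → ℝ} (hy : y ∈ M.dom) : (M.g y).transpose = M.g y := by
  obtain ⟨E, hE, h⟩ := M.lorentzian y hy.1 hy.2
  have hEt : IsUnit E.transpose.det := by rwa [Matrix.det_transpose]
  have h1 : M.g y = (E⁻¹).transpose * Matrix.diagonal ![-1, 1, 1, 1] * E⁻¹ := by
    rw [← h, Matrix.transpose_nonsing_inv]
    simp only [Matrix.mul_assoc]
    rw [Matrix.mul_nonsing_inv _ hE, Matrix.mul_one, ← Matrix.mul_assoc,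
      Matrix.nonsing_inv_mul _ hEt, Matrix.one_mul]
  rw [h1]
  simp [Matrix.transpose_mul, Matrix.mul_assoc]

lemma det_g_ne_zero {y : Fin 4 → ℝ} (hy : y ∈ M.dom) : (M.g y).det ≠ 0 := by
  obtain ⟨E, hE, h⟩ := M.lorentzian y hy.1 hy.2
  intro h0
  have := congrArg Matrix.det h
  rw [Matrix.det_mul, Matrix.det_mul, h0, Matrix.det_diagonal] at this
  simp [Fin.prod_univ_succ] at this

lemma g_add_time {y : Fin 4 → ℝ} (hy : y ∈ M.dom) (s : ℝ) :
    M.g (y + s • Pi.single 0 1) = M.g y := M.stationary y hy.1 hy.2 s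

lemma g_vecCons {y : Fin 4 → ℝ} (hy : y ∈ M.dom) :
    M.g (Matrix.vecCons 0 (Matrix.vecTail y)) = M.g y := by
  rw [vecCons_zero_vecTail, g_add_time hy]

lemma xiLower_eq (y : Fin 4 → ℝ) (a : Fin 4) : M.xiLower y a = M.g y a 0 := by
  simp [xiLower, xi, Pi.single_apply]

lemma lam_vecTail {y : Fin 4 → ℝ} (hy : y ∈ M.dom) : M.lam (Matrix.vecTail y) = -M.g y 0 0 := by
  simp [lam, normOnM, xiLower_eq, xi, Pi.single_apply, g_vecCons hy]

lemma h_vecTail {y : Fin 4 → ℝ} (hy : y ∈ M.dom) (i j : Fin 3) :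
    M.h (Matrix.vecTail y) i j
      = -M.g y 0 0 * M.g y i.succ j.succ + M.g y i.succ 0 * M.g y j.succ 0 := by
  simp [h, lam_vecTail hy, xiLower_eq, g_vecCons hy]

lemma vecCons_mem_dom {x : Fin 3 → ℝ} (hx : x ∈ M.V) : Matrix.vecCons 0 x ∈ M.dom := by
  simpa [dom] using hx

lemma lam_pos {x : Fin 3 → ℝ} (hx : x ∈ M.V) : 0 < M.lam x := by
  have h := lam_vecTail (M := M) (vecCons_mem_dom hx)
  rw [Matrix.tail_cons] at h
  have h2 := M.timelike (Matrix.vecCons 0 x) (vecCons_mem_dom hx).1 (vecCons_mem_dom hx).2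
  linarith

lemma contDiffAt_vecCons {n : WithTop ℕ∞} (x : Fin 3 → ℝ) :
    ContDiffAt ℝ n (fun x : Fin 3 → ℝ => (Matrix.vecCons 0 x : Fin 4 → ℝ)) x := by
  refine contDiffAt_pi.2 fun i => ?_
  refine Fin.cases ?_ (fun i => ?_) i
  · simpa using contDiffAt_const
  · simpa using contDiffAt_apply ℝ ℝ i x

lemma contDiffAt_lam {x : Fin 3 → ℝ} (hx : x ∈ M.V) : ContDiffAt ℝ (⊤ : ℕ∞) M.lam x := by
  have h1 : (fun x => M.g (Matrix.vecCons 0 x) 0 0) = (fun y => M.g y 0 0) ∘ fun x : Fin 3 → ℝ =>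
    (Matrix.vecCons 0 x : Fin 4 → ℝ) := rfl
  have h2 : M.lam = fun x => -M.g (Matrix.vecCons 0 x) 0 0 := by
    funext x; simp [lam, normOnM, xiLower_eq, xi, Pi.single_apply]
  rw [h2]
  refine ContDiffAt.neg ?_
  rw [h1]
  exact (contDiffAt_g (vecCons_mem_dom hx) 0 0).comp x (contDiffAt_vecCons x)

lemma contDiffAt_h {x : Fin 3 → ℝ} (hx : x ∈ M.V) (i j : Fin 3) :
    ContDiffAt ℝ (⊤ : ℕ∞) (fun x => M.h x i j) x := by
  have hg : ∀ a b, ContDiffAt ℝ (⊤ : ℕ∞) (fun x => M.g (Matrix.vecCons 0 x) a b) x := fun a b =>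
    (contDiffAt_g (vecCons_mem_dom hx) a b).comp x (contDiffAt_vecCons x)
  simp only [h, xiLower_eq, Matrix.of_apply]
  exact ((contDiffAt_lam hx).mul (hg _ _)).add ((hg _ _).mul (hg _ _))

end Spacetime

/-! ### The vacuum equations on the space of trajectories -/

/-- The change of coordinates `t ↦ t + v · x`. -/
def shear (v : Fin 3 → ℝ) : Matrix (Fin 4) (Fin 4) ℝ :=
  !![1, v 0, v 1, v 2; 0, 1, 0, 0; 0, 0, 1, 0; 0, 0, 0, 1]

lemma det_shear (v : Fin 3 → ℝ) : (shear v).det = 1 := by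
  simp [shear, Matrix.det_succ_row_zero, Fin.sum_univ_succ]

lemma shear_zero (v : Fin 3 → ℝ) (i : Fin 4) : shear v i 0 = if i = 0 then 1 else 0 := by
  fin_cases i <;> simp [shear]

lemma shear_mulVec (v : Fin 3 → ℝ) (y : Fin 4 → ℝ) :
    (shear v).mulVec y = y + (v 0 * y 1 + v 1 * y 2 + v 2 * y 3) • Pi.single 0 1 := by
  funext i
  fin_cases i <;> simp [shear, Matrix.mulVec, dotProduct, Fin.sum_univ_four]
  ring

namespace Spacetime

variable {M : Spacetime}

lemma shear_mem_dom {y : Fin 4 → ℝ} (hy : y ∈ M.dom) (v : Fin 3 → ℝ) :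
    (shear v).mulVec y ∈ M.dom := by
  rw [shear_mulVec]
  simpa only [dom, Set.mem_ofPred_eq, vecTail_add_time] using hy

lemma pullback_shear {y : Fin 4 → ℝ} (hy : y ∈ M.dom) (v : Fin 3 → ℝ) :
    pullback (shear v) M.g y = (shear v).transpose * M.g y * shear v := by
  rw [pullback, shear_mulVec, g_add_time hy]

lemma pullback_shear_time {y : Fin 4 → ℝ} (hy : y ∈ M.dom) (v : Fin 3 → ℝ) :
    pullback (shear v) M.g y 0 0 = M.g y 0 0 := by
  rw [pullback_shear hy]
  simp [shear, Matrix.mul_apply, Fin.sum_univ_four]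

lemma pullback_shear_mixed {y : Fin 4 → ℝ} (hy : y ∈ M.dom) (v : Fin 3 → ℝ) (i : Fin 3) :
    pullback (shear v) M.g y 0 i.succ = M.g y 0 i.succ + v i * M.g y 0 0 := by
  rw [pullback_shear hy]
  fin_cases i <;> simp [shear, Matrix.mul_apply, Fin.sum_univ_four] <;> ring

lemma pullback_shear_space {y : Fin 4 → ℝ} (hy : y ∈ M.dom) (v : Fin 3 → ℝ) (i j : Fin 3) :
    pullback (shear v) M.g y i.succ j.succ = M.g y i.succ j.succ + v i * M.g y 0 j.succ
      + v j * M.g y i.succ 0 + v i * v j * M.g y 0 0 := by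
  rw [pullback_shear hy]
  fin_cases i <;> fin_cases j <;> simp [shear, Matrix.mul_apply, Fin.sum_univ_four] <;> ring

lemma pullback_shear_symm {y : Fin 4 → ℝ} (hy : y ∈ M.dom) (v : Fin 3 → ℝ) (i j : Fin 4) :
    pullback (shear v) M.g y i j = pullback (shear v) M.g y j i := by
  have : (pullback (shear v) M.g y).transpose = pullback (shear v) M.g y := by
    rw [pullback_shear hy]
    simp [Matrix.transpose_mul, g_symm hy, Matrix.mul_assoc]
  exact congrFun (congrFun this j) i

lemma contDiffAt_pullback_shear {y : Fin 4 → ℝ} (hy : y ∈ M.dom) (v : Fin 3 → ℝ) (i j : Fin 4) :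
    ContDiffAt ℝ (⊤ : ℕ∞) (fun y => pullback (shear v) M.g y i j) y := by
  simp only [pullback_apply]
  refine ContDiffAt.sum fun a _ => ContDiffAt.sum fun b _ => contDiffAt_const.mul ?_
  exact ContDiffAt.comp (g := fun y => M.g y a b) y (contDiffAt_g (shear_mem_dom hy v) a b)
    (LinearMap.toContinuousLinearMap (shear v).mulVecLin).contDiff.contDiffAt

/-- `h` is built from `g` and `ξ` alone and is therefore insensitive to a shear of the time
coordinate. This leaves `v` free to be adapted to a single point. -/
lemma h_eq_pullback_shear {y : Fin 4 → ℝ} (hy : y ∈ M.dom) (v : Fin 3 → ℝ) (i j : Fin 3) :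
    M.h (Matrix.vecTail y) i j
      = -pullback (shear v) M.g y 0 0 * pullback (shear v) M.g y i.succ j.succ
        + pullback (shear v) M.g y 0 i.succ * pullback (shear v) M.g y 0 j.succ := by
  rw [h_vecTail hy, pullback_shear_time hy, pullback_shear_mixed hy, pullback_shear_mixed hy,
    pullback_shear_space hy]
  have hs : ∀ k, M.g y k 0 = M.g y 0 k := fun k => congrFun (congrFun (g_symm hy) 0) k
  rw [hs i.succ, hs j.succ]
  ring

lemma pd_twist {ω : (Fin 3 → ℝ) → ℝ} (hω : M.IsTwist ω) {x : Fin 3 → ℝ} (hx : x ∈ M.V)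
    {y : Fin 4 → ℝ} (hy : Matrix.vecTail y = x) (i : Fin 3) :
    pd i ω x = twistForm M.orientation M.g (fun _ => Pi.single 0 1) y i.succ := by
  have hd : DifferentiableAt ℝ ω (Matrix.vecTail y) := by
    rw [hy]
    exact (hω.smooth.contDiffAt (M.isOpen_V.mem_nhds hx)).differentiableAt (by simp)
  have := hω.grad y (by rw [hy]; exact hx) i.succ
  rw [pd_succ_comp_vecTail hd, hy] at this
  exact this

/-- The shear acts as the identity between spatial indices, and the time component of the twist
covector is zero because `ε` is already contracted with `ξ`. So the gradient of `ω` can be read off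
in the sheared coordinates. -/
lemma pd_twist_shear {ω : (Fin 3 → ℝ) → ℝ} (hω : M.IsTwist ω) {x : Fin 3 → ℝ} (hx : x ∈ M.V)
    (v : Fin 3 → ℝ) (i : Fin 3) :
    pd i ω x = twistForm M.orientation (pullback (shear v) M.g) (fun _ => Pi.single 0 1)
      (Matrix.vecCons 0 x) i.succ := by
  have hp := vecCons_mem_dom hx
  have hd : ∀ i j, DifferentiableAt ℝ (fun y => M.g y i j) ((shear v).mulVec (Matrix.vecCons 0 x)) :=
    fun i j => (contDiffAt_g (shear_mem_dom hp v) i j).differentiableAt (by simp)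
  rw [twistForm_pullback _ (det_shear v) (shear_zero v) hd, Fin.sum_univ_succ]
  have h0 : twistForm M.orientation M.g (fun _ => Pi.single 0 1)
      ((shear v).mulVec (Matrix.vecCons 0 x)) 0 = 0 := by
    rw [twistForm_eq, timeCurl_eq]; simp
  have h1 : ∀ j : Fin 3, shear v j.succ i.succ = if j = i then 1 else 0 := by
    intro j; fin_cases i <;> fin_cases j <;> simp [shear]
  rw [h0, mul_zero, zero_add]
  simp only [h1, ite_mul, one_mul, zero_mul, Finset.sum_ite_eq', Finset.mem_univ, if_true]
  refine pd_twist hω hx ?_ i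
  rw [shear_mulVec, vecTail_add_time, Matrix.tail_cons]

/-- The 2-jets of `h` and of `g`, at a point where `h` is `diag (a, b, a)` and for a time coordinate
adapted to that point. -/
lemma isQuotientJet {x : Fin 3 → ℝ} (hx : x ∈ M.V) {a b : ℝ} (v : Fin 3 → ℝ)
    (hd : pullback (shear v) M.g (Matrix.vecCons 0 x)
      = Matrix.diagonal ![-M.lam x, a / M.lam x, b / M.lam x, a / M.lam x]) :
    IsQuotientJet (M.lam x) a b
      (fun m i j => pd m (fun y => pullback (shear v) M.g y i j) (Matrix.vecCons 0 x))
      (fun m n i j => pd m (pd n (fun y => pullback (shear v) M.g y i j)) (Matrix.vecCons 0 x))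
      (fun m i j => pd m (fun y => M.h y i j) x)
      (fun m n i j => pd m (pd n (fun y => M.h y i j)) x) := by
  set p : Fin 4 → ℝ := Matrix.vecCons 0 x with hp
  have hpd : p ∈ M.dom := vecCons_mem_dom hx
  have hpx : Matrix.vecTail p = x := Matrix.tail_cons _ _
  have hdom : ∀ᶠ y in 𝓝 p, y ∈ M.dom := M.isOpen_dom.mem_nhds hpd
  set G := pullback (shear v) M.g with hG
  have hsm : ∀ y ∈ M.dom, ∀ i j, ContDiffAt ℝ (⊤ : ℕ∞) (fun y => G y i j) y :=
    fun y hy i j => contDiffAt_pullback_shear hy v i j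
  have hdf : ∀ y ∈ M.dom, ∀ i j, DifferentiableAt ℝ (fun y => G y i j) y :=
    fun y hy i j => (hsm y hy i j).differentiableAt (by simp)
  have hdf2 : ∀ y ∈ M.dom, ∀ m i j, DifferentiableAt ℝ (pd m (fun y => G y i j)) y :=
    fun y hy m i j => (contDiffAt_pd (m := (⊤ : ℕ∞)) (hsm y hy i j) (by simp) m).differentiableAt
      (by simp)
  have hsymm : ∀ y ∈ M.dom, ∀ i j, G y i j = G y j i := fun y hy => pullback_shear_symm hy v
  have hstat : ∀ y ∈ M.dom, ∀ i j, pd 0 (fun y => G y i j) y = 0 := by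
    intro y hy i j
    refine pd_zero_of_stationary (hdf y hy i j) fun s => ?_
    have hy' : y + s • Pi.single 0 1 ∈ M.dom := by
      simpa only [dom, Set.mem_ofPred_eq, vecTail_add_time] using hy
    rw [hG, pullback_shear hy, pullback_shear hy', g_add_time hy]
  have hcomm : ∀ m n i j, pd m (pd n (fun y => G y i j)) p = pd n (pd m (fun y => G y i j)) p :=
    fun m n i j => pd_comm ((hsm p hpd i j).of_le (WithTop.coe_le_coe.2 le_top)) m n
  have hG0 : ∀ i : Fin 3, G p 0 i.succ = 0 := by
    intro i; rw [hd, Matrix.diagonal_apply_ne _ (Fin.succ_ne_zero i).symm]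
  have hG00 : G p 0 0 = -M.lam x := by rw [hd]; simp
  have hGs : ∀ i j : Fin 3, G p i.succ j.succ = if i = j then ![a, b, a] i / M.lam x else 0 := by
    intro i j
    rw [hd]
    fin_cases i <;> fin_cases j <;> simp [Matrix.diagonal]
  have hF : ∀ y ∈ M.dom, ∀ i j, M.h (Matrix.vecTail y) i j
      = -G y 0 0 * G y i.succ j.succ + G y 0 i.succ * G y 0 j.succ := fun y hy i j =>
    h_eq_pullback_shear hy v i j
  have hhd : ∀ y ∈ M.dom, ∀ i j, DifferentiableAt ℝ (fun x => M.h x i j) (Matrix.vecTail y) :=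
    fun y hy i j => (contDiffAt_h hy i j).differentiableAt (by simp)
  -- Kept at all points of the domain, not only at `p` where the mixed components vanish, because it
  -- is differentiated once more below.
  have hfirst : ∀ y ∈ M.dom, ∀ n i j, pd n (fun x => M.h x i j) (Matrix.vecTail y)
      = -(pd n.succ (fun y => G y 0 0) y * G y i.succ j.succ
          + G y 0 0 * pd n.succ (fun y => G y i.succ j.succ) y)
        + (pd n.succ (fun y => G y 0 i.succ) y * G y 0 j.succ
          + G y 0 i.succ * pd n.succ (fun y => G y 0 j.succ) y) := by
    intro y hy n i j
    rw [← pd_succ_comp_vecTail (hhd y hy i j)]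
    rw [pd_congr (g := fun y => -(G y 0 0 * G y i.succ j.succ) + G y 0 i.succ * G y 0 j.succ)]
    · rw [pd_add ((hdf y hy _ _).fun_mul (hdf y hy _ _)).fun_neg
        ((hdf y hy _ _).fun_mul (hdf y hy _ _)), pd_neg, pd_mul (hdf y hy _ _) (hdf y hy _ _),
        pd_mul (hdf y hy _ _) (hdf y hy _ _)]
    · filter_upwards [M.isOpen_dom.mem_nhds hy] with z hz
      rw [hF z hz]; ring
  refine ⟨?_, ?_, ?_, ?_, ?_, ?_, ?_⟩
  · intro m i j
    exact pd_congr (hdom.mono fun y hy => hsymm y hy i j) m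
  · exact fun i j => hstat p hpd i j
  · intro m n i j
    exact pd_congr (pd_eventuallyEq (hdom.mono fun y hy => hsymm y hy i j) n) m
  · exact hcomm
  · intro m i j
    rw [hcomm, pd_congr (g := fun _ => (0 : ℝ)) (hdom.mono fun y hy => hstat y hy i j), pd_const]
  · intro m i j
    have := hfirst p hpd m i j
    rw [hpx] at this
    rw [this, hG0, hG0, hG00, hGs]
    ring
  · intro m n i j
    have hdh : DifferentiableAt ℝ (pd n (fun x => M.h x i j)) (Matrix.vecTail p) :=
      (contDiffAt_pd (m := (⊤ : ℕ∞)) (contDiffAt_h hpd i j) (by simp) n).differentiableAt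
        (by simp)
    rw [← hpx, ← pd_succ_comp_vecTail hdh, hpx,
      pd_congr (hdom.mono fun y hy => hfirst y hy n i j)]
    have d0 := fun i j => hdf p hpd i j
    have d1 := fun m i j => hdf2 p hpd m i j
    rw [pd_add (((d1 _ _ _).fun_mul (d0 _ _)).fun_add ((d0 _ _).fun_mul (d1 _ _ _))).fun_neg
      (((d1 _ _ _).fun_mul (d0 _ _)).fun_add ((d0 _ _).fun_mul (d1 _ _ _))), pd_neg,
      pd_add ((d1 _ _ _).fun_mul (d0 _ _)) ((d0 _ _).fun_mul (d1 _ _ _)),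
      pd_add ((d1 _ _ _).fun_mul (d0 _ _)) ((d0 _ _).fun_mul (d1 _ _ _)),
      pd_mul (d1 _ _ _) (d0 _ _), pd_mul (d0 _ _) (d1 _ _ _),
      pd_mul (d1 _ _ _) (d0 _ _), pd_mul (d0 _ _) (d1 _ _ _), hG0, hG0, hG00, hGs]
    ring

/-- The vacuum equations for the metric `h` of the space of trajectories, at a point where it is
`diag (a, b, a)`. -/
theorem ricci_h {ω : (Fin 3 → ℝ) → ℝ} (hω : M.IsTwist ω) {x : Fin 3 → ℝ} (hx : x ∈ M.V) {a b : ℝ}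
    (ha : 0 < a) (hb : 0 < b) (hh : M.h x = Matrix.diagonal ![a, b, a]) :
    ricci M.h x 0 2
        = 1 / (2 * M.lam x ^ 2) * (pd 0 M.lam x * pd 2 M.lam x + pd 0 ω x * pd 2 ω x) ∧
      ricci M.h x 2 2 - ricci M.h x 0 0
        = 1 / (2 * M.lam x ^ 2) * (pd 2 M.lam x ^ 2 - pd 0 M.lam x ^ 2
          + (pd 2 ω x ^ 2 - pd 0 ω x ^ 2)) := by
  set p : Fin 4 → ℝ := Matrix.vecCons 0 x with hp
  have hpd : p ∈ M.dom := vecCons_mem_dom hx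
  have hpx : Matrix.vecTail p = x := Matrix.tail_cons _ _
  have hl := lam_pos hx
  have hlg : M.lam x = -M.g p 0 0 := by rw [← lam_vecTail hpd, hpx]
  have hg0 : M.g p 0 0 ≠ 0 := by intro h0; rw [hlg, h0] at hl; simp at hl
  -- The shear that removes the mixed components `g₀ᵢ` at `p`; what is left of the spatial part is
  -- `h / λ`.
  set v : Fin 3 → ℝ := fun i => -M.g p 0 i.succ / M.g p 0 0 with hv
  set G := pullback (shear v) M.g with hG
  have hmix : ∀ i : Fin 3, G p 0 i.succ = 0 := by
    intro i
    rw [hG, pullback_shear_mixed hpd]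
    simp only [hv]
    field_simp
    ring
  have hmix' : ∀ i : Fin 3, G p i.succ 0 = 0 := by
    intro i; rw [hG, pullback_shear_symm hpd, ← hG, hmix]
  have htime : G p 0 0 = -M.lam x := by rw [hG, pullback_shear_time hpd, hlg, neg_neg]
  have hspace : ∀ i j : Fin 3, G p i.succ j.succ = M.h x i j / M.lam x := by
    intro i j
    have := h_eq_pullback_shear hpd v i j
    rw [hpx, ← hG, hmix, hmix, htime] at this
    rw [this]; field_simp; ring
  have hdiag : G p = Matrix.diagonal ![-M.lam x, a / M.lam x, b / M.lam x, a / M.lam x] := by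
    ext i j
    refine Fin.cases ?_ (fun i => ?_) i <;> refine Fin.cases ?_ (fun j => ?_) j
    · rw [htime]; simp
    · rw [hmix, Matrix.diagonal_apply_ne _ (Fin.succ_ne_zero j).symm]
    · rw [hmix', Matrix.diagonal_apply_ne _ (Fin.succ_ne_zero i)]
    · rw [hspace, hh]
      fin_cases i <;> fin_cases j <;> simp [Matrix.diagonal]
  have hinv : (G p)⁻¹
      = Matrix.diagonal ![-1 / M.lam x, M.lam x / a, M.lam x / b, M.lam x / a] := by
    refine Matrix.inv_eq_right_inv ?_
    rw [hdiag, Matrix.diagonal_mul_diagonal, ← Matrix.diagonal_one]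
    congr 1
    funext i
    fin_cases i <;> simp <;> field_simp
  have hdet : (G p).det = -(a ^ 2 * b / M.lam x ^ 2) := by
    rw [hdiag, Matrix.det_diagonal]
    simp [Fin.prod_univ_succ]
    field_simp
  have hinvh : (M.h x)⁻¹ = Matrix.diagonal ![1 / a, 1 / b, 1 / a] := by
    refine Matrix.inv_eq_right_inv ?_
    rw [hh, Matrix.diagonal_mul_diagonal, ← Matrix.diagonal_one]
    congr 1
    funext i
    fin_cases i <;> simp <;> field_simp
  have hdeth : (M.h x).det ≠ 0 := by
    rw [hh, Matrix.det_diagonal]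
    simp [Fin.prod_univ_succ, ha.ne', hb.ne']
  have h2 : ((2 : ℕ) : WithTop ℕ∞) ≤ ((⊤ : ℕ∞) : WithTop ℕ∞) := WithTop.coe_le_coe.2 le_top
  have hJ := isQuotientJet hx (a := a) (b := b) v hdiag
  have hric : ∀ i j, ricci G p i j = 0 := by
    intro i j
    have hp' := shear_mem_dom hpd v
    rw [hG, ricci_pullback (by rw [det_shear]; exact isUnit_one)
      (fun i j => (contDiffAt_g hp' i j).of_le h2) (det_g_ne_zero hp')]
    simp [M.vacuum _ hp'.1 hp'.2]
  have hricJ : ∀ i j, ricciJet ![-1 / M.lam x, M.lam x / a, M.lam x / b, M.lam x / a]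
      (fun m i j => pd m (fun y => G y i j) p) (fun m n i j => pd m (pd n (fun y => G y i j)) p)
      i j = 0 := by
    intro i j
    rw [← hric i j, ricci_eq_ricciJet (fun i j => (contDiffAt_pullback_shear hpd v i j).of_le h2)
      (by rw [hdet]; have : 0 < a ^ 2 * b / M.lam x ^ 2 := by positivity
          linarith) hinv]
  have hhJ := fun i j => ricci_eq_ricciJet (x := x) (fun i j => (contDiffAt_h hx i j).of_le h2)
    hdeth hinvh i j
  have hlam : ∀ i : Fin 3, pd i M.lam x = -pd i.succ (fun y => G y 0 0) p := by
    intro i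
    have hd : DifferentiableAt ℝ M.lam (Matrix.vecTail p) := by
      rw [hpx]; exact (contDiffAt_lam hx).differentiableAt (by simp)
    have := pd_succ_comp_vecTail hd i
    rw [hpx] at this
    rw [← this, ← pd_neg]
    refine pd_congr ?_ _
    filter_upwards [M.isOpen_dom.mem_nhds hpd] with y hy
    rw [lam_vecTail hy, hG, pullback_shear_time hy]
  set D : Fin 4 → Fin 4 → Fin 4 → ℝ := fun m i j => pd m (fun y => G y i j) p with hD
  -- For a Killing field `∇_c ξ_d = ½ (∂_c g_{0d} - ∂_d g_{0c})`; stationarity removes the third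
  -- term of the Christoffel symbol, and the diagonal inverse raises the indices.
  have hK : ∀ c d : Fin 4, killingGrad G p c d
      = (1 / 2) * (![-1 / M.lam x, M.lam x / a, M.lam x / b, M.lam x / a] c
        * ![-1 / M.lam x, M.lam x / a, M.lam x / b, M.lam x / a] d * (D c 0 d - D d 0 c)) := by
    intro c d
    rw [killingGrad, hinv, Matrix.diagonal_mul, Matrix.transpose_apply, Matrix.of_apply,
      christoffel, hinv, Finset.sum_eq_single d (fun l _ hl => by
        simp [Matrix.diagonal_apply_ne' _ hl]) (by simp), Matrix.diagonal_apply_eq]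
    have e1 : pd c (fun y => G y d 0) p = D c 0 d := hJ.symm₁ c d 0
    have e2 : pd 0 (fun y => G y c d) p = 0 := hJ.stat₁ c d
    have e3 : pd d (fun y => G y c 0) p = D d 0 c := hJ.symm₁ d c 0
    rw [e1, e2, e3]; ring
  have hs : (((M.orientation : ℤˣ) : ℤ) : ℝ) ^ 2 = 1 := by
    have : (((M.orientation : ℤˣ) : ℤ)) ^ 2 = 1 := by
      rcases Int.units_eq_one_or M.orientation with h | h <;> simp [h]
    exact_mod_cast this
  have hsq : √|(G p).det| ^ 2 = a ^ 2 * b / M.lam x ^ 2 := by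
    rw [Real.sq_sqrt (abs_nonneg _), hdet, abs_neg, abs_of_pos (by positivity)]
  have hω0 : pd 0 ω x = ((M.orientation : ℤ) : ℝ) * √|(G p).det| *
      (M.lam x ^ 2 / (a * b) * (D 3 0 2 - D 2 0 3)) := by
    rw [pd_twist_shear hω hx v, twistForm_eq, timeCurl_eq, ← hG, ← hp]
    have : (Fin.succ 0 : Fin 4) = 1 := rfl
    rw [this]
    simp [hK]
    left
    field_simp
    ring
  have hω2 : pd 2 ω x = ((M.orientation : ℤ) : ℝ) * √|(G p).det| *
      (M.lam x ^ 2 / (a * b) * (D 2 0 1 - D 1 0 2)) := by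
    rw [pd_twist_shear hω hx v, twistForm_eq, timeCurl_eq, ← hG, ← hp]
    have : (Fin.succ 2 : Fin 4) = 3 := rfl
    rw [this]
    simp [hK]
    left
    field_simp
    ring
  -- The orientation sign squares to `1` and the volume factor to `a² b / λ²`, so expressions
  -- quadratic in the gradient of `ω` contain neither a sign nor a root.
  have q02 : pd 0 ω x * pd 2 ω x
      = M.lam x ^ 2 / b * ((D 3 0 2 - D 2 0 3) * (D 2 0 1 - D 1 0 2)) := by
    rw [hω0, hω2]
    calc _ = (((M.orientation : ℤˣ) : ℤ) : ℝ) ^ 2 * √|(G p).det| ^ 2 * ((M.lam x ^ 2 / (a * b)) ^ 2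
          * ((D 3 0 2 - D 2 0 3) * (D 2 0 1 - D 1 0 2))) := by ring
      _ = _ := by rw [hs, hsq]; field_simp
  have q00 : pd 0 ω x ^ 2 = M.lam x ^ 2 / b * (D 3 0 2 - D 2 0 3) ^ 2 := by
    rw [hω0]
    calc _ = (((M.orientation : ℤˣ) : ℤ) : ℝ) ^ 2 * √|(G p).det| ^ 2 * ((M.lam x ^ 2 / (a * b)) ^ 2
          * (D 3 0 2 - D 2 0 3) ^ 2) := by ring
      _ = _ := by rw [hs, hsq]; field_simp
  have q22 : pd 2 ω x ^ 2 = M.lam x ^ 2 / b * (D 2 0 1 - D 1 0 2) ^ 2 := by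
    rw [hω2]
    calc _ = (((M.orientation : ℤˣ) : ℤ) : ℝ) ^ 2 * √|(G p).det| ^ 2 * ((M.lam x ^ 2 / (a * b)) ^ 2
          * (D 2 0 1 - D 1 0 2) ^ 2) := by ring
      _ = _ := by rw [hs, hsq]; field_simp
  have l0 : pd 0 M.lam x = -D 1 0 0 := hlam 0
  have l2 : pd 2 M.lam x = -D 3 0 0 := hlam 2
  constructor
  · rw [hhJ, hJ.ricciJet_offDiag hl.ne' ha.ne' hb.ne', hricJ, q02, l0, l2]
    ring
  · rw [hhJ, hhJ, hJ.ricciJet_diag hl.ne' ha.ne' hb.ne', hricJ, hricJ, q00, q22, l0, l2]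
    ring

end Spacetime

/-! ### Complex directional derivatives and their jets -/

section ComplexDerivative

variable {ι : Type} [Fintype ι] [DecidableEq ι]

/-- The derivative along the constant complex vector `v`. -/
def cderiv (v : ι → ℂ) (f : (ι → ℝ) → ℂ) (x : ι → ℝ) : ℂ := ∑ i, v i * pd i f x

variable {v : ι → ℂ} {f g : (ι → ℝ) → ℂ} {x : ι → ℝ}

lemma cderiv_add (hf : DifferentiableAt ℝ f x) (hg : DifferentiableAt ℝ g x) :
    cderiv v (fun y => f y + g y) x = cderiv v f x + cderiv v g x := by
  simp only [cderiv, pd_add hf hg, mul_add, Finset.sum_add_distrib]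

lemma cderiv_sub (hf : DifferentiableAt ℝ f x) (hg : DifferentiableAt ℝ g x) :
    cderiv v (fun y => f y - g y) x = cderiv v f x - cderiv v g x := by
  simp only [cderiv, pd_sub hf hg, mul_sub, Finset.sum_sub_distrib]

lemma cderiv_mul (hf : DifferentiableAt ℝ f x) (hg : DifferentiableAt ℝ g x) :
    cderiv v (fun y => f y * g y) x = cderiv v f x * g x + f x * cderiv v g x := by
  simp only [cderiv, pd_mul hf hg, mul_add, Finset.sum_add_distrib, Finset.sum_mul, Finset.mul_sum]
  congr 1 <;> exact Finset.sum_congr rfl fun i _ => by ring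

lemma cderiv_const (c : ℂ) : cderiv v (fun _ => c) x = 0 := by
  simp [cderiv, pd_const]

lemma cderiv_congr (h : f =ᶠ[𝓝 x] g) : cderiv v f x = cderiv v g x := by
  simp only [cderiv, pd_congr h]

lemma cderiv_eventuallyEq (h : f =ᶠ[𝓝 x] g) : cderiv v f =ᶠ[𝓝 x] cderiv v g := by
  filter_upwards [h.eventuallyEq_nhds] with y hy using cderiv_congr hy

lemma contDiffAt_cderiv (hf : ContDiffAt ℝ (⊤ : ℕ∞) f x) :
    ContDiffAt ℝ (⊤ : ℕ∞) (cderiv v f) x :=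
  ContDiffAt.sum fun i _ => contDiffAt_const.mul (contDiffAt_pd hf (by simp) i)

lemma eventually_differentiableAt {E : Type} [NormedAddCommGroup E] [NormedSpace ℝ E]
    {f : (ι → ℝ) → E} (hf : ContDiffAt ℝ (⊤ : ℕ∞) f x) :
    ∀ᶠ y in 𝓝 x, DifferentiableAt ℝ f y := by
  have h1 : ContDiffAt ℝ 1 f x := hf.of_le (WithTop.coe_le_coe.2 le_top)
  filter_upwards [h1.eventually (by simp)] with y hy
  exact hy.differentiableAt (by norm_num)

/-- The derivatives of order `< m` of `f` along `v` vanish at the origin. -/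
def JetZero (v : ι → ℂ) : ℕ → ((ι → ℝ) → ℂ) → Prop
  | 0, _ => True
  | m + 1, f => f 0 = 0 ∧ JetZero v m (cderiv v f)

lemma JetZero.congr {m : ℕ} (hf : JetZero v m f) (h : f =ᶠ[𝓝 0] g) : JetZero v m g := by
  induction m generalizing f g with
  | zero => trivial
  | succ m ih => exact ⟨h.self_of_nhds ▸ hf.1, ih hf.2 (cderiv_eventuallyEq h)⟩

lemma JetZero.of_succ {m : ℕ} (hf : JetZero v (m + 1) f) : JetZero v m f := by
  induction m generalizing f with
  | zero => trivial
  | succ m ih => exact ⟨hf.1, ih hf.2⟩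

lemma JetZero.add {m : ℕ} (hf : JetZero v m f) (hg : JetZero v m g)
    (cf : ContDiffAt ℝ (⊤ : ℕ∞) f 0) (cg : ContDiffAt ℝ (⊤ : ℕ∞) g 0) :
    JetZero v m (fun y => f y + g y) := by
  induction m generalizing f g with
  | zero => trivial
  | succ m ih =>
    refine ⟨by simp [hf.1, hg.1], ?_⟩
    refine (ih hf.2 hg.2 (contDiffAt_cderiv cf) (contDiffAt_cderiv cg)).congr ?_
    filter_upwards [eventually_differentiableAt cf, eventually_differentiableAt cg] with y h1 h2
    exact (cderiv_add h1 h2).symm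

/-- By the Leibniz rule the smooth functions with vanishing jets form an ideal: nothing is asked of
the jets of `f`. -/
lemma JetZero.mul {m : ℕ} (hg : JetZero v m g) (cf : ContDiffAt ℝ (⊤ : ℕ∞) f 0)
    (cg : ContDiffAt ℝ (⊤ : ℕ∞) g 0) : JetZero v m (fun y => f y * g y) := by
  induction m generalizing f g with
  | zero => trivial
  | succ m ih =>
    refine ⟨by simp [hg.1], ?_⟩
    have h1 := ih hg.of_succ (contDiffAt_cderiv (v := v) cf) cg
    have h2 := ih hg.2 cf (contDiffAt_cderiv cg)
    refine (h1.add h2 ((contDiffAt_cderiv cf).mul cg) (cf.mul (contDiffAt_cderiv cg))).congr ?_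
    filter_upwards [eventually_differentiableAt cf, eventually_differentiableAt cg] with y h1 h2
    exact (cderiv_mul h1 h2).symm

/-- A solution of a homogeneous linear second order equation whose value and first derivative
vanish has vanishing jets. -/
lemma JetZero.of_ode {p q : (ι → ℝ) → ℂ} (cf : ContDiffAt ℝ (⊤ : ℕ∞) f 0)
    (cp : ContDiffAt ℝ (⊤ : ℕ∞) p 0) (cq : ContDiffAt ℝ (⊤ : ℕ∞) q 0) (h0 : f 0 = 0)
    (h1 : cderiv v f 0 = 0)
    (hode : ∀ m, JetZero v m fun y =>
      cderiv v (cderiv v f) y - (p y * cderiv v f y + q y * f y)) (m : ℕ) :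
    JetZero v m f := by
  have c1 := contDiffAt_cderiv (v := v) cf
  have c2 := contDiffAt_cderiv (v := v) c1
  have key : ∀ m, JetZero v (m + 1) f := by
    intro m
    induction m with
    | zero => exact ⟨h0, trivial⟩
    | succ m ih =>
      refine ⟨h0, ?_⟩
      cases m with
      | zero => exact ⟨h1, trivial⟩
      | succ m =>
        refine ⟨h1, ?_⟩
        -- What is known about `f` and `vf` makes `p · vf + q · f` vanish to order `m + 1`. The
        -- equation hands this on to `v(vf)`, which is a gain of one order for `f`.
        have e1' : JetZero v (m + 1) (cderiv v f) := ih.2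
        have e2 := (e1'.mul cp c1).add (ih.of_succ.mul cq cf) (cp.mul c1) (cq.mul cf)
        have e3 := (hode (m + 1)).add e2 (c2.sub ((cp.mul c1).add (cq.mul cf)))
          ((cp.mul c1).add (cq.mul cf))
        exact e3.congr (Filter.Eventually.of_forall fun y => by ring)
  exact (key m).of_succ

end ComplexDerivative

/-! ### Null directions and meridian half-planes -/

section HalfPlane

/-- The complex null vector `∂/∂z - i ∂/∂ρ` of the meridian half-plane with azimuth `θ`. -/
def nullDir (θ : ℝ) : Fin 3 → ℂ :=
  ![-Complex.I * Real.cos θ, -Complex.I * Real.sin θ, 1]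

/-- The meridian half-plane with azimuth `θ`. -/
def halfPlane (θ : ℝ) : Set (Fin 3 → ℝ) :=
  {x | ∃ ρ > 0, ∃ z, x = ![ρ * Real.cos θ, ρ * Real.sin θ, z]}

/-- A half-plane omits the axis, where the form of the metric is not given; identities valid on it
reach `Λ` by a limit. -/
lemma zero_mem_closure_halfPlane (θ : ℝ) : (0 : Fin 3 → ℝ) ∈ closure (halfPlane θ) := by
  have h : Filter.Tendsto (fun ρ : ℝ => ρ • ![Real.cos θ, Real.sin θ, 0]) (𝓝[>] 0)
      (𝓝 (0 : Fin 3 → ℝ)) := by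
    have : Filter.Tendsto (fun ρ : ℝ => ρ • ![Real.cos θ, Real.sin θ, 0]) (𝓝 0)
      (𝓝 ((0 : ℝ) • ![Real.cos θ, Real.sin θ, 0])) :=
      (continuous_id.smul continuous_const).tendsto 0
    rw [zero_smul] at this
    exact this.mono_left nhdsWithin_le_nhds
  refine mem_closure_of_tendsto h ?_
  filter_upwards [self_mem_nhdsWithin] with ρ hρ
  exact ⟨ρ, hρ, 0, by simp⟩

instance (θ : ℝ) : (𝓝[halfPlane θ] (0 : Fin 3 → ℝ)).NeBot :=
  mem_closure_iff_nhdsWithin_neBot.1 (zero_mem_closure_halfPlane θ)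

/-- The null vector is a complex combination of the radial and the axial vector. Both are tangent to
the half-plane, so the derivative depends only on the values on it. -/
lemma cderiv_nullDir {f : (Fin 3 → ℝ) → ℂ} {x : Fin 3 → ℝ} (θ : ℝ) :
    cderiv (nullDir θ) f x = -Complex.I * fderiv ℝ f x ![Real.cos θ, Real.sin θ, 0]
      + fderiv ℝ f x ![0, 0, 1] := by
  have e1 : (![Real.cos θ, Real.sin θ, 0] : Fin 3 → ℝ)
      = Real.cos θ • Pi.single 0 1 + Real.sin θ • Pi.single 1 1 := by
    funext i; fin_cases i <;> simp
  have e2 : (![0, 0, 1] : Fin 3 → ℝ) = Pi.single 2 1 := by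
    funext i; fin_cases i <;> simp
  rw [e1, e2, map_add, map_smul, map_smul]
  simp only [cderiv, nullDir, Fin.sum_univ_three, pd]
  simp
  ring

lemma line_mem_halfPlane {θ : ℝ} {x : Fin 3 → ℝ} (hx : x ∈ halfPlane θ) (a b : ℝ) :
    ∀ᶠ t : ℝ in 𝓝 0, x + t • ![a * Real.cos θ, a * Real.sin θ, b] ∈ halfPlane θ := by
  obtain ⟨ρ, hρ, z, rfl⟩ := hx
  have : ∀ᶠ t : ℝ in 𝓝 0, 0 < ρ + t * a := by
    have hc : Filter.Tendsto (fun t : ℝ => ρ + t * a) (𝓝 0) (𝓝 (ρ + 0 * a)) :=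
      (continuous_const.add (continuous_id.mul continuous_const)).tendsto 0
    exact hc.eventually (lt_mem_nhds (by simpa using hρ))
  filter_upwards [this] with t ht
  refine ⟨ρ + t * a, ht, z + t * b, ?_⟩
  funext i; fin_cases i <;> simp <;> ring

lemma fderiv_eq_zero_of_halfPlane {E : Type} [NormedAddCommGroup E] [NormedSpace ℝ E]
    {f : (Fin 3 → ℝ) → E} {θ : ℝ} {x : Fin 3 → ℝ}
    (hx : x ∈ halfPlane θ) (hf : DifferentiableAt ℝ f x) (c : E)
    (h : ∀ᶠ y in 𝓝 x, y ∈ halfPlane θ → f y = c) (a b : ℝ) :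
    fderiv ℝ f x ![a * Real.cos θ, a * Real.sin θ, b] = 0 := by
  set d : Fin 3 → ℝ := ![a * Real.cos θ, a * Real.sin θ, b] with hd
  have hl : HasDerivAt (fun s : ℝ => x + s • d) d 0 := by
    simpa using ((hasDerivAt_id (0 : ℝ)).smul_const d).const_add x
  have hf' : HasFDerivAt f (fderiv ℝ f x) (x + (0 : ℝ) • d) := by simpa using hf.hasFDerivAt
  have h1 : HasDerivAt (fun s : ℝ => f (x + s • d)) (fderiv ℝ f x d) 0 :=
    hf'.comp_hasDerivAt (0 : ℝ) hl
  have ht : Filter.Tendsto (fun s : ℝ => x + s • d) (𝓝 0) (𝓝 x) := by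
    simpa using hl.continuousAt.tendsto
  have h2 : (fun s : ℝ => f (x + s • d)) =ᶠ[𝓝 0] fun _ => c := by
    filter_upwards [ht.eventually h, line_mem_halfPlane hx a b] with s h1 h2 using h1 h2
  exact (h1.congr_of_eventuallyEq h2.symm).unique (hasDerivAt_const 0 c)

lemma cderiv_eq_zero_of_halfPlane {f : (Fin 3 → ℝ) → ℂ} {θ : ℝ} {x : Fin 3 → ℝ}
    (hx : x ∈ halfPlane θ) (hf : DifferentiableAt ℝ f x) (c : ℂ)
    (h : ∀ᶠ y in 𝓝 x, y ∈ halfPlane θ → f y = c) :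
    cderiv (nullDir θ) f x = 0 := by
  have h1 := fderiv_eq_zero_of_halfPlane hx hf c h 1 0
  have h2 := fderiv_eq_zero_of_halfPlane hx hf c h 0 1
  simp only [one_mul, zero_mul] at h1 h2
  rw [cderiv_nullDir, h1, h2]
  simp

/-- A smooth function which vanishes on a half-plane near the origin has vanishing jets. -/
lemma JetZero.of_halfPlane {f : (Fin 3 → ℝ) → ℂ} {θ : ℝ} (cf : ContDiffAt ℝ (⊤ : ℕ∞) f 0)
    (h : ∀ᶠ x in 𝓝[halfPlane θ] 0, f x = 0) (m : ℕ) : JetZero (nullDir θ) m f := by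
  induction m generalizing f with
  | zero => trivial
  | succ m ih =>
    refine ⟨?_, ih (contDiffAt_cderiv cf) ?_⟩
    · have h1 : Filter.Tendsto f (𝓝[halfPlane θ] 0) (𝓝 (f 0)) :=
        cf.continuousAt.tendsto.mono_left nhdsWithin_le_nhds
      have h2 : Filter.Tendsto f (𝓝[halfPlane θ] 0) (𝓝 0) :=
        tendsto_const_nhds.congr' (h.mono fun x hx => hx.symm)
      exact tendsto_nhds_unique h1 h2
    · rw [eventually_nhdsWithin_iff] at h ⊢
      filter_upwards [h.eventually_nhds, eventually_differentiableAt cf] with x h1 h2 hx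
      exact cderiv_eq_zero_of_halfPlane hx h2 0 h1

end HalfPlane

/-! ### Contraction of tensors with null vectors -/

section Contraction

variable {ι : Type} [Fintype ι] [DecidableEq ι]

/-- The contraction `T(v, …, v)`. -/
def contract (v : ι → ℂ) {n : ℕ} (T : (Fin n → ι) → ℂ) : ℂ := ∑ a, (∏ m, v (a m)) * T a

variable {v : ι → ℂ} {n : ℕ}

lemma contract_sub (T S : (Fin n → ι) → ℂ) :
    contract v (fun a => T a - S a) = contract v T - contract v S := by
  simp [contract, mul_sub, Finset.sum_sub_distrib]

lemma contract_symmetrize (T : (Fin n → ι) → ℂ) : contract v (symmetrize T) = contract v T := by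
  have h : ∀ σ : Equiv.Perm (Fin n), ∑ a : Fin n → ι, (∏ m, v (a m)) * T (a ∘ σ)
      = contract v T := by
    intro σ
    have e := Equiv.sum_comp (Equiv.arrowCongr σ.symm (Equiv.refl ι))
      (fun a : Fin n → ι => (∏ m, v (a m)) * T a)
    rw [contract, ← e]
    refine Finset.sum_congr rfl fun a _ => ?_
    congr 1
    simp only [Equiv.arrowCongr_apply, Equiv.coe_refl, Function.comp_apply, id_eq,
      Equiv.symm_symm]
    exact (Equiv.prod_comp σ fun m => v (a m)).symm
  have hn : ((n.factorial : ℂ)) ≠ 0 := by exact_mod_cast n.factorial_ne_zero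
  calc contract v (symmetrize T)
      = ∑ a : Fin n → ι, ∑ σ : Equiv.Perm (Fin n), ((n.factorial : ℂ))⁻¹ *
          ((∏ m, v (a m)) * T (a ∘ σ)) := by
        simp only [contract, symmetrize, Finset.mul_sum]
        exact Finset.sum_congr rfl fun a _ => Finset.sum_congr rfl fun σ _ => by ring
    _ = ∑ σ : Equiv.Perm (Fin n), ((n.factorial : ℂ))⁻¹ * contract v T := by
        rw [Finset.sum_comm]
        exact Finset.sum_congr rfl fun σ _ => by rw [← Finset.mul_sum, h]
    _ = contract v T := by
        rw [Finset.sum_const, Finset.card_univ, Fintype.card_perm, Fintype.card_fin, nsmul_eq_mul,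
          mul_inv_cancel_left₀ hn]

/-- Summing over the slots `i` and `j` first produces the factor `h(v, v) = 0`. These two sums are
isolated by `sum_update₂`: overwriting two slots before summing repeats every term the same number
of times. -/
lemma contract_traceSpan [Nonempty ι] {h : Matrix ι ι ℝ}
    (hv : ∑ k, ∑ l, (h k l : ℂ) * v k * v l = 0)
    {W : (Fin n → ι) → ℂ} (hW : W ∈ traceSpan h n) : contract v W = 0 := by
  have hN : (Fintype.card ι : ℂ) ≠ 0 := by exact_mod_cast Fintype.card_ne_zero
  induction hW using Submodule.span_induction with
  | zero => simp [contract]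
  | add x y _ _ hx hy =>
    simp only [contract, Pi.add_apply, mul_add, Finset.sum_add_distrib] at hx hy ⊢
    rw [hx, hy, add_zero]
  | smul r x _ hx =>
    simp only [contract, Pi.smul_apply, smul_eq_mul, mul_left_comm] at hx ⊢
    rw [← Finset.mul_sum, hx, mul_zero]
  | mem W hW =>
    obtain ⟨i, j, hij, Q, hQ, rfl⟩ := hW
    have key := sum_update₂ i j (fun a : Fin n → ι =>
      (∏ m, v (a m)) * ((h (a i) (a j) : ℂ) * Q a))
    have : ∀ a : Fin n → ι, ∑ k, ∑ l, (fun a : Fin n → ι =>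
        (∏ m, v (a m)) * ((h (a i) (a j) : ℂ) * Q a))
          (Function.update (Function.update a i k) j l) = 0 := by
      intro a
      rw [← mul_zero ((∏ m ∈ (Finset.univ.erase i).erase j, v (a m)) * Q a), ← hv]
      simp only [Finset.mul_sum]
      refine Finset.sum_congr rfl fun k _ => Finset.sum_congr rfl fun l _ => ?_
      rw [prod_split hij, hQ, Function.update_self, Function.update_of_ne hij,
        Function.update_self, Finset.prod_congr rfl (g := fun m => v (a m))]
      · ring
      · intro m hm
        simp only [Finset.mem_erase] at hm
        rw [Function.update_of_ne hm.1, Function.update_of_ne hm.2.1]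
    simp only [this, Finset.sum_const_zero] at key
    simpa [contract, hN] using key.symm

/-- Contraction with a null vector does not see the difference between a tensor and its symmetric
trace-free part. -/
lemma contract_stfPart [Nonempty ι] {h : Matrix ι ι ℝ} (hh : h.PosDef)
    (hv : ∑ k, ∑ l, (h k l : ℂ) * v k * v l = 0) (T : (Fin n → ι) → ℂ) :
    contract v (stfPart h T) = contract v T := by
  have := contract_traceSpan hv (stfPart_spec hh T).differ
  rw [contract_sub, contract_symmetrize, sub_eq_zero] at this
  exact this.symm

lemma sum_fin_succ (F : (Fin (n + 1) → ι) → ℂ) :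
    ∑ a, F a = ∑ i, ∑ b : Fin n → ι, F (Fin.cons i b) := by
  rw [← Fintype.sum_prod_type' (f := fun i (b : Fin n → ι) => F (Fin.cons i b))]
  exact ((Fin.consEquiv fun _ => ι).sum_comp F).symm

lemma contract_succ (T : (Fin (n + 1) → ι) → ℂ) :
    contract v T = ∑ i, v i * contract v fun b => T (Fin.cons i b) := by
  simp only [contract]
  rw [sum_fin_succ]
  refine Finset.sum_congr rfl fun i _ => ?_
  rw [Finset.mul_sum]
  refine Finset.sum_congr rfl fun b _ => ?_
  rw [Fin.prod_univ_succ]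
  simp [mul_assoc]

/-- Contraction with `v` of an endomorphism acting in one slot, if `v` is an eigenvector. -/
lemma contract_update {A : ι → ι → ℂ} {μ : ℂ} (hA : ∀ k, ∑ l, A k l * v l = μ * v k) (j : Fin n)
    (T : (Fin n → ι) → ℂ) :
    contract v (fun b => ∑ k, A k (b j) * T (Function.update b j k)) = μ * contract v T := by
  let e : ((Fin n → ι) × ι) ≃ ((Fin n → ι) × ι) :=
    { toFun := fun p => (Function.update p.1 j p.2, p.1 j)
      invFun := fun p => (Function.update p.1 j p.2, p.1 j)
      left_inv := fun p => by simp
      right_inv := fun p => by simp }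
  let F : (Fin n → ι) × ι → ℂ := fun p =>
    (∏ m ∈ Finset.univ.erase j, v (p.1 m)) * (A (p.1 j) p.2 * v p.2) * T p.1
  calc contract v (fun b => ∑ k, A k (b j) * T (Function.update b j k))
      = ∑ p : (Fin n → ι) × ι, F (e p) := by
        rw [Fintype.sum_prod_type]
        simp only [contract, Finset.mul_sum]
        refine Finset.sum_congr rfl fun b _ => Finset.sum_congr rfl fun k _ => ?_
        simp only [F, e, Equiv.coe_fn_mk, Function.update_self]
        rw [← Finset.mul_prod_erase Finset.univ _ (Finset.mem_univ j),
          Finset.prod_congr rfl (g := fun m => v (b m))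
          (f := fun m => v (Function.update b j k m))]
        · ring
        · intro m hm
          rw [Function.update_of_ne (Finset.ne_of_mem_erase hm)]
    _ = ∑ p, F p := e.sum_comp F
    _ = μ * contract v T := by
        rw [Fintype.sum_prod_type]
        simp only [contract, Finset.mul_sum, F]
        refine Finset.sum_congr rfl fun b _ => ?_
        rw [← Finset.sum_mul, ← Finset.mul_sum, hA,
          ← Finset.mul_prod_erase Finset.univ (fun m => v (b m)) (Finset.mem_univ j)]
        ring

lemma cderiv_contract {T : (ι → ℝ) → (Fin n → ι) → ℂ} {x : ι → ℝ}
    (hT : ∀ a, DifferentiableAt ℝ (fun y => T y a) x) (w : ι → ℂ) :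
    cderiv w (fun y => contract v (T y)) x
      = ∑ i, w i * contract v fun a => pd i (fun y => T y a) x := by
  simp only [cderiv, contract]
  refine Finset.sum_congr rfl fun i _ => ?_
  rw [pd_sum _ fun a _ => (hT a).const_mul _]
  congr 1
  exact Finset.sum_congr rfl fun a _ => pd_const_mul _ (hT a) i

/-- Contraction of a covariant derivative with a constant vector that is geodesic at the point
considered. -/
lemma contract_covDeriv {G : (ι → ℝ) → Matrix ι ι ℝ} {T : (ι → ℝ) → (Fin n → ι) → ℂ}
    {x : ι → ℝ} {μ : ℂ} (hT : ∀ a, DifferentiableAt ℝ (fun y => T y a) x)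
    (hμ : ∀ k, ∑ i, ∑ l, (christoffel G x k i l : ℂ) * v i * v l = μ * v k) :
    contract v (covDeriv G T x)
      = cderiv v (fun y => contract v (T y)) x - n * μ * contract v (T x) := by
  -- The geodesic condition says that `v` is an eigenvector of the matrix `Γᵏ_{il} vⁱ`, so every
  -- slot of `T` contributes the same factor `μ`.
  have h1 : ∀ j : Fin n, contract v (fun b => ∑ k, (∑ i, v i * (christoffel G x k i (b j) : ℂ))
      * T x (Function.update b j k)) = μ * contract v (T x) := by
    intro j
    refine contract_update (A := fun k l => ∑ i, v i * (christoffel G x k i l : ℂ)) (fun k => ?_)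
      j (T x)
    rw [← hμ k, Finset.sum_comm]
    refine Finset.sum_congr rfl fun l _ => ?_
    rw [Finset.sum_mul]
    exact Finset.sum_congr rfl fun i _ => by ring
  rw [contract_succ, cderiv_contract hT]
  simp only [covDeriv, Fin.cons_zero, Fin.cons_succ, contract_sub, mul_sub,
    Finset.sum_sub_distrib]
  congr 1
  calc ∑ i, v i * contract v (fun b => ∑ j : Fin n, ∑ k, (christoffel G x k i (b j) : ℂ) *
        T x (Function.update (fun m => b m) j k))
      = ∑ j : Fin n, contract v (fun b => ∑ k, (∑ i, v i * (christoffel G x k i (b j) : ℂ))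
      * T x (Function.update b j k)) := by
        simp only [contract, Finset.mul_sum, Finset.sum_mul]
        rw [Finset.sum_comm]
        rw [Finset.sum_comm (s := (Finset.univ : Finset (Fin n)))]
        refine Finset.sum_congr rfl fun b _ => ?_
        rw [Finset.sum_comm]
        refine Finset.sum_congr rfl fun j _ => ?_
        rw [Finset.sum_comm]
        refine Finset.sum_congr rfl fun k _ => Finset.sum_congr rfl fun i _ => ?_
        ring
    _ = n * μ * contract v (T x) := by
        simp only [h1]
        simp [mul_assoc]

lemma contract_ricci (R : ι → ι → ℂ) (T : (Fin n → ι) → ℂ) (c : ℂ) :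
    contract v (fun a : Fin (n + 2) → ι => c * R (a 0) (a 1) * T fun k => a k.succ.succ)
      = c * (∑ i, ∑ j, R i j * v i * v j) * contract v T := by
  rw [contract_succ]
  simp only [contract_succ (v := v) (n := n)]
  have e : ∀ i j (b : Fin n → ι),
      c * R ((Fin.cons i (Fin.cons j b : Fin (n + 1) → ι) : Fin (n + 2) → ι) 0)
        ((Fin.cons i (Fin.cons j b : Fin (n + 1) → ι) : Fin (n + 2) → ι) 1)
        * T (fun k => (Fin.cons i (Fin.cons j b : Fin (n + 1) → ι) : Fin (n + 2) → ι) k.succ.succ)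
      = c * R i j * T b := by
    intro i j b
    rfl
  simp only [e, contract, Finset.mul_sum, Finset.sum_mul]
  rw [Finset.sum_comm (s := (Finset.univ : Finset (Fin n → ι)))]
  refine Finset.sum_congr rfl fun i _ => ?_
  rw [Finset.sum_comm (s := (Finset.univ : Finset (Fin n → ι)))]
  refine Finset.sum_congr rfl fun j _ => Finset.sum_congr rfl fun b _ => ?_
  ring

end Contraction

/-! ### Smooth dependence of the symmetric trace-free part -/

section Smoothness

variable {ι : Type} [Fintype ι] [DecidableEq ι]

lemma chg_symmetrize (B : Matrix ι ι ℝ) {n : ℕ} (T : (Fin n → ι) → ℂ) :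
    chg B (symmetrize T) = symmetrize (chg B T) := by
  funext a
  simp only [chg_apply, symmetrize, Finset.mul_sum]
  rw [Finset.sum_comm]
  refine Finset.sum_congr rfl fun σ _ => ?_
  have e := Equiv.sum_comp (Equiv.arrowCongr σ.symm (Equiv.refl ι))
      (fun c : Fin n → ι => ((n.factorial : ℂ))⁻¹ *
        ((∏ m, (B (c m) ((a ∘ σ) m) : ℂ)) * T c))
  rw [← e]
  refine Finset.sum_congr rfl fun c _ => ?_
  have : ∏ m, (B (c m) (a m) : ℂ) = ∏ m, (B (c (σ m)) (a (σ m)) : ℂ) :=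
    (Equiv.prod_comp σ fun m => (B (c m) (a m) : ℂ)).symm
  have hc : Equiv.arrowCongr σ.symm (Equiv.refl ι) c = c ∘ σ := rfl
  rw [this, hc]
  simp only [Function.comp_apply]
  ring

lemma isSTFPart_chg [Nonempty ι] {h B : Matrix ι ι ℝ} (hB : IsUnit B.det) {n : ℕ}
    {T S : (Fin n → ι) → ℂ} (hS : IsSTFPart h T S) :
    IsSTFPart (B.transpose * h * B) (chg B T) (chg B S) := by
  have hsymm : symmetrize S = S := by
    funext a
    simp only [symmetrize, hS.symmetric]
    rw [Finset.sum_const, Finset.card_univ, Fintype.card_perm, Fintype.card_fin, nsmul_eq_mul,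
      inv_mul_cancel_left₀ (by exact_mod_cast n.factorial_ne_zero)]
  refine ⟨?_, ?_, ?_⟩
  · intro σ a
    rw [← hsymm, chg_symmetrize, symmetrize_symm]
  · intro i j hij a
    exact traceAt_chg h B hB hij (hS.traceFree i j hij) a
  · have h1 := chg_mem_traceSpan h B hS.differ
    have h2 : (fun a => symmetrize (chg B T) a - chg B S a)
        = chg B (fun a => symmetrize T a - S a) := by
      have e : (fun a => symmetrize T a - S a) = symmetrize T - S := rfl
      rw [e, map_sub, chg_symmetrize]
      rfl
    rw [h2]; exact h1

lemma stfPart_eq [Nonempty ι] {h : Matrix ι ι ℝ} (hh : h.PosDef) {n : ℕ} {T S : (Fin n → ι) → ℂ}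
    (hS : IsSTFPart h T S) : stfPart h T = S :=
  (existsUnique_stfPart hh T).unique (stfPart_spec hh T) hS

/-- In an orthonormal frame the metric becomes Euclidean and `C[·]` a fixed linear map, so the
dependence on the metric sits in `B` alone. This turns the choice-based definition of `stfPart` into
a formula that is smooth in the base point. -/
lemma stfPart_frame [Nonempty ι] {B : Matrix ι ι ℝ} (hB : IsUnit B.det) {n : ℕ}
    (hh : (B.transpose * B).PosDef) (T : (Fin n → ι) → ℂ) :
    stfPart (B.transpose * B) T = chg B (stfPart 1 (chg B⁻¹ T)) := by
  refine stfPart_eq hh ?_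
  have h1 := isSTFPart_chg hB (stfPart_spec (Matrix.PosDef.one (n := ι) (R := ℝ)) (chg B⁻¹ T))
  rwa [Matrix.mul_one, chg_chg, Matrix.nonsing_inv_mul _ hB, chg_one] at h1

/-- The symmetric trace-free part for the Euclidean metric, as a linear map. -/
def stfLinear [Nonempty ι] (n : ℕ) : ((Fin n → ι) → ℂ) →ₗ[ℂ] ((Fin n → ι) → ℂ) where
  toFun := stfPart (1 : Matrix ι ι ℝ)
  map_add' S T := by
    have h1 := stfPart_spec (Matrix.PosDef.one (n := ι) (R := ℝ)) S
    have h2 := stfPart_spec (Matrix.PosDef.one (n := ι) (R := ℝ)) T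
    refine stfPart_eq Matrix.PosDef.one ⟨?_, ?_, ?_⟩
    · intro σ a; simp [h1.symmetric, h2.symmetric]
    · intro i j hij a
      have e1 := h1.traceFree i j hij a
      have e2 := h2.traceFree i j hij a
      simp only [traceAt] at e1 e2 ⊢
      simp only [Pi.add_apply, mul_add, Finset.sum_add_distrib, e1, e2, add_zero]
    · convert Submodule.add_mem _ h1.differ h2.differ using 1
      funext a
      simp [symmetrize, mul_add, Finset.sum_add_distrib]
      ring
  map_smul' r T := by
    have h2 := stfPart_spec (Matrix.PosDef.one (n := ι) (R := ℝ)) T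
    refine stfPart_eq Matrix.PosDef.one ⟨?_, ?_, ?_⟩
    · intro σ a; simp [h2.symmetric]
    · intro i j hij a
      have e2 := h2.traceFree i j hij a
      simp only [traceAt] at e2 ⊢
      simp only [Pi.smul_apply, smul_eq_mul, RingHom.id_apply, mul_left_comm _ r,
        ← Finset.mul_sum, e2, mul_zero]
    · convert Submodule.smul_mem _ r h2.differ using 1
      funext a
      simp [symmetrize, ← Finset.mul_sum]
      ring

/-- The Cholesky factor of a positive definite `3 × 3` matrix. -/
def cholesky (h : Matrix (Fin 3) (Fin 3) ℝ) : Matrix (Fin 3) (Fin 3) ℝ :=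
  let p := √(h 0 0)
  let q := h 0 1 / p
  let r := h 0 2 / p
  let s := √(h 1 1 - q ^ 2)
  let t := (h 1 2 - q * r) / s
  !![p, q, r; 0, s, t; 0, 0, √(h 2 2 - r ^ 2 - t ^ 2)]

/-- The pivots of a positive definite `3 × 3` matrix are positive. -/
lemma cholesky_pos {h : Matrix (Fin 3) (Fin 3) ℝ} (hh : h.PosDef) :
    0 < h 0 0 ∧ 0 < h 1 1 - (h 0 1 / √(h 0 0)) ^ 2 ∧
    0 < h 2 2 - (h 0 2 / √(h 0 0)) ^ 2 - ((h 1 2 - h 0 1 / √(h 0 0) * (h 0 2 / √(h 0 0)))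
      / √(h 1 1 - (h 0 1 / √(h 0 0)) ^ 2)) ^ 2 := by
  have h10 : h 1 0 = h 0 1 := by simpa using hh.isHermitian.apply 0 1
  have h20 : h 2 0 = h 0 2 := by simpa using hh.isHermitian.apply 0 2
  have h21 : h 2 1 = h 1 2 := by simpa using hh.isHermitian.apply 1 2
  have h0 : 0 < h 0 0 := hh.diag_pos
  have hm : 0 < h 0 0 * h 1 1 - h 0 1 ^ 2 := by
    have hinj : Function.Injective ![(0 : Fin 3), 1] := by decide
    have := (hh.submatrix hinj).det_pos
    rw [Matrix.det_fin_two] at this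
    simp [h10] at this
    nlinarith
  have hdet := hh.det_pos
  rw [Matrix.det_fin_three, h10, h20, h21] at hdet
  have hsq : √(h 0 0) ^ 2 = h 0 0 := Real.sq_sqrt h0.le
  have e1 : h 1 1 - (h 0 1 / √(h 0 0)) ^ 2 = (h 0 0 * h 1 1 - h 0 1 ^ 2) / h 0 0 := by
    rw [div_pow, hsq]; field_simp
  have h1 : 0 < h 1 1 - (h 0 1 / √(h 0 0)) ^ 2 := by rw [e1]; positivity
  refine ⟨h0, h1, ?_⟩
  have e2 : h 0 1 / √(h 0 0) * (h 0 2 / √(h 0 0)) = h 0 1 * h 0 2 / h 0 0 := by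
    rw [div_mul_div_comm, ← sq, hsq]
  have e3 : h 2 2 - (h 0 2 / √(h 0 0)) ^ 2 - ((h 1 2 - h 0 1 / √(h 0 0) * (h 0 2 / √(h 0 0)))
      / √(h 1 1 - (h 0 1 / √(h 0 0)) ^ 2)) ^ 2
      = (h 0 0 * h 1 1 * h 2 2 - h 0 0 * h 1 2 * h 1 2 - h 0 1 * h 0 1 * h 2 2
        + h 0 1 * h 1 2 * h 0 2 + h 0 2 * h 0 1 * h 1 2 - h 0 2 * h 1 1 * h 0 2)
        / (h 0 0 * h 1 1 - h 0 1 ^ 2) := by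
    rw [div_pow _ (√(h 1 1 - _)), Real.sq_sqrt h1.le, e1, e2, div_pow, hsq]
    field_simp
    ring
  rw [e3]
  exact div_pos hdet hm

lemma cholesky_mul {h : Matrix (Fin 3) (Fin 3) ℝ} (hh : h.PosDef) :
    (cholesky h).transpose * cholesky h = h := by
  obtain ⟨h0, h1, h2⟩ := cholesky_pos hh
  have h10 : h 1 0 = h 0 1 := by simpa using hh.isHermitian.apply 0 1
  have h20 : h 2 0 = h 0 2 := by simpa using hh.isHermitian.apply 0 2
  have h21 : h 2 1 = h 1 2 := by simpa using hh.isHermitian.apply 1 2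
  have p0 := Real.sqrt_pos.2 h0
  have s0 := Real.sqrt_pos.2 h1
  have e0 := Real.mul_self_sqrt h0.le
  have e1 := Real.mul_self_sqrt h1.le
  have e2 := Real.mul_self_sqrt h2.le
  ext i j
  fin_cases i <;> fin_cases j <;>
    simp [cholesky, Matrix.mul_apply, Fin.sum_univ_three]
  · exact e0
  · field_simp
  · field_simp
  · rw [h10]; field_simp
  · rw [e1]; ring
  · rw [mul_div_cancel₀ _ s0.ne']; ring
  · rw [h20]; field_simp
  · rw [div_mul_cancel₀ _ s0.ne', h21]; ring
  · rw [e2]; ring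

lemma det_cholesky {h : Matrix (Fin 3) (Fin 3) ℝ} (hh : h.PosDef) : (cholesky h).det ≠ 0 := by
  intro h0
  have := hh.det_pos
  rw [← cholesky_mul hh, Matrix.det_mul, h0] at this
  simp at this

lemma contDiffAt_cholesky {n : WithTop ℕ∞} {G : (Fin 3 → ℝ) → Matrix (Fin 3) (Fin 3) ℝ}
    {x : Fin 3 → ℝ} (hG : ∀ i j, ContDiffAt ℝ n (fun y => G y i j) x) (hx : (G x).PosDef)
    (i j : Fin 3) : ContDiffAt ℝ n (fun y => cholesky (G y) i j) x := by
  obtain ⟨h0, h1, h2⟩ := cholesky_pos hx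
  have cp := (hG 0 0).sqrt h0.ne'
  have np := (Real.sqrt_pos.2 h0).ne'
  have cq := (hG 0 1).fun_div cp np
  have cr := (hG 0 2).fun_div cp np
  have cs := ((hG 1 1).sub (cq.pow 2)).sqrt h1.ne'
  have ct := ((hG 1 2).sub (cq.mul cr)).fun_div cs (Real.sqrt_pos.2 h1).ne'
  have cu := (((hG 2 2).sub (cr.pow 2)).sub (ct.pow 2)).sqrt h2.ne'
  fin_cases i <;> fin_cases j <;> simp [cholesky]
  · exact cp
  · exact cq
  · exact cr
  · exact contDiffAt_const
  · exact cs
  · exact ct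
  · exact contDiffAt_const
  · exact contDiffAt_const
  · exact cu

lemma contDiffAt_chg {m : WithTop ℕ∞} {E : Type} [NormedAddCommGroup E] [NormedSpace ℝ E]
    {B : E → Matrix ι ι ℝ} {n : ℕ} {T : E → (Fin n → ι) → ℂ} {x : E}
    (hB : ∀ i j, ContDiffAt ℝ m (fun y => B y i j) x) (hT : ∀ a, ContDiffAt ℝ m (fun y => T y a) x)
    (a : Fin n → ι) : ContDiffAt ℝ m (fun y => chg (B y) (T y) a) x := by
  simp only [chg_apply]
  refine ContDiffAt.sum fun c _ => (contDiffAt_prod fun k _ => ?_).mul (hT c)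
  exact Complex.ofRealCLM.contDiff.contDiffAt.comp x (hB _ _)

/-- The symmetric trace-free part of a smooth tensor field with respect to a smooth metric is
smooth. -/
lemma contDiffAt_stfPart {m : WithTop ℕ∞} {G : (Fin 3 → ℝ) → Matrix (Fin 3) (Fin 3) ℝ} {n : ℕ}
    {T : (Fin 3 → ℝ) → (Fin n → Fin 3) → ℂ} {x : Fin 3 → ℝ}
    (hG : ∀ i j, ContDiffAt ℝ m (fun y => G y i j) x) (hpos : ∀ᶠ y in 𝓝 x, (G y).PosDef)
    (hT : ∀ a, ContDiffAt ℝ m (fun y => T y a) x) (a : Fin n → Fin 3) :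
    ContDiffAt ℝ m (fun y => stfPart (G y) (T y) a) x := by
  have hx := hpos.self_of_nhds
  have hB := contDiffAt_cholesky hG hx
  have hB' := contDiffAt_inv hB (det_cholesky hx)
  have h1 : ∀ a, ContDiffAt ℝ m (fun y => stfLinear n (chg (cholesky (G y))⁻¹ (T y)) a) x := by
    have e := (LinearMap.toContinuousLinearMap
      ((stfLinear (ι := Fin 3) n).restrictScalars ℝ)).contDiff.contDiffAt.comp (n := m) x
      (contDiffAt_pi.2 fun a => contDiffAt_chg hB' hT a)
    exact fun a => contDiffAt_pi.1 e a
  refine (contDiffAt_chg hB h1 a).congr_of_eventuallyEq ?_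
  filter_upwards [hpos] with y hy
  have e := stfPart_frame (isUnit_iff_ne_zero.2 (det_cholesky hy))
    (by rw [cholesky_mul hy]; exact hy) (T y)
  rw [cholesky_mul hy] at e
  rw [e]
  rfl

end Smoothness

/-! ### Symmetric trace-free tensors are determined by their null contractions -/

section NullContractions

lemma update_swap {ι : Type} {n : ℕ} {i j : Fin n} (hij : i ≠ j) (a : Fin n → ι) (k l : ι) :
    Function.update (Function.update a i k) j l ∘ Equiv.swap i j
      = Function.update (Function.update a i l) j k := by
  funext m
  simp only [Function.comp_apply]
  by_cases hi : m = i
  · subst hi; simp [Function.update_of_ne hij]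
  · by_cases hj : m = j
    · subst hj; simp [Function.update_of_ne hij]
    · rw [Equiv.swap_apply_of_ne_of_ne hi hj]
      simp [Function.update_of_ne hi, Function.update_of_ne hj]

/-- A symmetric function of words in `0, 1, 2` that does not change when letters `0, 2` are
replaced by `1, 1` depends on the sum of the letters only. -/
lemma eq_of_sum_eq {n : ℕ} {f : (Fin n → Fin 3) → ℂ}
    (hs : ∀ (σ : Equiv.Perm (Fin n)) c, f (c ∘ σ) = f c)
    (ht : ∀ i j, i ≠ j → ∀ c, f (Function.update (Function.update c i 0) j 2)
      = f (Function.update (Function.update c i 1) j 1))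
    (c d : Fin n → Fin 3) (h : ∑ m, (c m : ℕ) = ∑ m, (d m : ℕ)) : f c = f d := by
  have hswap : ∀ i j, i ≠ j → ∀ c k l, f (Function.update (Function.update c i k) j l)
      = f (Function.update (Function.update c i l) j k) := by
    intro i j hij c k l
    rw [← update_swap hij, hs]
  -- Raising one letter and lowering another keeps the sum. Each possible case is a swap of letters,
  -- the trace relation, or both.
  have move : ∀ i j, i ≠ j → ∀ c : Fin n → Fin 3, (c i : ℕ) < 2 → 0 < (c j : ℕ) →
      f (Function.update (Function.update c i (c i + 1)) j (c j - 1)) = f c := by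
    intro i j hij c hi hj
    have hc : f c = f (Function.update (Function.update c i (c i)) j (c j)) := by
      rw [Function.update_eq_self, Function.update_eq_self]
    rw [hc]
    generalize c i = k at *
    generalize c j = l at *
    fin_cases k <;> fin_cases l <;> simp at hi hj ⊢
    · exact hswap i j hij c 1 0
    · exact (ht i j hij c).symm
    · exact (hswap i j hij c 2 0).trans (ht i j hij c)
    · exact hswap i j hij c 2 1
  -- Subtraction is truncated: `N` is the total amount by which `c` falls short of `d`, and one move
  -- lowers it by `1`. For `N = 0` the equality of the sums forces `c = d`.
  generalize hN : ∑ m, ((d m : ℕ) - (c m : ℕ)) = N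
  induction N generalizing c with
  | zero =>
    have h0 : ∀ m, (d m : ℕ) ≤ (c m : ℕ) := fun m => by
      have := Finset.sum_eq_zero_iff.1 hN m (Finset.mem_univ m)
      omega
    have h1 := (Finset.sum_eq_sum_iff_of_le fun m _ => h0 m).1 h.symm
    congr 1
    funext m
    exact Fin.ext (h1 m (Finset.mem_univ m)).symm
  | succ N ih =>
    obtain ⟨i, hi⟩ : ∃ i, (c i : ℕ) < (d i : ℕ) := by
      by_contra! hcon
      rw [Finset.sum_eq_zero fun m _ => Nat.sub_eq_zero_of_le (hcon m)] at hN
      omega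
    obtain ⟨j, hj⟩ : ∃ j, (d j : ℕ) < (c j : ℕ) := by
      by_contra! hcon
      have := Finset.sum_lt_sum (fun m _ => hcon m) ⟨i, Finset.mem_univ i, hi⟩
      omega
    have hij : i ≠ j := by rintro rfl; omega
    have hi2 : (c i : ℕ) < 2 := by have := (d i).isLt; omega
    have vi : ((c i + 1 : Fin 3) : ℕ) = (c i : ℕ) + 1 := by
      generalize c i = k at *; fin_cases k <;> simp at hi2 ⊢
    have vj : ((c j - 1 : Fin 3) : ℕ) = (c j : ℕ) - 1 := by
      have hj0 : 0 < (c j : ℕ) := by omega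
      generalize c j = k at *; fin_cases k <;> simp at hj0 ⊢
    rw [← move i j hij c hi2 (by omega)]
    have split : ∀ F : Fin n → ℕ, ∑ m, F m
        = F i + (F j + ∑ m ∈ (Finset.univ.erase i).erase j, F m) := fun F => by
      rw [Finset.add_sum_erase (Finset.univ.erase i) F (by simp [hij.symm]),
        Finset.add_sum_erase _ F (Finset.mem_univ i)]
    have rest : ∀ m ∈ (Finset.univ.erase i).erase j,
        Function.update (Function.update c i (c i + 1)) j (c j - 1) m = c m := by
      intro m hm
      simp only [Finset.mem_erase] at hm
      rw [Function.update_of_ne hm.1, Function.update_of_ne hm.2.1]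
    have ei : Function.update (Function.update c i (c i + 1)) j (c j - 1) i = c i + 1 := by
      rw [Function.update_of_ne hij, Function.update_self]
    have ej : Function.update (Function.update c i (c i + 1)) j (c j - 1) j = c j - 1 :=
      Function.update_self _ _ _
    refine ih _ ?_ ?_
    · rw [← h, split, split (fun m => (c m : ℕ)), ei, ej, vi, vj,
        Finset.sum_congr rfl fun m hm => by rw [rest m hm]]
      omega
    · rw [split, ei, ej, vi, vj, Finset.sum_congr rfl fun m hm => by rw [rest m hm]]
      rw [split] at hN
      omega

/-- The components of a tensor in the frame with vectors `U k`. -/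
def frameComp (U : Fin 3 → Fin 3 → ℂ) {n : ℕ} (T : (Fin n → Fin 3) → ℂ) (c : Fin n → Fin 3) : ℂ :=
  ∑ a, (∏ m, U (c m) (a m)) * T a

lemma sum_prod_frame (U : Fin 3 → Fin 3 → ℂ) {n : ℕ} (T : (Fin n → Fin 3) → ℂ)
    (A : Fin n → Fin 3 → ℂ) :
    ∑ a : Fin n → Fin 3, (∏ m, ∑ k, A m k * U k (a m)) * T a
      = ∑ c : Fin n → Fin 3, (∏ m, A m (c m)) * frameComp U T c := by
  have h : ∀ a : Fin n → Fin 3, ∏ m, ∑ k, A m k * U k (a m)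
      = ∑ c : Fin n → Fin 3, ∏ m, (A m (c m) * U (c m) (a m)) := by
    intro a
    have e := Finset.prod_univ_sum (fun _ : Fin n => (Finset.univ : Finset (Fin 3)))
      (fun m k => A m k * U k (a m))
    rwa [Fintype.piFinset_univ] at e
  simp only [h, frameComp, Finset.sum_mul, Finset.mul_sum]
  rw [Finset.sum_comm]
  refine Finset.sum_congr rfl fun c _ => Finset.sum_congr rfl fun a _ => ?_
  rw [Finset.prod_mul_distrib]
  ring

lemma frameComp_symm (U : Fin 3 → Fin 3 → ℂ) {n : ℕ} {T : (Fin n → Fin 3) → ℂ}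
    (hs : ∀ (σ : Equiv.Perm (Fin n)) a, T (a ∘ σ) = T a) (σ : Equiv.Perm (Fin n))
    (c : Fin n → Fin 3) : frameComp U T (c ∘ σ) = frameComp U T c := by
  have e := Equiv.sum_comp (Equiv.arrowCongr σ.symm (Equiv.refl (Fin 3)))
      (fun a : Fin n → Fin 3 => (∏ m, U ((c ∘ σ) m) (a m)) * T a)
  rw [frameComp, ← e, frameComp]
  refine Finset.sum_congr rfl fun a _ => ?_
  have hc : Equiv.arrowCongr σ.symm (Equiv.refl (Fin 3)) a = a ∘ σ := rfl
  rw [hc, hs]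
  congr 1
  exact Equiv.prod_comp σ fun m => U (c m) (a m)

/-- A null frame: `∂ₓ + i∂_y`, `i∂_z`, `∂ₓ - i∂_y`. -/
def nullFrame : Fin 3 → Fin 3 → ℂ :=
  ![![1, Complex.I, 0], ![0, 0, Complex.I], ![1, -Complex.I, 0]]

/-- The factor `i` in the middle frame vector is chosen so that `T(∂ₓ + i∂_y, ∂ₓ - i∂_y) - T(i∂_z,
i∂_z)` is the trace `T_xx + T_yy + T_zz`; the mixed terms cancel by symmetry. -/
lemma frameComp_trace {n : ℕ} {T : (Fin n → Fin 3) → ℂ}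
    (hs : ∀ (σ : Equiv.Perm (Fin n)) a, T (a ∘ σ) = T a)
    (ht : ∀ i j : Fin n, i ≠ j → ∀ a, traceAt (1 : Matrix (Fin 3) (Fin 3) ℝ) i j T a = 0)
    (i j : Fin n) (hij : i ≠ j) (c : Fin n → Fin 3) :
    frameComp nullFrame T (Function.update (Function.update c i 0) j 2)
      = frameComp nullFrame T (Function.update (Function.update c i 1) j 1) := by
  have key : ∀ k l, (Fintype.card (Fin 3) : ℂ) * ((Fintype.card (Fin 3) : ℂ) *
      frameComp nullFrame T (Function.update (Function.update c i k) j l))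
      = ∑ a : Fin n → Fin 3, (∏ m ∈ (Finset.univ.erase i).erase j, nullFrame (c m) (a m)) *
        ∑ p, ∑ q, nullFrame k p * nullFrame l q *
          T (Function.update (Function.update a i p) j q) := by
    intro k l
    rw [frameComp, ← sum_update₂ i j]
    refine Finset.sum_congr rfl fun a _ => ?_
    simp only [Finset.mul_sum]
    refine Finset.sum_congr rfl fun p _ => Finset.sum_congr rfl fun q _ => ?_
    rw [prod_split hij]
    simp only [Function.update_self, Function.update_of_ne hij]
    rw [Finset.prod_congr rfl (g := fun m => nullFrame (c m) (a m))]
    · ring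
    · intro m hm
      simp only [Finset.mem_erase] at hm
      simp only [Function.update_of_ne hm.1, Function.update_of_ne hm.2.1]
  have h3 : (Fintype.card (Fin 3) : ℂ) ≠ 0 := by simp
  refine mul_left_cancel₀ h3 (mul_left_cancel₀ h3 ?_)
  rw [key, key]
  refine Finset.sum_congr rfl fun a _ => ?_
  congr 1
  have h0 := ht i j hij a
  have hsw : T (Function.update (Function.update a i 1) j 0)
      = T (Function.update (Function.update a i 0) j 1) := by
    rw [← update_swap hij, hs]
  simp only [traceAt, inv_one, Fin.sum_univ_three] at h0
  simp at h0
  simp only [Fin.sum_univ_three]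
  simp [nullFrame]
  rw [hsw]
  linear_combination h0

/-- The null directions trace out a conic, parametrized quadratically by `w = e^{iθ}`. The
contraction of an `n`-tensor with them is thus, up to a power of `w`, a polynomial in `w`. -/
lemma nullDir_eq_nullFrame (θ : ℝ) (k : Fin 3) :
    Complex.exp (θ * Complex.I) * nullDir θ k = -(Complex.I / 2) *
      ∑ l, ![1, 2 * Complex.exp (θ * Complex.I), Complex.exp (θ * Complex.I) ^ 2] l
        * nullFrame l k := by
  have hc : (Real.cos θ : ℂ) = (Complex.exp (θ * Complex.I) + Complex.exp (-θ * Complex.I)) / 2 := by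
    rw [Complex.ofReal_cos, Complex.cos]
  have hsn : (Real.sin θ : ℂ)
      = (Complex.exp (-θ * Complex.I) - Complex.exp (θ * Complex.I)) * Complex.I / 2 := by
    rw [Complex.ofReal_sin, Complex.sin]
  have hm : Complex.exp (θ * Complex.I) * Complex.exp (-θ * Complex.I) = 1 := by
    rw [← Complex.exp_add]; simp
  set w := Complex.exp (θ * Complex.I)
  set w' := Complex.exp (-θ * Complex.I)
  have hI := Complex.I_sq
  fin_cases k
  · simp only [nullDir, nullFrame, Fin.sum_univ_three, hc]
    simp
    linear_combination (Complex.I / 2) * hm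
  · simp only [nullDir, nullFrame, Fin.sum_univ_three, hsn]
    simp
    linear_combination (Complex.I ^ 2 / 2) * hm
  · simp only [nullDir, nullFrame, Fin.sum_univ_three]
    simp
    linear_combination w * hI

/-- A symmetric trace-free tensor whose contractions with all the null vectors `nullDir θ` vanish
is zero. -/
theorem eq_zero_of_contract_nullDir {n : ℕ} {T : (Fin n → Fin 3) → ℂ}
    (hs : ∀ (σ : Equiv.Perm (Fin n)) a, T (a ∘ σ) = T a)
    (ht : ∀ i j : Fin n, i ≠ j → ∀ a, traceAt (1 : Matrix (Fin 3) (Fin 3) ℝ) i j T a = 0)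
    (hc : ∀ θ : ℝ, contract (nullDir θ) T = 0) : T = 0 := by
  set Q := frameComp nullFrame T with hQ
  have hsum : ∀ c d : Fin n → Fin 3, ∑ m, (c m : ℕ) = ∑ m, (d m : ℕ) → Q c = Q d :=
    eq_of_sum_eq (frameComp_symm nullFrame hs) (frameComp_trace hs ht)
  -- Expand `T(v, …, v)` in the null frame: each word contributes its component times the power of
  -- `w = e^{iθ}` given by the sum of its letters.
  have hpoly : ∀ θ : ℝ, ∑ c : Fin n → Fin 3,
      (∏ m, (![1, 2, 1] : Fin 3 → ℂ) (c m)) * Q c * Complex.exp (θ * Complex.I) ^ (∑ m, (c m : ℕ))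
      = 0 := by
    intro θ
    have h1 := sum_prod_frame nullFrame T (fun _ =>
      ![1, 2 * Complex.exp (θ * Complex.I), Complex.exp (θ * Complex.I) ^ 2])
    have h2 : ∀ a : Fin n → Fin 3, ∏ m, ∑ k,
        (![1, 2 * Complex.exp (θ * Complex.I), Complex.exp (θ * Complex.I) ^ 2] : Fin 3 → ℂ) k
          * nullFrame k (a m)
        = (2 * Complex.I * Complex.exp (θ * Complex.I)) ^ n * ∏ m, nullDir θ (a m) := by
      intro a
      rw [← Fin.prod_const n (2 * Complex.I * Complex.exp (θ * Complex.I)), ← Finset.prod_mul_distrib]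
      refine Finset.prod_congr rfl fun m _ => ?_
      have := nullDir_eq_nullFrame θ (a m)
      rw [mul_assoc, this]
      linear_combination (∑ l, (![1, 2 * Complex.exp (θ * Complex.I),
        Complex.exp (θ * Complex.I) ^ 2] : Fin 3 → ℂ) l * nullFrame l (a m)) * Complex.I_sq
    simp only [h2] at h1
    have h3 : ∑ a : Fin n → Fin 3, (2 * Complex.I * Complex.exp (θ * Complex.I)) ^ n
        * (∏ m, nullDir θ (a m)) * T a = 0 := by
      have := hc θ
      simp only [mul_assoc, ← Finset.mul_sum]
      rw [contract] at this
      rw [this]; simp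
    rw [h3] at h1
    rw [h1]
    refine Finset.sum_congr rfl fun c _ => ?_
    rw [mul_right_comm, ← Finset.prod_pow_eq_pow_sum, ← Finset.prod_mul_distrib]
    congr 1
    refine Finset.prod_congr rfl fun m _ => ?_
    generalize c m = k
    fin_cases k <;> simp
  set P : Polynomial ℂ := ∑ c : Fin n → Fin 3,
    Polynomial.monomial (∑ m, (c m : ℕ)) ((∏ m, (![1, 2, 1] : Fin 3 → ℂ) (c m)) * Q c) with hP
  have hP0 : P = 0 := by
    refine Polynomial.eq_zero_of_infinite_isRoot P ?_
    -- The imaginary part of `e^{iθ}` is `sin θ`, which is injective on `(0, 1)`; this already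
    -- supplies infinitely many roots.
    have hinf : (Set.range fun θ : Set.Ioo (0 : ℝ) 1 => Complex.exp (θ * Complex.I)).Infinite := by
      have : Infinite (Set.Ioo (0 : ℝ) 1) := (Set.Ioo_infinite one_pos).to_subtype
      refine Set.infinite_range_of_injective fun θ θ' h => ?_
      have h2 := congrArg Complex.im h
      simp only [Complex.exp_ofReal_mul_I_im] at h2
      have pi3 := Real.pi_gt_three
      have := Real.injOn_sin ⟨by linarith [θ.2.1], by linarith [θ.2.2]⟩
        ⟨by linarith [θ'.2.1], by linarith [θ'.2.2]⟩ h2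
      exact Subtype.ext this
    refine hinf.mono ?_
    rintro _ ⟨θ, rfl⟩
    simp only [Set.mem_ofPred_eq, Polynomial.IsRoot.def, hP, Polynomial.eval_finsetSum,
      Polynomial.eval_monomial]
    exact hpoly θ
  have hQ0 : ∀ c, Q c = 0 := by
    intro c
    have h1 := congrArg (fun p : Polynomial ℂ => p.coeff (∑ m, (c m : ℕ))) hP0
    simp only [hP, Polynomial.finsetSum_coeff, Polynomial.coeff_monomial,
      Polynomial.coeff_zero] at h1
    -- All words with the same sum share one value of `Q`. The coefficient is this value times a sum
    -- of products of the weights `1, 2, 1`, which is positive, so nothing can cancel.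
    have h2 : ∑ d : Fin n → Fin 3, (if ∑ m, (d m : ℕ) = ∑ m, (c m : ℕ) then
        (∏ m, (![1, 2, 1] : Fin 3 → ℂ) (d m)) * Q d else 0)
        = ((∑ d : Fin n → Fin 3, (if ∑ m, (d m : ℕ) = ∑ m, (c m : ℕ) then
        (∏ m, (![1, 2, 1] : Fin 3 → ℝ) (d m)) else 0) : ℝ) : ℂ) * Q c := by
      push_cast
      rw [Finset.sum_mul]
      refine Finset.sum_congr rfl fun d _ => ?_
      split_ifs with hd
      · rw [hsum d c hd]
        push_cast
        congr 1
        refine Finset.prod_congr rfl fun m _ => ?_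
        generalize d m = k
        fin_cases k <;> simp
      · simp
    rw [h2] at h1
    have hpos : 0 < ∑ d : Fin n → Fin 3, (if ∑ m, (d m : ℕ) = ∑ m, (c m : ℕ) then
        (∏ m, (![1, 2, 1] : Fin 3 → ℝ) (d m)) else 0) := by
      have hp : ∀ d : Fin n → Fin 3, 0 < ∏ m, (![1, 2, 1] : Fin 3 → ℝ) (d m) := fun d =>
        Finset.prod_pos fun m _ => by
          generalize d m = k
          fin_cases k <;> simp
      refine Finset.sum_pos' (fun d _ => ?_) ⟨c, Finset.mem_univ c, ?_⟩
      · split_ifs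
        · exact (hp d).le
        · exact le_rfl
      · simpa using hp c
    rcases mul_eq_zero.1 h1 with h | h
    · exact absurd (by exact_mod_cast h) hpos.ne'
    · exact h
  funext a
  -- The rows are the coefficients of the Cartesian basis vectors in the null frame.
  have h1 := sum_prod_frame nullFrame T (fun m =>
    (![![1 / 2, 0, 1 / 2], ![-Complex.I / 2, 0, Complex.I / 2], ![0, -Complex.I, 0]] :
      Fin 3 → Fin 3 → ℂ) (a m))
  have h2 : ∀ k l : Fin 3, ∑ p, (![![1 / 2, 0, 1 / 2], ![-Complex.I / 2, 0, Complex.I / 2],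
      ![0, -Complex.I, 0]] : Fin 3 → Fin 3 → ℂ) k p * nullFrame p l = if l = k then 1 else 0 := by
    intro k l
    have hI : Complex.I * Complex.I = -1 := Complex.I_mul_I
    fin_cases k <;> fin_cases l <;> simp [nullFrame, Fin.sum_univ_three] <;>
      first | linear_combination (-1 : ℂ) * hI | ring
  simp only [h2, ← hQ, hQ0, mul_zero, Finset.sum_const_zero] at h1
  rw [Finset.sum_eq_single a] at h1
  · simpa using h1
  · intro b _ hb
    obtain ⟨m, hm⟩ := Function.ne_iff.1 hb
    rw [Finset.prod_eq_zero (Finset.mem_univ m), zero_mul]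
    simp [hm]
  · simp

end NullContractions

/-! ### Geometry of the meridian half-planes -/

section Axial

/-- The lowered null vector determines how the Christoffel symbols act on it. -/
lemma christoffel_contract {ι : Type} [Fintype ι] [DecidableEq ι] {G : (ι → ℝ) → Matrix ι ι ℝ}
    {x : ι → ℝ} (hG : ∀ i j, DifferentiableAt ℝ (fun y => G y i j) x)
    (hs : ∀ᶠ y in 𝓝 x, ∀ i j, G y i j = G y j i) (v : ι → ℂ) (k : ι) :
    ∑ i, ∑ l, (christoffel G x k i l : ℂ) * v i * v l
      = ∑ m, (((G x)⁻¹ k m : ℝ) : ℂ) * (cderiv v (fun y => ∑ j, (G y m j : ℂ) * v j) x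
        - 1 / 2 * pd m (fun y => ∑ i, ∑ l, (G y i l : ℂ) * v i * v l) x) := by
  have hGc : ∀ i j, DifferentiableAt ℝ (fun y => (G y i j : ℂ)) x := fun i j =>
    Complex.ofRealCLM.differentiableAt.comp x (hG i j)
  have h1 : ∀ m, cderiv v (fun y => ∑ j, (G y m j : ℂ) * v j) x
      = ∑ i, ∑ l, ((pd i (fun y => G y m l) x : ℝ) : ℂ) * v i * v l := by
    intro m
    rw [cderiv]
    refine Finset.sum_congr rfl fun i _ => ?_
    rw [pd_sum _ fun j _ => (hGc m j).mul_const _, Finset.mul_sum]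
    refine Finset.sum_congr rfl fun l _ => ?_
    rw [pd_mul (hGc m l) (differentiableAt_const _), pd_const, pd_ofReal (hG m l)]
    ring
  have h2 : ∀ m, pd m (fun y => ∑ i, ∑ l, (G y i l : ℂ) * v i * v l) x
      = ∑ i, ∑ l, ((pd m (fun y => G y i l) x : ℝ) : ℂ) * v i * v l := by
    intro m
    rw [pd_sum _ fun i _ => DifferentiableAt.fun_sum fun l _ =>
      ((hGc i l).mul_const _).mul_const _]
    refine Finset.sum_congr rfl fun i _ => ?_
    rw [pd_sum _ fun l _ => ((hGc i l).mul_const _).mul_const _]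
    refine Finset.sum_congr rfl fun l _ => ?_
    rw [pd_mul ((hGc i l).mul_const _) (differentiableAt_const _), pd_const,
      pd_mul (hGc i l) (differentiableAt_const _), pd_const, pd_ofReal (hG i l)]
    ring
  have h3 : ∀ m, ∑ i, ∑ l, ((pd l (fun y => G y i m) x : ℝ) : ℂ) * v i * v l
      = ∑ i, ∑ l, ((pd i (fun y => G y m l) x : ℝ) : ℂ) * v i * v l := by
    intro m
    rw [Finset.sum_comm]
    refine Finset.sum_congr rfl fun i _ => Finset.sum_congr rfl fun l _ => ?_
    rw [pd_congr (hs.mono fun y hy => hy l m)]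
    ring
  have h4 : ∀ i l, (christoffel G x k i l : ℂ) * v i * v l
      = ∑ m, (((G x)⁻¹ k m : ℝ) : ℂ) * (1 / 2 *
        (((pd i (fun y => G y m l) x : ℝ) : ℂ) * v i * v l
          + ((pd l (fun y => G y i m) x : ℝ) : ℂ) * v i * v l
          - ((pd m (fun y => G y i l) x : ℝ) : ℂ) * v i * v l)) := by
    intro i l
    rw [christoffel]
    push_cast
    rw [Finset.mul_sum, Finset.sum_mul, Finset.sum_mul]
    exact Finset.sum_congr rfl fun m _ => by ring
  simp only [h4]
  rw [Finset.sum_congr rfl fun i _ => Finset.sum_comm, Finset.sum_comm]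
  refine Finset.sum_congr rfl fun m _ => ?_
  rw [h1, h2]
  simp only [← Finset.mul_sum, Finset.sum_add_distrib, Finset.sum_sub_distrib]
  rw [h3]
  ring

lemma axialMetric_halfPlane (β κ : (Fin 3 → ℝ) → ℝ) {θ ρ z : ℝ} (hρ : 0 < ρ) (i j : Fin 3) :
    axialMetric β κ ![ρ * Real.cos θ, ρ * Real.sin θ, z] i j
      = Real.exp (2 * κ ![ρ * Real.cos θ, ρ * Real.sin θ, z]) *
        (Real.exp (-2 * β ![ρ * Real.cos θ, ρ * Real.sin θ, z])
          * ![-Real.sin θ, Real.cos θ, 0] i * ![-Real.sin θ, Real.cos θ, 0] j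
          + ![Real.cos θ, Real.sin θ, 0] i * ![Real.cos θ, Real.sin θ, 0] j
          + ![0, 0, 1] i * ![0, 0, 1] j) := by
  have hr : √((ρ * Real.cos θ) ^ 2 + (ρ * Real.sin θ) ^ 2) = ρ := by
    have : (ρ * Real.cos θ) ^ 2 + (ρ * Real.sin θ) ^ 2 = ρ ^ 2 := by
      rw [mul_pow, mul_pow, ← mul_add, Real.cos_sq_add_sin_sq, mul_one]
    rw [this, Real.sqrt_sq hρ.le]
  simp only [axialMetric, Matrix.of_apply]
  simp only [Matrix.cons_val_zero, Matrix.cons_val_one, hr]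
  congr 1
  fin_cases i <;> fin_cases j <;> simp <;> field_simp

/-- Away from the half-plane `v` need not be null, but `h̃(v, v)` is divisible by the square of a
linear function that vanishes on it. A double zero is what the geodesic property needs. -/
lemma axialMetric_null (β κ : (Fin 3 → ℝ) → ℝ) (θ : ℝ) {y : Fin 3 → ℝ} (hy : y 0 ≠ 0 ∨ y 1 ≠ 0) :
    ∑ i, ∑ l, (axialMetric β κ y i l : ℂ) * nullDir θ i * nullDir θ l
      = ((Real.exp (2 * κ y) * (1 - Real.exp (-2 * β y)) / (y 0 ^ 2 + y 1 ^ 2) : ℝ) : ℂ)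
        * (((y 1 * Real.cos θ - y 0 * Real.sin θ : ℝ) : ℂ)
          * ((y 1 * Real.cos θ - y 0 * Real.sin θ : ℝ) : ℂ)) := by
  have hpos : 0 < y 0 ^ 2 + y 1 ^ 2 := by rcases hy with h | h <;> positivity
  have hne : √(y 0 ^ 2 + y 1 ^ 2) ≠ 0 := (Real.sqrt_pos.2 hpos).ne'
  have hsq : √(y 0 ^ 2 + y 1 ^ 2) ^ 2 = y 0 ^ 2 + y 1 ^ 2 := Real.sq_sqrt hpos.le
  have hI := Complex.I_sq
  have hcs : (Real.cos θ : ℂ) ^ 2 + (Real.sin θ : ℂ) ^ 2 = 1 := by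
    exact_mod_cast Real.cos_sq_add_sin_sq θ
  have hneC : ((√(y 0 ^ 2 + y 1 ^ 2) : ℝ) : ℂ) ≠ 0 := by exact_mod_cast hne
  have hsqC : ((√(y 0 ^ 2 + y 1 ^ 2) : ℝ) : ℂ) ^ 2 = (y 0 : ℂ) ^ 2 + (y 1 : ℂ) ^ 2 := by
    exact_mod_cast hsq
  set r := √(y 0 ^ 2 + y 1 ^ 2) with hr
  have hd : ((y 0 : ℂ) ^ 2 + (y 1 : ℂ) ^ 2) = (r : ℂ) ^ 2 := hsqC.symm
  set E : ℂ := ((Real.exp (2 * κ y) : ℝ) : ℂ) with hE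
  set B : ℂ := ((Real.exp (-2 * β y) : ℝ) : ℂ) with hB
  set c : ℂ := (Real.cos θ : ℂ) with hc
  set s : ℂ := (Real.sin θ : ℂ) with hs
  have hcomp : ∀ i l, (axialMetric β κ y i l : ℂ)
      = E * ((r : ℂ) ^ 2 * B * (![-(y 1 : ℂ) / r ^ 2, y 0 / r ^ 2, 0] : Fin 3 → ℂ) i
          * (![-(y 1 : ℂ) / r ^ 2, y 0 / r ^ 2, 0] : Fin 3 → ℂ) l
        + (![(y 0 : ℂ) / r, y 1 / r, 0] : Fin 3 → ℂ) i * (![(y 0 : ℂ) / r, y 1 / r, 0] : Fin 3 → ℂ) l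
        + (![0, 0, 1] : Fin 3 → ℂ) i * (![0, 0, 1] : Fin 3 → ℂ) l) := by
    intro i l
    simp only [axialMetric, Matrix.of_apply]
    rw [← hr]
    fin_cases i <;> fin_cases l <;> simp [hE, hB]
  have hfac : ∑ i, ∑ l, (axialMetric β κ y i l : ℂ) * nullDir θ i * nullDir θ l
      = E * ((r : ℂ) ^ 2 * B * (-Complex.I * (-(y 1 : ℂ) * c + y 0 * s) / r ^ 2) ^ 2
        + (-Complex.I * ((y 0 : ℂ) * c + y 1 * s) / r) ^ 2 + 1) := by
    simp only [hcomp, nullDir, Fin.sum_univ_three]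
    simp [← hc, ← hs]
    field_simp
    ring
  rw [hfac]
  simp only [Complex.ofReal_mul, Complex.ofReal_sub, Complex.ofReal_div, Complex.ofReal_add,
    Complex.ofReal_pow, Complex.ofReal_one]
  rw [hd, ← hE, ← hB, ← hc, ← hs]
  have h1 : (y 0 : ℂ) ^ 2 = (r : ℂ) ^ 2 - (y 1 : ℂ) ^ 2 := by rw [← hd]; ring
  have h2 : c ^ 2 = 1 - s ^ 2 := by rw [← hcs]; ring
  field_simp
  rw [hI]
  linear_combination (-(E * (c ^ 2 + s ^ 2))) * h1 - (E * (r : ℂ) ^ 2) * hcs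

/-! ### The rescaled metric on the meridian half-planes. -/

variable {M : Spacetime} (C : Completion M)

/-- The points at which the geometry of the completion is that of the axial metric and smooth. -/
structure Completion.Regular (x : Fin 3 → ℝ) : Prop where
  mem : x ∈ M.U
  kappa : ∀ᶠ y in 𝓝 x, DifferentiableAt ℝ C.κ y
  beta : ∀ᶠ y in 𝓝 x, DifferentiableAt ℝ C.β y

variable {C}

lemma Completion.eventually_regular (hβ : AnalyticAt ℝ C.β 0) (hκ : AnalyticAt ℝ C.κ 0) :
    ∀ᶠ x in 𝓝 0, C.Regular x := by
  filter_upwards [M.isOpen_U.mem_nhds M.zero_mem,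
    (hκ.eventually_analyticAt.mono fun y hy => hy.differentiableAt).eventually_nhds,
    (hβ.eventually_analyticAt.mono fun y hy => hy.differentiableAt).eventually_nhds]
    with x h1 h2 h3 using ⟨h1, h2, h3⟩

lemma halfPlane_off_axis {θ : ℝ} {x : Fin 3 → ℝ} (hx : x ∈ halfPlane θ) : x 0 ≠ 0 ∨ x 1 ≠ 0 := by
  obtain ⟨ρ, hρ, z, rfl⟩ := hx
  by_contra! h
  obtain ⟨h0, h1⟩ := h
  simp [hρ.ne'] at h0 h1
  have := Real.cos_sq_add_sin_sq θ
  rw [h0, h1] at this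
  simp at this

lemma eventually_off_axis {x : Fin 3 → ℝ} (hx : x 0 ≠ 0 ∨ x 1 ≠ 0) :
    ∀ᶠ y : Fin 3 → ℝ in 𝓝 x, y 0 ≠ 0 ∨ y 1 ≠ 0 := by
  rcases hx with h | h
  · exact ((continuous_apply 0).continuousAt.eventually_ne h).mono fun y hy => Or.inl hy
  · exact ((continuous_apply 1).continuousAt.eventually_ne h).mono fun y hy => Or.inr hy

lemma Completion.eventually_axial {x : Fin 3 → ℝ} (hx : x ∈ M.U) (ho : x 0 ≠ 0 ∨ x 1 ≠ 0) :
    C.hTilde =ᶠ[𝓝 x] axialMetric C.β C.κ := by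
  filter_upwards [M.isOpen_U.mem_nhds hx, eventually_off_axis ho] with y h1 h2
  exact C.metric_form y h1 h2

lemma Completion.contDiffAt_hTilde {x : Fin 3 → ℝ} (hx : x ∈ M.U) (i j : Fin 3) :
    ContDiffAt ℝ (⊤ : ℕ∞) (fun y => C.hTilde y i j) x :=
  (C.smooth_metric i j).contDiffAt (M.isOpen_U.mem_nhds hx)

lemma Completion.hTilde_symm {x : Fin 3 → ℝ} (hx : x ∈ M.U) (i j : Fin 3) :
    C.hTilde x i j = C.hTilde x j i := by
  simpa using (C.posDef x hx).isHermitian.apply j i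

lemma Completion.eventually_posDef {x : Fin 3 → ℝ} (hx : x ∈ M.U) :
    ∀ᶠ y in 𝓝 x, (C.hTilde y).PosDef := by
  filter_upwards [M.isOpen_U.mem_nhds hx] with y hy using C.posDef y hy

/-- `nullDir θ` is null along the half-plane with azimuth `θ`. -/
lemma Completion.null_halfPlane {θ : ℝ} {x : Fin 3 → ℝ} (hx : x ∈ M.U) (hp : x ∈ halfPlane θ) :
    ∑ k, ∑ l, (C.hTilde x k l : ℂ) * nullDir θ k * nullDir θ l = 0 := by
  rw [C.metric_form x hx (halfPlane_off_axis hp),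
    axialMetric_null _ _ _ (halfPlane_off_axis hp)]
  obtain ⟨ρ, hρ, z, rfl⟩ := hp
  have : ρ * Real.sin θ * Real.cos θ - ρ * Real.cos θ * Real.sin θ = 0 := by ring
  simp only [Matrix.cons_val_zero, Matrix.cons_val_one]
  rw [this]
  simp

/-- `v` lies in the ρz-plane, which is orthogonal to `∂_φ` and carries `e^{2κ}` times the Euclidean
metric. -/
lemma Completion.lower_halfPlane {θ : ℝ} {x : Fin 3 → ℝ} (hx : x ∈ M.U) (hp : x ∈ halfPlane θ)
    (m : Fin 3) :
    ∑ j, (C.hTilde x m j : ℂ) * nullDir θ j = (Real.exp (2 * C.κ x) : ℂ) * nullDir θ m := by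
  rw [C.metric_form x hx (halfPlane_off_axis hp)]
  obtain ⟨ρ, hρ, z, rfl⟩ := hp
  simp only [axialMetric_halfPlane C.β C.κ hρ, nullDir, Fin.sum_univ_three]
  have hcs : (Complex.cos θ) ^ 2 + (Complex.sin θ) ^ 2 = 1 := Complex.cos_sq_add_sin_sq θ
  fin_cases m <;> simp
  · linear_combination (-(Complex.exp (2 * ↑(C.κ ![ρ * Real.cos θ, ρ * Real.sin θ, z])))
      * Complex.I * Complex.cos θ) * hcs
  · linear_combination (-(Complex.exp (2 * ↑(C.κ ![ρ * Real.cos θ, ρ * Real.sin θ, z])))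
      * Complex.I * Complex.sin θ) * hcs

/-- Up to reparametrization, `nullDir θ` is geodesic along the half-plane with azimuth `θ`. -/
lemma Completion.geodesic_halfPlane {θ : ℝ} {x : Fin 3 → ℝ} (hr : C.Regular x)
    (hp : x ∈ halfPlane θ) (k : Fin 3) :
    ∑ i, ∑ l, (christoffel C.hTilde x k i l : ℂ) * nullDir θ i * nullDir θ l
      = 2 * cderiv (nullDir θ) (fun y => (C.κ y : ℂ)) x * nullDir θ k := by
  have hx := hr.mem
  have hU := M.isOpen_U.mem_nhds hx
  have hκ : DifferentiableAt ℝ C.κ x := hr.kappa.self_of_nhds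
  have hβ : DifferentiableAt ℝ C.β x := hr.beta.self_of_nhds
  have hdG : ∀ i j, DifferentiableAt ℝ (fun y => C.hTilde y i j) x := fun i j =>
    (C.contDiffAt_hTilde hx i j).differentiableAt (by simp)
  rw [christoffel_contract hdG (by filter_upwards [hU] with y hy using C.hTilde_symm hy)]
  -- The derivative across the half-plane is included, so nullness on the half-plane alone would not
  -- do; the double zero in `axialMetric_null` does.
  have h1 : ∀ m, pd m (fun y => ∑ i, ∑ l, (C.hTilde y i l : ℂ) * nullDir θ i * nullDir θ l) x
      = 0 := by
    intro m
    have e : (fun y => ∑ i, ∑ l, (C.hTilde y i l : ℂ) * nullDir θ i * nullDir θ l) =ᶠ[𝓝 x]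
        fun y => ((Real.exp (2 * C.κ y) * (1 - Real.exp (-2 * C.β y))
            / (y 0 ^ 2 + y 1 ^ 2) : ℝ) : ℂ)
          * (((y 1 * Real.cos θ - y 0 * Real.sin θ : ℝ) : ℂ)
            * ((y 1 * Real.cos θ - y 0 * Real.sin θ : ℝ) : ℂ)) := by
      filter_upwards [C.eventually_axial hx (halfPlane_off_axis hp),
        eventually_off_axis (halfPlane_off_axis hp)] with y hy h2
      rw [hy, axialMetric_null _ _ _ h2]
    have hpos : x 0 ^ 2 + x 1 ^ 2 ≠ 0 := by
      rcases halfPlane_off_axis hp with h | h <;> positivity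
    have hq0 : x 1 * Real.cos θ - x 0 * Real.sin θ = 0 := by
      obtain ⟨ρ, hρ, z, rfl⟩ := hp
      simp only [Matrix.cons_val_zero, Matrix.cons_val_one]
      ring
    have d0 : DifferentiableAt ℝ (fun y : Fin 3 → ℝ => y 0) x := differentiableAt_apply 0 x
    have d1 : DifferentiableAt ℝ (fun y : Fin 3 → ℝ => y 1) x := differentiableAt_apply 1 x
    have dq : DifferentiableAt ℝ (fun y : Fin 3 → ℝ =>
        ((y 1 * Real.cos θ - y 0 * Real.sin θ : ℝ) : ℂ)) x :=
      Complex.ofRealCLM.differentiableAt.comp x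
        ((d1.mul_const _).fun_sub (d0.mul_const _))
    have dΦ : DifferentiableAt ℝ (fun y : Fin 3 → ℝ => ((Real.exp (2 * C.κ y) *
        (1 - Real.exp (-2 * C.β y)) / (y 0 ^ 2 + y 1 ^ 2) : ℝ) : ℂ)) x := by
      have dn : DifferentiableAt ℝ (fun y : Fin 3 → ℝ => Real.exp (2 * C.κ y) *
          (1 - Real.exp (-2 * C.β y))) x :=
        (hκ.const_mul 2).exp.fun_mul ((differentiableAt_const _).fun_sub (hβ.const_mul (-2)).exp)
      have dd : DifferentiableAt ℝ (fun y : Fin 3 → ℝ => y 0 ^ 2 + y 1 ^ 2) x :=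
        (d0.fun_pow 2).fun_add (d1.fun_pow 2)
      have dR : DifferentiableAt ℝ (fun y : Fin 3 → ℝ => Real.exp (2 * C.κ y) *
          (1 - Real.exp (-2 * C.β y)) / (y 0 ^ 2 + y 1 ^ 2)) x := by
        simp only [div_eq_mul_inv]
        exact dn.fun_mul (dd.fun_inv hpos)
      exact Complex.ofRealCLM.differentiableAt.comp x dR
    rw [pd_congr e, pd_mul dΦ (dq.fun_mul dq), pd_mul dq dq, hq0]
    simp
  have hκc : DifferentiableAt ℝ (fun y => (C.κ y : ℂ)) x :=
    Complex.ofRealCLM.differentiableAt.comp x hκ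
  have hexp : DifferentiableAt ℝ (fun y => (Real.exp (2 * C.κ y) : ℂ)) x :=
    Complex.ofRealCLM.differentiableAt.comp x (hκ.const_mul 2).exp
  have hdexp : cderiv (nullDir θ) (fun y => (Real.exp (2 * C.κ y) : ℂ)) x
      = 2 * cderiv (nullDir θ) (fun y => (C.κ y : ℂ)) x * Real.exp (2 * C.κ x) := by
    have hp : ∀ i, pd i (fun y => Real.exp (2 * C.κ y)) x
        = Real.exp (2 * C.κ x) * (2 * pd i C.κ x) := by
      intro i
      have := ((hκ.hasFDerivAt.const_mul 2).exp).fderiv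
      simp only [pd]
      rw [this]
      simp
    simp only [cderiv, pd_ofReal (hκ.const_mul 2).exp, pd_ofReal hκ, hp, Finset.mul_sum,
      Finset.sum_mul]
    refine Finset.sum_congr rfl fun i _ => ?_
    push_cast
    ring
  -- The lowered vector is `e^{2κ} v` only on the half-plane, but `v` differentiates inside it, and
  -- the logarithmic derivative of `e^{2κ}` is `2 v(κ)`.
  have h2 : ∀ m, cderiv (nullDir θ) (fun y => ∑ j, (C.hTilde y m j : ℂ) * nullDir θ j) x
      = 2 * cderiv (nullDir θ) (fun y => (C.κ y : ℂ)) x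
        * ∑ j, (C.hTilde x m j : ℂ) * nullDir θ j := by
    intro m
    have dl : DifferentiableAt ℝ (fun y => ∑ j, (C.hTilde y m j : ℂ) * nullDir θ j) x :=
      DifferentiableAt.fun_sum fun j _ =>
        (Complex.ofRealCLM.differentiableAt.comp x (hdG m j)).mul_const _
    have dr : DifferentiableAt ℝ (fun y => (Real.exp (2 * C.κ y) : ℂ) * nullDir θ m) x :=
      hexp.mul_const _
    have h0 := cderiv_eq_zero_of_halfPlane hp (dl.fun_sub dr) 0 (by
      filter_upwards [hU] with y hy hpy
      rw [C.lower_halfPlane hy hpy, sub_self])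
    rw [cderiv_sub dl dr, sub_eq_zero] at h0
    rw [h0, cderiv_mul hexp (differentiableAt_const _), cderiv_const, hdexp,
      C.lower_halfPlane hx hp]
    ring
  simp only [h1, h2]
  have hinv : (C.hTilde x)⁻¹ * C.hTilde x = 1 :=
    Matrix.nonsing_inv_mul _ (isUnit_iff_ne_zero.2 (C.posDef x hx).det_pos.ne')
  have h3 : ∑ m, (((C.hTilde x)⁻¹ k m : ℝ) : ℂ) * ∑ j, (C.hTilde x m j : ℂ) * nullDir θ j
      = nullDir θ k := by
    have e : ∀ j, ∑ m, (((C.hTilde x)⁻¹ k m : ℝ) : ℂ) * (C.hTilde x m j : ℂ)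
        = (((1 : Matrix (Fin 3) (Fin 3) ℝ) k j : ℝ) : ℂ) := by
      intro j
      rw [← hinv, Matrix.mul_apply]
      push_cast
      rfl
    simp only [Finset.mul_sum]
    rw [Finset.sum_comm]
    simp only [← mul_assoc, ← Finset.sum_mul, e]
    rw [Finset.sum_eq_single k (fun j _ hj => by simp [hj.symm]) (by simp)]
    simp
  rw [← h3, Finset.mul_sum]
  refine Finset.sum_congr rfl fun m _ => ?_
  ring

/-- At `Λ` the rescaled metric is the Euclidean one. -/
lemma Completion.hTilde_zero (hβ : AnalyticAt ℝ C.β 0) (hκ : AnalyticAt ℝ C.κ 0) :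
    C.hTilde 0 = 1 := by
  have key : ∀ θ : ℝ, ∀ i j, C.hTilde 0 i j = Real.exp (-2 * C.β 0)
          * ![-Real.sin θ, Real.cos θ, 0] i * ![-Real.sin θ, Real.cos θ, 0] j
          + ![Real.cos θ, Real.sin θ, 0] i * ![Real.cos θ, Real.sin θ, 0] j
          + ![0, 0, 1] i * ![0, 0, 1] j := by
    intro θ i j
    have h1 : Filter.Tendsto (fun x => C.hTilde x i j) (𝓝[halfPlane θ] 0) (𝓝 (C.hTilde 0 i j)) :=
      (C.contDiffAt_hTilde M.zero_mem i j).continuousAt.tendsto.mono_left nhdsWithin_le_nhds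
    have h2 : Filter.Tendsto (fun x => Real.exp (2 * C.κ x) * (Real.exp (-2 * C.β x)
          * ![-Real.sin θ, Real.cos θ, 0] i * ![-Real.sin θ, Real.cos θ, 0] j
          + ![Real.cos θ, Real.sin θ, 0] i * ![Real.cos θ, Real.sin θ, 0] j
          + ![0, 0, 1] i * ![0, 0, 1] j)) (𝓝[halfPlane θ] 0)
        (𝓝 (Real.exp (2 * C.κ 0) * (Real.exp (-2 * C.β 0)
          * ![-Real.sin θ, Real.cos θ, 0] i * ![-Real.sin θ, Real.cos θ, 0] j
          + ![Real.cos θ, Real.sin θ, 0] i * ![Real.cos θ, Real.sin θ, 0] j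
          + ![0, 0, 1] i * ![0, 0, 1] j))) := by
      refine Filter.Tendsto.mono_left (ContinuousAt.tendsto ?_) nhdsWithin_le_nhds
      have cκ := hκ.continuousAt
      have cβ := hβ.continuousAt
      fun_prop
    rw [C.kappa_zero, mul_zero, Real.exp_zero, one_mul] at h2
    refine tendsto_nhds_unique (h1.congr' ?_) h2
    rw [Filter.EventuallyEq, eventually_nhdsWithin_iff]
    filter_upwards [M.isOpen_U.mem_nhds M.zero_mem] with x hx hp
    rw [C.metric_form x hx (halfPlane_off_axis hp)]
    obtain ⟨ρ, hρ, z, rfl⟩ := hp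
    rw [axialMetric_halfPlane _ _ hρ]
  -- The `xx`-component at `Λ` is `1` when approached along azimuth 0 and `e^{-2β(Λ)}` along azimuth
  -- `π/2`.
  have hb : Real.exp (-2 * C.β 0) = 1 := by
    have h1 := key 0 0 0
    have h2 := key (Real.pi / 2) 0 0
    simp at h1 h2
    rw [h1] at h2
    simpa using h2.symm
  ext i j
  rw [key 0, hb]
  fin_cases i <;> fin_cases j <;> simp

end Axial

/-! ### Multipole moments and jets along null directions -/

section Moments

lemma contDiffAt_covDeriv {ι : Type} [Fintype ι] [DecidableEq ι] {G : (ι → ℝ) → Matrix ι ι ℝ}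
    {n : ℕ} {T : (ι → ℝ) → (Fin n → ι) → ℂ} {x : ι → ℝ}
    (hG : ∀ i j, ContDiffAt ℝ (⊤ : ℕ∞) (fun y => G y i j) x) (hx : (G x).det ≠ 0)
    (hT : ∀ a, ContDiffAt ℝ (⊤ : ℕ∞) (fun y => T y a) x) (a : Fin (n + 1) → ι) :
    ContDiffAt ℝ (⊤ : ℕ∞) (fun y => covDeriv G T y a) x := by
  unfold covDeriv
  refine (contDiffAt_pd (hT _) (by simp) _).sub
    (ContDiffAt.sum fun j _ => ContDiffAt.sum fun k _ => ContDiffAt.mul ?_ (hT _))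
  exact Complex.ofRealCLM.contDiff.contDiffAt.comp x
    (contDiffAt_christoffel (m := (⊤ : ℕ∞)) hG (by simp) hx _ _ _)

variable {G : (Fin 3 → ℝ) → Matrix (Fin 3) (Fin 3) ℝ} {P : (Fin 3 → ℝ) → ℂ} {x : Fin 3 → ℝ}

lemma contDiffAt_multipoleTensor (hG : ∀ i j, ContDiffAt ℝ (⊤ : ℕ∞) (fun y => G y i j) x)
    (hpos : ∀ᶠ y in 𝓝 x, (G y).PosDef) (hP : ContDiffAt ℝ (⊤ : ℕ∞) P x) (n : ℕ) :
    ∀ a, ContDiffAt ℝ (⊤ : ℕ∞) (fun y => multipoleTensor G P n y a) x := by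
  have hx : (G x).det ≠ 0 := hpos.self_of_nhds.det_pos.ne'
  induction n using Nat.twoStepInduction with
  | zero => exact fun _ => hP
  | one =>
    refine contDiffAt_stfPart hG hpos fun a => ?_
    exact contDiffAt_covDeriv hG hx (fun _ => hP) a
  | more n h0 h1 =>
    refine contDiffAt_stfPart hG hpos fun a => ?_
    refine (contDiffAt_covDeriv hG hx h1 a).sub ((contDiffAt_const.mul ?_).mul (h0 _))
    exact Complex.ofRealCLM.contDiff.contDiffAt.comp x (contDiffAt_ricci hG hx _ _)

lemma contDiffAt_contract {n : ℕ} {T : (Fin 3 → ℝ) → (Fin n → Fin 3) → ℂ}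
    (hT : ∀ a, ContDiffAt ℝ (⊤ : ℕ∞) (fun y => T y a) x) (v : Fin 3 → ℂ) :
    ContDiffAt ℝ (⊤ : ℕ∞) (fun y => contract v (T y)) x :=
  ContDiffAt.sum fun a _ => contDiffAt_const.mul (hT a)

/-- The recursion for the contractions of the multipole tensors with a null geodesic vector. -/
lemma contract_multipoleTensor_one {v : Fin 3 → ℂ} {μ : ℂ} (hpos : (G x).PosDef)
    (hP : DifferentiableAt ℝ P x)
    (hv : ∑ k, ∑ l, (G x k l : ℂ) * v k * v l = 0)
    (hμ : ∀ k, ∑ i, ∑ l, (christoffel G x k i l : ℂ) * v i * v l = μ * v k) :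
    contract v (multipoleTensor G P 1 x)
      = cderiv v (fun y => contract v (multipoleTensor G P 0 y)) x := by
  have h : multipoleTensor G P 1 x = stfPart (G x) (covDeriv G (multipoleTensor G P 0) x) := rfl
  rw [h, contract_stfPart hpos hv, contract_covDeriv (T := multipoleTensor G P 0) (fun _ => hP) hμ]
  simp

/-- The Ricci coefficient is `(N-1)(2N-3)/2` at `N = n + 2`, and each of the `n + 1` slots of the
preceding tensor contributes `μ`. -/
lemma contract_multipoleTensor_add_two {v : Fin 3 → ℂ} {μ : ℂ} (hpos : (G x).PosDef) (n : ℕ)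
    (hP : ∀ a, DifferentiableAt ℝ (fun y => multipoleTensor G P (n + 1) y a) x)
    (hv : ∑ k, ∑ l, (G x k l : ℂ) * v k * v l = 0)
    (hμ : ∀ k, ∑ i, ∑ l, (christoffel G x k i l : ℂ) * v i * v l = μ * v k) :
    contract v (multipoleTensor G P (n + 2) x)
      = cderiv v (fun y => contract v (multipoleTensor G P (n + 1) y)) x
        - (n + 1) * μ * contract v (multipoleTensor G P (n + 1) x)
        - (((n : ℂ) + 1) * (2 * (n : ℂ) + 1) / 2) * (∑ i, ∑ j, (ricci G x i j : ℂ) * v i * v j)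
          * contract v (multipoleTensor G P n x) := by
  have h : multipoleTensor G P (n + 2) x = stfPart (G x) fun a =>
      covDeriv G (multipoleTensor G P (n + 1)) x a
        - (((n : ℂ) + 1) * (2 * (n : ℂ) + 1) / 2) * (ricci G x (a 0) (a 1) : ℂ)
          * multipoleTensor G P n x (fun k => a k.succ.succ) := rfl
  rw [h, contract_stfPart hpos hv, contract_sub, contract_covDeriv hP hμ,
    contract_ricci (fun i j => (ricci G x i j : ℂ))]
  push_cast
  ring

variable {M : Spacetime} {C : Completion M}

/-- Two potentials whose difference has vanishing jets along all null directions produce the same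
multipole moments. -/
theorem multipoleTensor_eq_of_jetZero (hβ : AnalyticAt ℝ C.β 0) (hκ : AnalyticAt ℝ C.κ 0)
    {u w : (Fin 3 → ℝ) → ℂ} (cu : ContDiffAt ℝ (⊤ : ℕ∞) u 0) (cw : ContDiffAt ℝ (⊤ : ℕ∞) w 0)
    (h : ∀ θ m, JetZero (nullDir θ) m fun y => u y - w y) (n : ℕ) :
    multipoleTensor C.hTilde u n 0 = multipoleTensor C.hTilde w n 0 := by
  have hG := fun i j => C.contDiffAt_hTilde M.zero_mem i j
  have hpos := C.eventually_posDef M.zero_mem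
  have h0 := C.hTilde_zero hβ hκ
  have hcu := contDiffAt_multipoleTensor hG hpos cu
  have hcw := contDiffAt_multipoleTensor hG hpos cw
  have hκc : ContDiffAt ℝ (⊤ : ℕ∞) (fun y => (C.κ y : ℂ)) 0 :=
    Complex.ofRealCLM.contDiff.contDiffAt.comp 0 hκ.contDiffAt
  -- The recursion is linear and its coefficients belong to the geometry, so the difference of the
  -- two sequences obeys it as well. All orders `m` are carried along, since each rank consumes a
  -- derivative of the preceding one.
  have key : ∀ θ n m, JetZero (nullDir θ) m fun y =>
      contract (nullDir θ) (multipoleTensor C.hTilde u n y)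
        - contract (nullDir θ) (multipoleTensor C.hTilde w n y) := by
    intro θ n
    set v := nullDir θ with hv
    have cF : ∀ n, ContDiffAt ℝ (⊤ : ℕ∞) (fun y => contract v (multipoleTensor C.hTilde u n y)
        - contract v (multipoleTensor C.hTilde w n y)) 0 := fun n =>
      (contDiffAt_contract (hcu n) v).sub (contDiffAt_contract (hcw n) v)
    have hd : ∀ n, ∀ᶠ y in 𝓝 0, (∀ a, DifferentiableAt ℝ
        (fun y => multipoleTensor C.hTilde u n y a) y) ∧ (∀ a, DifferentiableAt ℝ
        (fun y => multipoleTensor C.hTilde w n y a) y) := fun n =>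
      (Filter.eventually_all.2 fun a => eventually_differentiableAt (hcu n a)).and
        (Filter.eventually_all.2 fun a => eventually_differentiableAt (hcw n a))
    have hdc : ∀ n, ∀ᶠ y in 𝓝 0, DifferentiableAt ℝ
        (fun y => contract v (multipoleTensor C.hTilde u n y)) y ∧ DifferentiableAt ℝ
        (fun y => contract v (multipoleTensor C.hTilde w n y)) y := fun n =>
      (eventually_differentiableAt (contDiffAt_contract (hcu n) v)).and
        (eventually_differentiableAt (contDiffAt_contract (hcw n) v))
    induction n using Nat.twoStepInduction with
    | zero =>
      intro m
      refine (h θ m).congr (Filter.Eventually.of_forall fun y => ?_)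
      simp [contract, multipoleTensor]
    | one =>
      intro m
      have c1 := contDiffAt_cderiv (v := v) (cF 0)
      have e1 : JetZero v m (cderiv v fun y => contract v (multipoleTensor C.hTilde u 0 y)
        - contract v (multipoleTensor C.hTilde w 0 y)) := by
        have := h θ (m + 1)
        refine (this.2).congr ?_
        refine cderiv_eventuallyEq (Filter.Eventually.of_forall fun y => ?_)
        simp [contract, multipoleTensor]
      -- The recursion is available on the half-plane only. Its defect vanishes there, hence has
      -- vanishing jets, and is added back afterwards.
      have e2 := JetZero.of_halfPlane (θ := θ) ((cF 1).sub c1) (by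
        rw [eventually_nhdsWithin_iff]
        filter_upwards [C.eventually_regular hβ hκ, hd 0, hdc 0] with y hr h1 h2 hp
        rw [cderiv_sub h2.1 h2.2,
          contract_multipoleTensor_one (P := u) (C.posDef y hr.mem) (h1.1 Fin.elim0)
            (C.null_halfPlane hr.mem hp) (C.geodesic_halfPlane hr hp),
          contract_multipoleTensor_one (P := w) (C.posDef y hr.mem) (h1.2 Fin.elim0)
            (C.null_halfPlane hr.mem hp) (C.geodesic_halfPlane hr hp)]
        exact sub_self _) m
      exact (e2.add e1 ((cF 1).sub c1) c1).congr
        (Filter.Eventually.of_forall fun y => by simp)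
    | more n ih0 ih1 =>
      intro m
      set D0 := fun y => contract v (multipoleTensor C.hTilde u n y)
        - contract v (multipoleTensor C.hTilde w n y) with hD0
      set D1 := fun y => contract v (multipoleTensor C.hTilde u (n + 1) y)
        - contract v (multipoleTensor C.hTilde w (n + 1) y) with hD1
      have c1 := contDiffAt_cderiv (v := v) (cF (n + 1))
      have cκ := contDiffAt_cderiv (v := v) hκc
      have cR : ContDiffAt ℝ (⊤ : ℕ∞)
          (fun y => ∑ i, ∑ j, (ricci C.hTilde y i j : ℂ) * v i * v j) 0 :=
        ContDiffAt.sum fun i _ => ContDiffAt.sum fun j _ =>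
          ((Complex.ofRealCLM.contDiff.contDiffAt.comp 0 (contDiffAt_ricci hG
            hpos.self_of_nhds.det_pos.ne' i j)).mul contDiffAt_const).mul contDiffAt_const
      have ca : ContDiffAt ℝ (⊤ : ℕ∞) (fun y => -(((n : ℂ) + 1) *
        (2 * cderiv v (fun y => (C.κ y : ℂ)) y))) 0 :=
        (contDiffAt_const.mul (contDiffAt_const.mul cκ)).neg
      have cb : ContDiffAt ℝ (⊤ : ℕ∞) (fun y => -((((n : ℂ) + 1) * (2 * (n : ℂ) + 1) / 2) *
        (∑ i, ∑ j, (ricci C.hTilde y i j : ℂ) * v i * v j))) 0 :=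
        (contDiffAt_const.mul cR).neg
      have e1 : JetZero v m (cderiv v D1) := (ih1 (m + 1)).2
      have e2 := (ih1 m).mul ca (cF (n + 1))
      have e3 := (ih0 m).mul cb (cF n)
      have c12 := c1.add (ca.mul (cF (n + 1)))
      have c123 := c12.add (cb.mul (cF n))
      have e4 := (e1.add e2 c1 (ca.mul (cF (n + 1)))).add e3 c12 (cb.mul (cF n))
      have e5 := JetZero.of_halfPlane (θ := θ) ((cF (n + 2)).sub c123) (by
        rw [eventually_nhdsWithin_iff]
        filter_upwards [C.eventually_regular hβ hκ, hd (n + 1), hdc (n + 1)] with y hr h1 h2 hp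
        have k1 := contract_multipoleTensor_add_two (C.posDef y hr.mem) n h1.1
            (C.null_halfPlane hr.mem hp) (C.geodesic_halfPlane hr hp)
        have k2 := contract_multipoleTensor_add_two (C.posDef y hr.mem) n h1.2
            (C.null_halfPlane hr.mem hp) (C.geodesic_halfPlane hr hp)
        rw [k1, k2, cderiv_sub h2.1 h2.2]
        ring) m
      refine (e5.add e4 ((cF (n + 2)).sub c123) c123).congr
        (Filter.Eventually.of_forall fun y => ?_)
      ring
  have hstf : ∀ u : (Fin 3 → ℝ) → ℂ, (∀ (σ : Equiv.Perm (Fin n)) a,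
      multipoleTensor C.hTilde u n 0 (a ∘ σ) = multipoleTensor C.hTilde u n 0 a) ∧
      ∀ i j : Fin n, i ≠ j → ∀ a, traceAt (1 : Matrix (Fin 3) (Fin 3) ℝ) i j
        (multipoleTensor C.hTilde u n 0) a = 0 := by
    intro u
    match n with
    | 0 => exact ⟨fun σ a => rfl, fun i => i.elim0⟩
    | 1 =>
      have := stfPart_spec (C.posDef 0 M.zero_mem) (covDeriv C.hTilde
        (multipoleTensor C.hTilde u 0) 0)
      exact ⟨this.symmetric, fun i j hij a => by rw [← h0]; exact this.traceFree i j hij a⟩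
    | n + 2 =>
      have := stfPart_spec (C.posDef 0 M.zero_mem) (fun a =>
        covDeriv C.hTilde (multipoleTensor C.hTilde u (n + 1)) 0 a
        - (((n : ℂ) + 1) * (2 * (n : ℂ) + 1) / 2) * (ricci C.hTilde 0 (a 0) (a 1) : ℂ)
          * multipoleTensor C.hTilde u n 0 (fun k => a k.succ.succ))
      exact ⟨this.symmetric, fun i j hij a => by rw [← h0]; exact this.traceFree i j hij a⟩
  -- At `Λ` the metric is Euclidean, so trace-free there means trace-free for the identity matrix;
  -- order zero of `key` supplies the contractions.
  have hz := eq_zero_of_contract_nullDir (T := fun a => multipoleTensor C.hTilde u n 0 a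
      - multipoleTensor C.hTilde w n 0 a)
    (fun σ a => by simp only [(hstf u).1 σ a, (hstf w).1 σ a])
    (fun i j hij a => by
      have e1 := (hstf u).2 i j hij a
      have e2 := (hstf w).2 i j hij a
      simp only [traceAt] at e1 e2 ⊢
      simp only [mul_sub, Finset.sum_sub_distrib, e1, e2, sub_zero])
    (fun θ => by rw [contract_sub]; exact (key θ n 1).1)
  funext a
  exact sub_eq_zero.1 (congrFun hz a)

end Moments

/-! ### The conformal factor along null directions -/

section Factor

lemma christoffel_eq_christoffelJet {ι : Type} [Fintype ι] [DecidableEq ι]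
    {G : (ι → ℝ) → Matrix ι ι ℝ} {x : ι → ℝ} {e : ι → ℝ} (he : (G x)⁻¹ = Matrix.diagonal e)
    (k i j : ι) :
    christoffel G x k i j = christoffelJet e (fun a b c => pd a (fun y => G y b c) x) k i j := by
  unfold christoffel christoffelJet
  rw [he, Finset.sum_eq_single k (fun l _ hl => by simp [Matrix.diagonal_apply_ne' _ hl])
    (by simp), Matrix.diagonal_apply_eq]

lemma christoffel_symm {ι : Type} [Fintype ι] [DecidableEq ι]
    {G : (ι → ℝ) → Matrix ι ι ℝ} {x : ι → ℝ} (hs : ∀ᶠ y in 𝓝 x, ∀ i j, G y i j = G y j i)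
    (k i j : ι) : christoffel G x k i j = christoffel G x k j i := by
  unfold christoffel
  congr 1
  refine Finset.sum_congr rfl fun l _ => ?_
  have h : ∀ m a b, pd m (fun y => G y a b) x = pd m (fun y => G y b a) x := fun m a b =>
    pd_congr (hs.mono fun y hy => hy a b) m
  rw [h i l j, h j i l, h l i j]
  ring

lemma diagonal_inv_three {a b : ℝ} (ha : a ≠ 0) (hb : b ≠ 0) :
    (Matrix.diagonal ![a, b, a])⁻¹ = Matrix.diagonal ![1 / a, 1 / b, 1 / a] := by
  refine Matrix.inv_eq_right_inv ?_
  rw [Matrix.diagonal_mul_diagonal, ← Matrix.diagonal_one]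
  congr 1
  funext i
  fin_cases i <;> simp [ha, hb]

namespace Completion

variable {M : Spacetime} {C : Completion M} {x : Fin 3 → ℝ}

lemma contDiffAt_factor (hx : x ∈ M.U) : ContDiffAt ℝ (⊤ : ℕ∞) C.Ω x :=
  C.smooth_factor.contDiffAt (M.isOpen_U.mem_nhds hx)

lemma h_symm (C : Completion M) (hx : x ∈ M.V) (i j : Fin 3) : M.h x i j = M.h x j i := by
  have h := C.hTilde_symm hx.1 i j
  rw [C.conformal x hx] at h
  have hp := C.factor_pos x hx
  simpa [hp.ne'] using h

lemma isConformalJet (hx : x ∈ M.V) {a b : ℝ} (hh : M.h x = Matrix.diagonal ![a, b, a]) :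
    IsConformalJet a b (C.Ω x) (fun m => pd m C.Ω x) (fun m n => pd m (pd n C.Ω) x)
      (fun m i j => pd m (fun y => M.h y i j) x)
      (fun m n i j => pd m (pd n (fun y => M.h y i j)) x)
      (fun m i j => pd m (fun y => C.hTilde y i j) x)
      (fun m n i j => pd m (pd n (fun y => C.hTilde y i j)) x) := by
  have hV : ∀ᶠ y in 𝓝 x, y ∈ M.V := M.isOpen_V.mem_nhds hx
  have h2 : ((2 : ℕ) : WithTop ℕ∞) ≤ ((⊤ : ℕ∞) : WithTop ℕ∞) := WithTop.coe_le_coe.2 le_top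
  have dh : ∀ y ∈ M.V, ∀ i j, DifferentiableAt ℝ (fun y => M.h y i j) y := fun y hy i j =>
    (Spacetime.contDiffAt_h hy i j).differentiableAt (by simp)
  have dh' : ∀ m i j, DifferentiableAt ℝ (pd m fun y => M.h y i j) x := fun m i j =>
    (contDiffAt_pd (m := (⊤ : ℕ∞)) (Spacetime.contDiffAt_h hx i j) (by simp) m).differentiableAt
      (by simp)
  have df : ∀ y ∈ M.V, DifferentiableAt ℝ C.Ω y := fun y hy =>
    (contDiffAt_factor hy.1).differentiableAt (by simp)
  have df' : ∀ m, DifferentiableAt ℝ (pd m C.Ω) x := fun m =>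
    (contDiffAt_pd (m := (⊤ : ℕ∞)) (contDiffAt_factor hx.1) (by simp) m).differentiableAt
      (by simp)
  have hfirst : ∀ y ∈ M.V, ∀ n i j, pd n (fun y => C.hTilde y i j) y
      = (pd n C.Ω y * C.Ω y + C.Ω y * pd n C.Ω y) * M.h y i j
        + C.Ω y * C.Ω y * pd n (fun y => M.h y i j) y := by
    intro y hy n i j
    rw [pd_congr (g := fun y => C.Ω y * C.Ω y * M.h y i j),
      pd_mul ((df y hy).fun_mul (df y hy)) (dh y hy i j), pd_mul (df y hy) (df y hy)]
    filter_upwards [M.isOpen_V.mem_nhds hy] with z hz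
    rw [C.conformal z hz]
    simp [pow_two]
  have hhx : ∀ i j, M.h x i j = if i = j then ![a, b, a] i else 0 := by
    intro i j; rw [hh]; rfl
  refine ⟨?_, ?_, ?_, ?_, ?_, ?_⟩
  · exact fun m i j => pd_congr (hV.mono fun y hy => C.h_symm hy i j) m
  · exact fun m n i j =>
      pd_congr (pd_eventuallyEq (hV.mono fun y hy => C.h_symm hy i j) n) m
  · exact fun m n i j => pd_comm ((Spacetime.contDiffAt_h hx i j).of_le h2) m n
  · exact fun m n => pd_comm ((contDiffAt_factor hx.1).of_le h2) m n
  · intro m i j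
    rw [hfirst x hx, hhx]
    ring
  · intro m n i j
    rw [pd_congr (hV.mono fun y hy => hfirst y hy n i j)]
    have d := df x hx
    rw [pd_add ((((df' n).fun_mul d).fun_add (d.fun_mul (df' n))).fun_mul (dh x hx i j))
        ((d.fun_mul d).fun_mul (dh' n i j)),
      pd_mul (((df' n).fun_mul d).fun_add (d.fun_mul (df' n))) (dh x hx i j),
      pd_add ((df' n).fun_mul d) (d.fun_mul (df' n)), pd_mul (df' n) d, pd_mul d (df' n),
      pd_mul (d.fun_mul d) (dh' n i j), pd_mul d d, hhx]
    ring

/-- At azimuth 0 the Cartesian basis is `∂_ρ, ρ⁻¹∂_φ, ∂_z`, so the metric has the diagonal form on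
which the jet identities rely. -/
lemma hTilde_halfPlane_zero (hx : x ∈ M.U) (hp : x ∈ halfPlane 0) :
    C.hTilde x = Matrix.diagonal ![Real.exp (2 * C.κ x),
      Real.exp (2 * C.κ x) * Real.exp (-2 * C.β x), Real.exp (2 * C.κ x)] := by
  rw [C.metric_form x hx (halfPlane_off_axis hp)]
  obtain ⟨ρ, hρ, z, rfl⟩ := hp
  ext i j
  rw [axialMetric_halfPlane C.β C.κ hρ]
  fin_cases i <;> fin_cases j <;> simp

/-- The vacuum equations, rewritten for the rescaled metric on the half-plane `φ = 0`. -/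
lemma factor_hessian {ω : (Fin 3 → ℝ) → ℝ} (hω : M.IsTwist ω) (hx : x ∈ M.V)
    (hp : x ∈ halfPlane 0) :
    C.Ω x * (1 / (2 * M.lam x ^ 2) * (pd 0 M.lam x * pd 2 M.lam x + pd 0 ω x * pd 2 ω x))
        = C.Ω x * ricci C.hTilde x 0 2 + hessian C.hTilde C.Ω x 0 2 ∧
      C.Ω x * (1 / (2 * M.lam x ^ 2) * (pd 2 M.lam x ^ 2 - pd 0 M.lam x ^ 2
          + (pd 2 ω x ^ 2 - pd 0 ω x ^ 2)))
        = C.Ω x * (ricci C.hTilde x 2 2 - ricci C.hTilde x 0 0)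
          + hessian C.hTilde C.Ω x 2 2 - hessian C.hTilde C.Ω x 0 0 := by
  have hf := C.factor_pos x hx
  have h2 : ((2 : ℕ) : WithTop ℕ∞) ≤ ((⊤ : ℕ∞) : WithTop ℕ∞) := WithTop.coe_le_coe.2 le_top
  obtain ⟨A, hA, B, hB, ht⟩ : ∃ A > 0, ∃ B > 0, C.hTilde x = Matrix.diagonal ![A, B, A] :=
    ⟨_, Real.exp_pos _, _, mul_pos (Real.exp_pos _) (Real.exp_pos _),
      hTilde_halfPlane_zero hx.1 hp⟩
  -- Dividing by `Ω²` turns the diagonal form of the rescaled metric into that of `h`.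
  obtain ⟨a, ha, rfl⟩ : ∃ a > 0, A = C.Ω x ^ 2 * a :=
    ⟨A / C.Ω x ^ 2, by positivity, by field_simp⟩
  obtain ⟨b, hb, rfl⟩ : ∃ b > 0, B = C.Ω x ^ 2 * b :=
    ⟨B / C.Ω x ^ 2, by positivity, by field_simp⟩
  have hh : M.h x = Matrix.diagonal ![a, b, a] := by
    have e := ht
    rw [C.conformal x hx] at e
    ext i j
    have e' := congrFun (congrFun e i) j
    fin_cases i <;> fin_cases j <;> simpa [hf.ne'] using e'
  have hinvt : (C.hTilde x)⁻¹ = Matrix.diagonal ![1 / (C.Ω x ^ 2 * a), 1 / (C.Ω x ^ 2 * b),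
      1 / (C.Ω x ^ 2 * a)] := by
    rw [ht, diagonal_inv_three hA.ne' hB.ne']
  have hinv : (M.h x)⁻¹ = Matrix.diagonal ![1 / a, 1 / b, 1 / a] := by
    rw [hh, diagonal_inv_three ha.ne' hb.ne']
  have hdet : (M.h x).det ≠ 0 := by
    rw [hh, Matrix.det_diagonal]
    simp [Fin.prod_univ_succ, ha.ne', hb.ne']
  have hJ := C.isConformalJet hx hh
  have rh := ricci_eq_ricciJet (x := x) (fun i j => (Spacetime.contDiffAt_h hx i j).of_le h2)
    hdet hinv
  have rt := ricci_eq_ricciJet (x := x) (fun i j => (C.contDiffAt_hTilde hx.1 i j).of_le h2)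
    (C.posDef x hx.1).det_pos.ne' hinvt
  have ct := christoffel_eq_christoffelJet hinvt
  obtain ⟨k1, k2⟩ := Spacetime.ricci_h hω hx ha hb hh
  have j1 := hJ.ricciJet_offDiag hf.ne' ha.ne' hb.ne'
  have j2 := hJ.ricciJet_diag hf.ne' ha.ne' hb.ne'
  unfold hessian
  simp only [ct]
  rw [← rh, ← rt] at j1
  rw [← rh, ← rh, ← rt, ← rt] at j2
  rw [← k1, ← k2]
  refine ⟨j1, j2.trans ?_⟩
  ring

/-- Both sides are the Hessian evaluated on `(v, v)` with `v = (-i, 0, 1)`: on the left through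
`v(vf)`, as `v` has constant components, on the right by expanding in components. -/
lemma hessian_nullDir (hx : x ∈ M.U) (f : (Fin 3 → ℝ) → ℝ) (hf : ContDiffAt ℝ (⊤ : ℕ∞) f x) :
    cderiv (nullDir 0) (cderiv (nullDir 0) fun y => (f y : ℂ)) x
      - ∑ k, (∑ i, ∑ l, (christoffel C.hTilde x k i l : ℂ) * nullDir 0 i * nullDir 0 l)
        * ((pd k f x : ℝ) : ℂ)
      = ((hessian C.hTilde f x 2 2 - hessian C.hTilde f x 0 0 : ℝ) : ℂ)
        - 2 * Complex.I * (hessian C.hTilde f x 0 2 : ℂ) := by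
  have h2 : ((2 : ℕ) : WithTop ℕ∞) ≤ ((⊤ : ℕ∞) : WithTop ℕ∞) := WithTop.coe_le_coe.2 le_top
  have hs : ∀ᶠ y in 𝓝 x, ∀ i j, C.hTilde y i j = C.hTilde y j i := by
    filter_upwards [M.isOpen_U.mem_nhds hx] with y hy using C.hTilde_symm hy
  have d2 : ∀ j, DifferentiableAt ℝ (pd j f) x := fun j =>
    (contDiffAt_pd (m := (⊤ : ℕ∞)) hf (by simp) j).differentiableAt (by simp)
  have e1 : cderiv (nullDir 0) (fun y => (f y : ℂ)) =ᶠ[𝓝 x]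
      fun y => ∑ j, nullDir 0 j * ((pd j f y : ℝ) : ℂ) := by
    filter_upwards [eventually_differentiableAt hf] with y hy
    simp only [cderiv, pd_ofReal hy]
  have d3 : ∀ j, DifferentiableAt ℝ (fun y => ((pd j f y : ℝ) : ℂ)) x := fun j =>
    Complex.ofRealCLM.differentiableAt.comp x (d2 j)
  have e2 : ∀ i, pd i (fun y => ∑ j, nullDir 0 j * ((pd j f y : ℝ) : ℂ)) x
      = ∑ j, nullDir 0 j * ((pd i (pd j f) x : ℝ) : ℂ) := by
    intro i
    rw [pd_sum _ fun j _ => (differentiableAt_const _).fun_mul (d3 j)]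
    refine Finset.sum_congr rfl fun j _ => ?_
    rw [pd_const_mul _ (d3 j), pd_ofReal (d2 j)]
  rw [cderiv_congr e1]
  simp only [cderiv, e2, hessian]
  have hc := pd_comm (hf.of_le h2) 2 0
  have hΓ := fun k => christoffel_symm hs k 2 0
  have hI := Complex.I_sq
  simp [Fin.sum_univ_three, nullDir, hc, hΓ]
  linear_combination (((pd 0 (pd 0 f) x : ℝ) : ℂ)
    - (christoffel C.hTilde x 0 0 0 : ℂ) * ((pd 0 f x : ℝ) : ℂ)
    - (christoffel C.hTilde x 1 0 0 : ℂ) * ((pd 1 f x : ℝ) : ℂ)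
    - (christoffel C.hTilde x 2 0 0 : ℂ) * ((pd 2 f x : ℝ) : ℂ)) * hI

/-- The null-null component of the rescaled vacuum equations. The relation `D_v v = 2 v(κ) v`
evaluates the Hessian of `Ω`, and the source `v(λ)² + v(ω)²` factors as `v(λ + iω) v(λ - iω)`. -/
lemma factor_equation {ω : (Fin 3 → ℝ) → ℝ} (hω : M.IsTwist ω) (hr : C.Regular x)
    (hp : x ∈ halfPlane 0) (hx : x ∈ M.V) :
    cderiv (nullDir 0) (cderiv (nullDir 0) fun y => (C.Ω y : ℂ)) x
      - 2 * cderiv (nullDir 0) (fun y => (C.κ y : ℂ)) x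
        * cderiv (nullDir 0) (fun y => (C.Ω y : ℂ)) x
      + ((ricci C.hTilde x 2 2 : ℂ) - ricci C.hTilde x 0 0 - 2 * Complex.I * ricci C.hTilde x 0 2)
        * (C.Ω x : ℂ)
      = (C.Ω x : ℂ) / (2 * (M.lam x : ℂ) ^ 2) *
        (cderiv (nullDir 0) (fun y => (M.lam y : ℂ) + Complex.I * (ω y : ℂ)) x
          * cderiv (nullDir 0) (fun y => (M.lam y : ℂ) - Complex.I * (ω y : ℂ)) x) := by
  have dl : DifferentiableAt ℝ M.lam x := (Spacetime.contDiffAt_lam hx).differentiableAt (by simp)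
  have dw : DifferentiableAt ℝ ω x :=
    (hω.smooth.contDiffAt (M.isOpen_V.mem_nhds hx)).differentiableAt (by simp)
  have dlc : DifferentiableAt ℝ (fun y => (M.lam y : ℂ)) x :=
    Complex.ofRealCLM.differentiableAt.comp x dl
  have dwc : DifferentiableAt ℝ (fun y => (ω y : ℂ)) x :=
    Complex.ofRealCLM.differentiableAt.comp x dw
  have dΩ : DifferentiableAt ℝ C.Ω x := (contDiffAt_factor hx.1).differentiableAt (by simp)
  have hl : (M.lam x : ℂ) ≠ 0 := by exact_mod_cast (Spacetime.lam_pos hx).ne'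
  obtain ⟨k1, k2⟩ := C.factor_hessian hω hx hp
  have k1c := congrArg (fun r : ℝ => (r : ℂ)) k1
  have k2c := congrArg (fun r : ℝ => (r : ℂ)) k2
  have k3 := C.hessian_nullDir hx.1 C.Ω (contDiffAt_factor hx.1)
  simp only [C.geodesic_halfPlane hr hp] at k3
  have dIw : DifferentiableAt ℝ (fun y => Complex.I * (ω y : ℂ)) x :=
    (differentiableAt_const _).fun_mul dwc
  rw [cderiv_add dlc dIw, cderiv_sub dlc dIw, cderiv_mul (differentiableAt_const _) dwc,
    cderiv_const]
  have e : ∀ f : (Fin 3 → ℝ) → ℝ, DifferentiableAt ℝ f x →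
      cderiv (nullDir 0) (fun y => (f y : ℂ)) x = ((pd 2 f x : ℝ) : ℂ) - Complex.I * ((pd 0 f x : ℝ) : ℂ) := by
    intro f hf
    simp only [cderiv, pd_ofReal hf]
    simp [Fin.sum_univ_three, nullDir]
    ring
  rw [e _ dl, e _ dw]
  rw [e _ dΩ]
  push_cast at k1c k2c k3
  have hI := Complex.I_sq
  have v0 : nullDir 0 0 = -Complex.I := by simp [nullDir]
  have v1 : nullDir 0 1 = 0 := by simp [nullDir]
  have v2 : nullDir 0 2 = 1 := by simp [nullDir]
  simp only [Fin.sum_univ_three, v0, v1, v2] at k3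
  linear_combination k3 - k2c + 2 * Complex.I * k1c - (C.Ω x : ℂ) / (2 * (M.lam x : ℂ) ^ 2) *
    (((pd 0 M.lam x : ℝ) : ℂ) ^ 2 + ((pd 0 ω x : ℝ) : ℂ) ^ 2
      - (((pd 2 ω x : ℝ) : ℂ) - Complex.I * ((pd 0 ω x : ℝ) : ℂ)) ^ 2) * hI

end Completion

end Factor

/-! ### The equation for the conformal factor in terms of the Ernst potential. -/

section FactorJet

lemma ofReal_sqrt_ne_zero {r : ℝ} (hr : 0 < r) : ((√r : ℝ) : ℂ) ≠ 0 := by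
  exact_mod_cast (Real.sqrt_pos.2 hr).ne'

lemma ofReal_sqrt_mul_self {r : ℝ} (hr : 0 < r) : ((√r : ℝ) : ℂ) * ((√r : ℝ) : ℂ) = r := by
  exact_mod_cast Real.mul_self_sqrt hr.le

/-- The logarithmic form of the derivative of the Ernst potential. -/
lemma ernst_energy {lam s ψ ψ' χ χ' s' Ω' E E' F F' φ φ' η η' Ω : ℂ}
    (hE : (1 + E) * (1 + φ) = 2) (hF : (1 + F) * (1 + η) = 2)
    (hE' : E' * (1 + φ) + (1 + E) * φ' = 0) (hF' : F' * (1 + η) + (1 + F) * η' = 0)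
    (hlam : E + F = 2 * lam) (hl : lam ≠ 0) (hs : s * s = Ω) (hs' : s' * s + s * s' = Ω')
    (hφ : φ = s * ψ) (hη : η = s * χ) (hφ' : φ' = s' * ψ + s * ψ') (hη' : η' = s' * χ + s * χ') :
    1 - Ω * (ψ * χ) ≠ 0 ∧ Ω / (2 * lam ^ 2) * (E' * F')
      = 2 * ((Ω' / 2 * ψ + Ω * ψ') * (Ω' / 2 * χ + Ω * χ')) / (1 - Ω * (ψ * χ)) ^ 2 := by
  have hE0 : 1 + E ≠ 0 := by intro h; rw [h] at hE; simp at hE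
  have hF0 : 1 + F ≠ 0 := by intro h; rw [h] at hF; simp at hF
  have hφ1 : 1 + φ = 2 / (1 + E) := by field_simp; linear_combination hE
  have hη1 : 1 + η = 2 / (1 + F) := by field_simp; linear_combination hF
  have hprod : Ω * (ψ * χ) = φ * η := by rw [hφ, hη, ← hs]; ring
  -- For conjugate `ψ` and `χ` this is `1 - |φ_E|²`; it is nonzero because `λ` is.
  have hD : 1 - Ω * (ψ * χ) = 4 * lam / ((1 + E) * (1 + F)) := by
    have a1 : φ = 2 / (1 + E) - 1 := by rw [← hφ1]; ring
    have a2 : η = 2 / (1 + F) - 1 := by rw [← hη1]; ring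
    rw [hprod, a1, a2]
    field_simp
    linear_combination 2 * hlam
  have b1 : E' = -(1 + E) ^ 2 * φ' / 2 := by
    rw [hφ1] at hE'
    field_simp at hE'
    linear_combination hE' / 2
  have b2 : F' = -(1 + F) ^ 2 * η' / 2 := by
    rw [hη1] at hF'
    field_simp at hF'
    linear_combination hF' / 2
  -- Multiplying `(sψ)'` by `s = √Ω` clears the root, as `s s' = Ω'/2`. Only `Ω` and `ψ`, which are
  -- smooth at `Λ`, remain.
  have c1 : Ω' / 2 * ψ + Ω * ψ' = s * φ' := by rw [hφ', ← hs', ← hs]; ring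
  have c2 : Ω' / 2 * χ + Ω * χ' = s * η' := by rw [hη', ← hs', ← hs]; ring
  refine ⟨by rw [hD]; exact div_ne_zero (mul_ne_zero (by norm_num) hl) (mul_ne_zero hE0 hF0), ?_⟩
  rw [c1, c2, hD, b1, b2, ← hs]
  field_simp
  ring

namespace Completion

variable {M : Spacetime} {C : Completion M} {x : Fin 3 → ℝ} {ω : (Fin 3 → ℝ) → ℝ}

/-- The relation `1 + φ_E = 2 / (1 + λ + iω)`, in a product form that is differentiated without
quotients. -/
lemma one_add_ernst_mul (hx : x ∈ M.V) :
    (1 + ((M.lam x : ℂ) + Complex.I * (ω x : ℂ))) * (1 + ernst M.lam ω x) = 2 := by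
  have h : (1 + (M.lam x : ℂ) + Complex.I * (ω x : ℂ)) ≠ 0 := by
    intro h
    have := congrArg Complex.re h
    simp at this
    linarith [Spacetime.lam_pos hx]
  unfold ernst
  rw [mul_add, mul_one, ← add_assoc, mul_div_cancel₀ _ h]
  ring

/-- The equation for the conformal factor on the half-plane `φ = 0`, in terms of the rescaled Ernst
potential. -/
lemma factor_ernst_equation (hω : M.IsTwist ω) (hr : C.Regular x) (hp : x ∈ halfPlane 0)
    (hx : x ∈ M.V) {ψ χ : (Fin 3 → ℝ) → ℂ} (hψ : DifferentiableAt ℝ ψ x)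
    (hχ : DifferentiableAt ℝ χ x)
    (eψ : ∀ y ∈ M.V, ernst M.lam ω y = ((√(C.Ω y) : ℝ) : ℂ) * ψ y)
    (eχ : ∀ y, χ y = (starRingEnd ℂ) (ψ y)) :
    1 - (C.Ω x : ℂ) * (ψ x * χ x) ≠ 0 ∧
    cderiv (nullDir 0) (cderiv (nullDir 0) fun y => (C.Ω y : ℂ)) x
      - 2 * cderiv (nullDir 0) (fun y => (C.κ y : ℂ)) x
        * cderiv (nullDir 0) (fun y => (C.Ω y : ℂ)) x
      + ((ricci C.hTilde x 2 2 : ℂ) - ricci C.hTilde x 0 0 - 2 * Complex.I * ricci C.hTilde x 0 2)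
        * (C.Ω x : ℂ)
      = 2 * ((cderiv (nullDir 0) (fun y => (C.Ω y : ℂ)) x / 2 * ψ x
            + (C.Ω x : ℂ) * cderiv (nullDir 0) ψ x)
          * (cderiv (nullDir 0) (fun y => (C.Ω y : ℂ)) x / 2 * χ x
            + (C.Ω x : ℂ) * cderiv (nullDir 0) χ x)) / (1 - (C.Ω x : ℂ) * (ψ x * χ x)) ^ 2 := by
  rw [factor_equation hω hr hp hx]
  have hV : ∀ᶠ y in 𝓝 x, y ∈ M.V := M.isOpen_V.mem_nhds hx
  set v := nullDir 0 with hv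
  have dl : DifferentiableAt ℝ (fun y => (M.lam y : ℂ)) x :=
    Complex.ofRealCLM.differentiableAt.comp x
      ((Spacetime.contDiffAt_lam hx).differentiableAt (by simp))
  have dw : DifferentiableAt ℝ (fun y => Complex.I * (ω y : ℂ)) x :=
    (differentiableAt_const _).fun_mul (Complex.ofRealCLM.differentiableAt.comp x
      ((hω.smooth.contDiffAt (M.isOpen_V.mem_nhds hx)).differentiableAt (by simp)))
  have dΩ : DifferentiableAt ℝ C.Ω x := (contDiffAt_factor hx.1).differentiableAt (by simp)
  have ds : DifferentiableAt ℝ (fun y => ((√(C.Ω y) : ℝ) : ℂ)) x :=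
    Complex.ofRealCLM.differentiableAt.comp x (dΩ.sqrt (C.factor_pos x hx).ne')
  have eη : ∀ y ∈ M.V, (starRingEnd ℂ) (ernst M.lam ω y) = ((√(C.Ω y) : ℝ) : ℂ) * χ y := by
    intro y hy; rw [eψ y hy, eχ, map_mul, Complex.conj_ofReal]
  have mE : ∀ y ∈ M.V, (1 + ((M.lam y : ℂ) + Complex.I * (ω y : ℂ)))
      * (1 + ((√(C.Ω y) : ℝ) : ℂ) * ψ y) = 2 := by
    intro y hy; rw [← eψ y hy]; exact one_add_ernst_mul hy
  have mF : ∀ y ∈ M.V, (1 + ((M.lam y : ℂ) - Complex.I * (ω y : ℂ)))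
      * (1 + ((√(C.Ω y) : ℝ) : ℂ) * χ y) = 2 := by
    intro y hy
    rw [← eη y hy]
    have := congrArg (starRingEnd ℂ) (one_add_ernst_mul (ω := ω) hy)
    rw [map_ofNat] at this
    simpa [sub_eq_add_neg] using this
  have dE := (differentiableAt_const (1 : ℂ)).fun_add (dl.fun_add dw)
  have dF := (differentiableAt_const (1 : ℂ)).fun_add (dl.fun_sub dw)
  have d1 := (differentiableAt_const (1 : ℂ)).fun_add (ds.fun_mul hψ)
  have d2 := (differentiableAt_const (1 : ℂ)).fun_add (ds.fun_mul hχ)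
  have k1 := cderiv_congr (v := v) (g := fun _ => (2 : ℂ)) (hV.mono fun y hy => mE y hy)
  have k2 := cderiv_congr (v := v) (g := fun _ => (2 : ℂ)) (hV.mono fun y hy => mF y hy)
  have k3 := cderiv_congr (v := v) (hV.mono fun y hy => ofReal_sqrt_mul_self (C.factor_pos y hy))
  rw [cderiv_const, cderiv_mul dE d1, cderiv_add (differentiableAt_const _) (dl.fun_add dw),
    cderiv_add (differentiableAt_const _) (ds.fun_mul hψ), cderiv_const, zero_add, zero_add] at k1
  rw [cderiv_const, cderiv_mul dF d2, cderiv_add (differentiableAt_const _) (dl.fun_sub dw),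
    cderiv_add (differentiableAt_const _) (ds.fun_mul hχ), cderiv_const, zero_add, zero_add] at k2
  rw [cderiv_mul ds ds] at k3
  refine ernst_energy (mE x hx) (mF x hx) k1 k2 (by ring)
    (by exact_mod_cast (Spacetime.lam_pos hx).ne') (ofReal_sqrt_mul_self (C.factor_pos x hx)) k3
    rfl rfl (cderiv_mul ds hψ) (cderiv_mul ds hχ)

lemma halfPlane_ne_zero {θ : ℝ} (hp : x ∈ halfPlane θ) : x ≠ 0 := by
  rintro rfl
  simpa using halfPlane_off_axis hp

/-- The jets of the conformal factor along the null direction `(-i, 0, 1)` vanish. -/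
lemma jetZero_factor_zero (hω : M.IsTwist ω) (hβ : AnalyticAt ℝ C.β 0) (hκ : AnalyticAt ℝ C.κ 0)
    {ψ : (Fin 3 → ℝ) → ℂ} (hψ : ContDiffAt ℝ (⊤ : ℕ∞) ψ 0)
    (eψ : ∀ y ∈ M.V, ernst M.lam ω y = ((√(C.Ω y) : ℝ) : ℂ) * ψ y) (m : ℕ) :
    JetZero (nullDir 0) m fun y => (C.Ω y : ℂ) := by
  set v := nullDir 0 with hv
  have cΩ : ContDiffAt ℝ (⊤ : ℕ∞) (fun y => (C.Ω y : ℂ)) 0 :=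
    Complex.ofRealCLM.contDiff.contDiffAt.comp 0 (contDiffAt_factor M.zero_mem)
  have cκ : ContDiffAt ℝ (⊤ : ℕ∞) (fun y => (C.κ y : ℂ)) 0 :=
    Complex.ofRealCLM.contDiff.contDiffAt.comp 0 hκ.contDiffAt
  -- Conjugation does not commute with the derivative along the complex vector `v`, so the conjugate
  -- potential is carried as a function of its own.
  set χ : (Fin 3 → ℝ) → ℂ := fun y => (starRingEnd ℂ) (ψ y) with hχd
  have hχ : ContDiffAt ℝ (⊤ : ℕ∞) χ 0 :=
    ContDiffAt.comp (g := fun z : ℂ => (starRingEnd ℂ) z) 0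
      Complex.conjCLE.contDiff.contDiffAt hψ
  have cR : ∀ i j, ContDiffAt ℝ (⊤ : ℕ∞) (fun y => (ricci C.hTilde y i j : ℂ)) 0 := fun i j =>
    Complex.ofRealCLM.contDiff.contDiffAt.comp 0 (contDiffAt_ricci
      (fun i j => C.contDiffAt_hTilde M.zero_mem i j) (C.posDef 0 M.zero_mem).det_pos.ne' i j)
  -- The denominator is `1` at `Λ`, where `Ω = 0`. Hence the coefficients are smooth there although
  -- neither `λ`, `ω` nor `√Ω` is known to be.
  have cD : ContDiffAt ℝ (⊤ : ℕ∞) (fun y => ((1 - (C.Ω y : ℂ) * (ψ y * χ y)) ^ 2)⁻¹) 0 := by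
    refine ContDiffAt.inv ((contDiffAt_const.sub (cΩ.mul (hψ.mul hχ))).pow 2) ?_
    simp [C.factor_zero]
  have cQ : ContDiffAt ℝ (⊤ : ℕ∞) (fun y => cderiv v (fun y => (C.Ω y : ℂ)) y / 2 * χ y
      + (C.Ω y : ℂ) * cderiv v χ y) 0 :=
    (((contDiffAt_cderiv cΩ).div_const 2).mul hχ).add (cΩ.mul (contDiffAt_cderiv hχ))
  -- The source is quadratic in `(Ω, vΩ)`. The factor with `χ` is absorbed into the coefficients,
  -- and twice the other factor is `ψ · vΩ + 2 vψ · Ω`. This linearizes the equation: `cp` and `cq`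
  -- concern the coefficients of `vΩ` and `Ω`.
  have cp : ContDiffAt ℝ (⊤ : ℕ∞) (fun y => 2 * cderiv v (fun y => (C.κ y : ℂ)) y
      + ψ y * (cderiv v (fun y => (C.Ω y : ℂ)) y / 2 * χ y + (C.Ω y : ℂ) * cderiv v χ y)
        * ((1 - (C.Ω y : ℂ) * (ψ y * χ y)) ^ 2)⁻¹) 0 :=
    (contDiffAt_const.mul (contDiffAt_cderiv cκ)).add ((hψ.mul cQ).mul cD)
  have cq : ContDiffAt ℝ (⊤ : ℕ∞) (fun y => 2 * cderiv v ψ y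
        * (cderiv v (fun y => (C.Ω y : ℂ)) y / 2 * χ y + (C.Ω y : ℂ) * cderiv v χ y)
        * ((1 - (C.Ω y : ℂ) * (ψ y * χ y)) ^ 2)⁻¹
      - ((ricci C.hTilde y 2 2 : ℂ) - ricci C.hTilde y 0 0
        - 2 * Complex.I * ricci C.hTilde y 0 2)) 0 :=
    (((contDiffAt_const.mul (contDiffAt_cderiv hψ)).mul cQ).mul cD).sub
      (((cR 2 2).sub (cR 0 0)).sub (contDiffAt_const.mul (cR 0 2)))
  refine JetZero.of_ode cΩ cp cq (by simp [C.factor_zero]) ?_ (fun m => ?_) m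
  · have d : DifferentiableAt ℝ C.Ω 0 :=
      (contDiffAt_factor M.zero_mem).differentiableAt (by simp)
    simp [cderiv, pd_ofReal d, C.factor_grad]
  · refine JetZero.of_halfPlane ((contDiffAt_cderiv (contDiffAt_cderiv cΩ)).sub
      ((cp.mul (contDiffAt_cderiv cΩ)).add (cq.mul cΩ))) ?_ m
    rw [eventually_nhdsWithin_iff]
    filter_upwards [C.eventually_regular hβ hκ, eventually_differentiableAt hψ,
      eventually_differentiableAt hχ] with y hr d1 d2 hp
    have hy : y ∈ M.V := ⟨hr.mem, halfPlane_ne_zero hp⟩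
    obtain ⟨k1, k2⟩ := factor_ernst_equation hω hr hp hy d1 d2 eψ (fun _ => rfl)
    rw [div_eq_mul_inv] at k2
    linear_combination k2

end Completion

end FactorJet

/-! ### Axial symmetry -/

section Axial

lemma cderiv_comp_mulVec {ι κ : Type} [Fintype ι] [DecidableEq ι] [Fintype κ] [DecidableEq κ]
    {f : (κ → ℝ) → ℂ} {x : ι → ℝ} (B : Matrix κ ι ℝ) (hf : DifferentiableAt ℝ f (B.mulVec x))
    (v : ι → ℂ) :
    cderiv v (fun y => f (B.mulVec y)) x
      = cderiv (fun j => ∑ i, (B j i : ℂ) * v i) f (B.mulVec x) := by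
  simp only [cderiv, pd_comp_mulVec B hf, Finset.mul_sum, Finset.sum_mul]
  rw [Finset.sum_comm]
  refine Finset.sum_congr rfl fun j _ => Finset.sum_congr rfl fun i _ => ?_
  rw [Complex.real_smul]
  ring

lemma JetZero.of_comp_mulVec {ι κ : Type} [Fintype ι] [DecidableEq ι] [Fintype κ] [DecidableEq κ]
    {f : (κ → ℝ) → ℂ} (B : Matrix κ ι ℝ) {v : ι → ℂ} {m : ℕ} (cf : ContDiffAt ℝ (⊤ : ℕ∞) f 0)
    (h : JetZero v m fun y => f (B.mulVec y)) :
    JetZero (fun j => ∑ i, (B j i : ℂ) * v i) m f := by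
  induction m generalizing f with
  | zero => trivial
  | succ m ih =>
    refine ⟨by simpa using h.1, ih (contDiffAt_cderiv cf) (h.2.congr ?_)⟩
    have hc : Filter.Tendsto (fun y : ι → ℝ => B.mulVec y) (𝓝 0) (𝓝 0) := by
      have := (LinearMap.toContinuousLinearMap B.mulVecLin).continuous.tendsto 0
      rw [map_zero] at this
      exact this
    filter_upwards [hc.eventually (eventually_differentiableAt cf)] with y hy
    exact cderiv_comp_mulVec B hy v

lemma rot_mulVec (θ : ℝ) (x : Fin 3 → ℝ) : (rot θ).mulVec x
    = ![Real.cos θ * x 0 - Real.sin θ * x 1, Real.sin θ * x 0 + Real.cos θ * x 1, x 2] := by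
  funext i
  fin_cases i <;> simp [rot, Matrix.mulVec, dotProduct, Fin.sum_univ_three] <;> ring

lemma rot_mulVec_two (θ : ℝ) (x : Fin 3 → ℝ) : (rot θ).mulVec x 2 = x 2 := by
  rw [rot_mulVec]; rfl

lemma rot_mulVec_sq (θ : ℝ) (x : Fin 3 → ℝ) :
    (rot θ).mulVec x 0 ^ 2 + (rot θ).mulVec x 1 ^ 2 = x 0 ^ 2 + x 1 ^ 2 := by
  rw [rot_mulVec]
  simp
  linear_combination (x 0 ^ 2 + x 1 ^ 2) * Real.sin_sq_add_cos_sq θ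

lemma rot_mulVec_axis (θ : ℝ) {x : Fin 3 → ℝ} (h0 : x 0 = 0) (h1 : x 1 = 0) :
    (rot θ).mulVec x = x := by
  rw [rot_mulVec]
  funext i
  fin_cases i <;> simp [h0, h1]

lemma rot_mulVec_ne_zero (θ : ℝ) {x : Fin 3 → ℝ} (hx : x ≠ 0) : (rot θ).mulVec x ≠ 0 := by
  intro h
  apply hx
  have h1 := rot_mulVec_sq θ x
  have h2 := rot_mulVec_two θ x
  rw [h] at h1 h2
  simp at h1 h2
  have h3 : x 0 = 0 := by nlinarith [sq_nonneg (x 0), sq_nonneg (x 1)]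
  have h4 : x 1 = 0 := by nlinarith [sq_nonneg (x 0), sq_nonneg (x 1)]
  funext i
  fin_cases i <;> simp [h3, h4, ← h2]

lemma rot_nullDir (θ : ℝ) : (fun j => ∑ i, (rot θ j i : ℂ) * nullDir 0 i) = nullDir θ := by
  funext j
  fin_cases j <;> simp [rot, nullDir, Fin.sum_univ_three] <;> ring

/-- For an axisymmetric function it is enough to look at one null direction. -/
lemma JetZero.rotate {f : (Fin 3 → ℝ) → ℂ} (cf : ContDiffAt ℝ (⊤ : ℕ∞) f 0) {θ : ℝ}
    (hf : ∀ᶠ y in 𝓝 0, f ((rot θ).mulVec y) = f y) {m : ℕ} (h : JetZero (nullDir 0) m f) :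
    JetZero (nullDir θ) m f := by
  rw [← rot_nullDir θ]
  exact JetZero.of_comp_mulVec (rot θ) cf (h.congr (hf.mono fun y hy => hy.symm))

lemma vecTail_rotTime (θ : ℝ) (y : Fin 4 → ℝ) :
    Matrix.vecTail ((rotTime θ).mulVec y) = (rot θ).mulVec (Matrix.vecTail y) := by
  rw [rot_mulVec]
  funext i
  fin_cases i <;>
    simp [rotTime, dotProduct, Fin.sum_univ_succ, Matrix.vecTail] <;> ring

lemma rotTime_vecCons (θ : ℝ) (x : Fin 3 → ℝ) :
    (rotTime θ).mulVec (Matrix.vecCons 0 x) = Matrix.vecCons 0 ((rot θ).mulVec x) := by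
  rw [rot_mulVec]
  funext i
  fin_cases i <;>
    simp [rotTime, Matrix.mulVec, dotProduct, Fin.sum_univ_succ] <;> ring

/-! ### Rotational invariance of the norm, of `h_zz` and of the twist potential. -/

namespace Spacetime

variable {M : Spacetime} {x : Fin 3 → ℝ}

lemma rot_mem_V (θ : ℝ) (hx : x ∈ M.V) : (rot θ).mulVec x ∈ M.V :=
  ⟨M.rot_mem θ x hx.1, rot_mulVec_ne_zero θ hx.2⟩

lemma rotTime_mem_dom (θ : ℝ) {y : Fin 4 → ℝ} (hy : y ∈ M.dom) : (rotTime θ).mulVec y ∈ M.dom := by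
  change Matrix.vecTail ((rotTime θ).mulVec y) ∈ M.V
  rw [vecTail_rotTime]
  exact rot_mem_V θ hy

/-- The components of the metric along `∂/∂t` and `∂/∂z` are axisymmetric. -/
lemma g_rotTime (θ : ℝ) {y : Fin 4 → ℝ} (hy : y ∈ M.dom) {a b : Fin 4} (ha : a = 0 ∨ a = 3)
    (hb : b = 0 ∨ b = 3) : M.g ((rotTime θ).mulVec y) a b = M.g y a b := by
  have h := M.axisymmetric y hy.1 hy.2 θ
  have e := congrFun (congrFun h a) b
  rw [← e]
  rcases ha with rfl | rfl <;> rcases hb with rfl | rfl <;>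
    simp [Matrix.mul_apply, Fin.sum_univ_succ, rotTime]

lemma lam_eq (x : Fin 3 → ℝ) : M.lam x = -M.g (Matrix.vecCons 0 x) 0 0 := by
  simp [lam, normOnM, xiLower_eq, xi, Pi.single_apply]

lemma lam_rot (θ : ℝ) (hx : x ∈ M.V) : M.lam ((rot θ).mulVec x) = M.lam x := by
  rw [lam_eq, lam_eq, ← rotTime_vecCons, g_rotTime θ (vecCons_mem_dom hx) (.inl rfl) (.inl rfl)]

lemma h_rot (θ : ℝ) (hx : x ∈ M.V) : M.h ((rot θ).mulVec x) 2 2 = M.h x 2 2 := by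
  have e : (Fin.succ 2 : Fin 4) = 3 := rfl
  simp only [h, Matrix.of_apply, xiLower_eq, lam_rot θ hx, ← rotTime_vecCons, e]
  rw [g_rotTime θ (vecCons_mem_dom hx) (.inr rfl) (.inr rfl),
    g_rotTime θ (vecCons_mem_dom hx) (.inr rfl) (.inl rfl)]

/-- The twist covector is made of `g`, `∂/∂t` and the volume form, all preserved by the rotation.
Thus `ω` and the rotated `ω` have the same gradient and can differ only by a constant on connected
pieces. -/
lemma pd_twist_rot {ω : (Fin 3 → ℝ) → ℝ} (hω : M.IsTwist ω) (θ : ℝ) (hx : x ∈ M.V) (i : Fin 3) :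
    pd i (fun y => ω ((rot θ).mulVec y)) x = pd i ω x := by
  have hRx := rot_mem_V θ hx
  have hd : DifferentiableAt ℝ ω ((rot θ).mulVec x) :=
    (hω.smooth.contDiffAt (M.isOpen_V.mem_nhds hRx)).differentiableAt (by simp)
  set y : Fin 4 → ℝ := Matrix.vecCons 0 x with hy
  have hyd : y ∈ M.dom := vecCons_mem_dom hx
  have e1 : twistForm M.orientation (pullback (rotTime θ) M.g) (fun _ => Pi.single 0 1) y i.succ
      = twistForm M.orientation M.g (fun _ => Pi.single 0 1) y i.succ := by
    refine twistForm_congr _ ?_ _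
    filter_upwards [M.isOpen_dom.mem_nhds hyd] with z hz
    exact M.axisymmetric z hz.1 hz.2 θ
  have hdet : (rotTime θ).det = 1 := by
    have := Real.sin_sq_add_cos_sq θ
    simp [rotTime, Matrix.det_succ_row_zero, Fin.sum_univ_succ]
    linear_combination this
  have hB0 : ∀ i, rotTime θ i 0 = if i = 0 then 1 else 0 := by
    intro i; fin_cases i <;> simp [rotTime]
  rw [twistForm_pullback M.orientation hdet hB0
    (fun a b => (contDiffAt_g (rotTime_mem_dom θ hyd) a b).differentiableAt (by simp)),
    Fin.sum_univ_succ] at e1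
  have h0 : rotTime θ 0 i.succ = 0 := by fin_cases i <;> simp [rotTime]
  have hs : ∀ j : Fin 3, rotTime θ j.succ i.succ = rot θ j i := by
    intro j; fin_cases i <;> fin_cases j <;> simp [rot, rotTime]
  rw [h0, zero_mul, zero_add] at e1
  rw [pd_comp_mulVec _ hd, pd_twist hω hx (y := y) (Matrix.tail_cons _ _), ← e1]
  refine Finset.sum_congr rfl fun j _ => ?_
  rw [hs, pd_twist hω hRx (y := (rotTime θ).mulVec y) (by rw [vecTail_rotTime]; rfl), smul_eq_mul]

lemma fderiv_eq_zero_of_pd {ι E : Type} [Fintype ι] [DecidableEq ι] [NormedAddCommGroup E]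
    [NormedSpace ℝ E] {f : (ι → ℝ) → E} {x : ι → ℝ} (h : ∀ i, pd i f x = 0) :
    fderiv ℝ f x = 0 := by
  ext w
  have e : w = ∑ i, w i • (Pi.single i 1 : ι → ℝ) := by
    funext j; simp [Finset.sum_apply, Pi.single_apply]
  rw [e, map_sum]
  exact Finset.sum_eq_zero fun i _ => by rw [map_smul, show fderiv ℝ f x (Pi.single i 1) = 0 from h i,
    smul_zero]

/-- The twist is axisymmetric near infinity. -/
lemma eventually_twist_rot {ω : (Fin 3 → ℝ) → ℝ} (hω : M.IsTwist ω) (θ : ℝ) :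
    ∀ᶠ x in 𝓝 0, ω ((rot θ).mulVec x) = ω x := by
  obtain ⟨ε, hε, hball⟩ := Metric.isOpen_iff.1 M.isOpen_U 0 M.zero_mem
  set F : (Fin 3 → ℝ) → ℝ := fun x => ω ((rot θ).mulVec x) - ω x with hF
  have dω : ∀ x ∈ M.V, DifferentiableAt ℝ ω x := fun x hx =>
    (hω.smooth.contDiffAt (M.isOpen_V.mem_nhds hx)).differentiableAt (by simp)
  have dR : ∀ x ∈ M.V, DifferentiableAt ℝ (fun x => ω ((rot θ).mulVec x)) x := fun x hx =>
    DifferentiableAt.comp (g := ω) x (dω _ (rot_mem_V θ hx))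
      (LinearMap.toContinuousLinearMap (rot θ).mulVecLin).differentiableAt
  have dF : ∀ x ∈ M.V, DifferentiableAt ℝ F x := fun x hx => (dR x hx).fun_sub (dω x hx)
  have F' : ∀ x ∈ M.V, fderiv ℝ F x = 0 := fun x hx => fderiv_eq_zero_of_pd fun i => by
    rw [hF, pd_sub (dR x hx) (dω x hx), pd_twist_rot hω θ hx, sub_self]
  -- The upper and the lower half-ball are convex and avoid `Λ`, so `F` is constant on each and
  -- equals its value on the axis, which the rotation fixes. The sign of `s` selects the half.
  have half : ∀ s : ℝ, s ≠ 0 → ∀ x ∈ Metric.ball (0 : Fin 3 → ℝ) ε, 0 < s * x 2 → F x = 0 := by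
    intro s hs x hx hx2
    set H : Set (Fin 3 → ℝ) := Metric.ball 0 ε ∩ {x | 0 < s * x 2} with hH
    have hHV : ∀ y ∈ H, y ∈ M.V := by
      rintro y ⟨h1, h2⟩
      refine ⟨hball h1, ?_⟩
      rintro rfl
      simp at h2
    have hconv : Convex ℝ H := by
      refine (convex_ball 0 ε).inter ?_
      intro y hy z hz a b ha hb hab
      simp only [Set.mem_ofPred_eq] at hy hz ⊢
      simp only [Pi.add_apply, Pi.smul_apply, smul_eq_mul]
      rcases ha.eq_or_lt with rfl | ha'
      · have : b = 1 := by linarith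
        subst this
        simpa using hz
      · nlinarith [mul_pos ha' hy, mul_nonneg hb hz.le]
    have hopen : IsOpen H := Metric.isOpen_ball.inter
      (isOpen_lt continuous_const (continuous_const.mul (continuous_apply 2)))
    -- The projection to the axis stays in the ball because the norm is the sup norm.
    have hpz : (![0, 0, x 2] : Fin 3 → ℝ) ∈ H := by
      refine ⟨?_, by simpa using hx2⟩
      rw [mem_ball_zero_iff] at hx ⊢
      refine lt_of_le_of_lt ?_ hx
      rw [pi_norm_le_iff_of_nonneg (norm_nonneg _)]
      intro i
      fin_cases i
      · simp
      · simp
      · exact norm_le_pi_norm x 2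
    have hc := hconv.is_const_of_fderivWithin_eq_zero (𝕜 := ℝ) (f := F)
      (fun y hy => (dF y (hHV y hy)).differentiableWithinAt)
      (fun y hy => by rw [fderivWithin_of_isOpen hopen hy, F' y (hHV y hy)])
      (show x ∈ H from ⟨hx, hx2⟩) hpz
    rw [hc, hF]
    simp only
    rw [rot_mulVec_axis θ (by simp) (by simp), sub_self]
  filter_upwards [Metric.ball_mem_nhds (0 : Fin 3 → ℝ) hε] with x hx
  rcases eq_or_ne x 0 with rfl | hx0
  · simp
  suffices F x = 0 from sub_eq_zero.1 this
  rcases lt_trichotomy (x 2) 0 with h | h | h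
  · exact half (-1) (by norm_num) x hx (by linarith)
  -- The plane `z = 0`, away from `Λ`, is reached by continuity from above.
  · have hcont : ContinuousAt F x := (dF x ⟨hball hx, hx0⟩).continuousAt
    have hl : Filter.Tendsto (fun t : ℝ => x + t • (Pi.single 2 1 : Fin 3 → ℝ)) (𝓝[>] 0) (𝓝 x) := by
      have : Filter.Tendsto (fun t : ℝ => x + t • (Pi.single 2 1 : Fin 3 → ℝ)) (𝓝 0)
          (𝓝 (x + (0 : ℝ) • (Pi.single 2 1 : Fin 3 → ℝ))) :=
        (continuous_const.add (continuous_id.smul continuous_const)).tendsto 0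
      rw [zero_smul, add_zero] at this
      exact this.mono_left nhdsWithin_le_nhds
    have h1 := hcont.tendsto.comp hl
    have h2 : (F ∘ fun t : ℝ => x + t • (Pi.single 2 1 : Fin 3 → ℝ)) =ᶠ[𝓝[>] 0] fun _ => 0 := by
      filter_upwards [hl.eventually (Metric.isOpen_ball.mem_nhds hx), self_mem_nhdsWithin]
        with t ht ht'
      exact half 1 one_ne_zero _ ht (by simpa [h] using ht')
    exact tendsto_nhds_unique h1 (tendsto_const_nhds.congr' h2.symm)
  · exact half 1 one_ne_zero x hx (by linarith)

end Spacetime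

/-! ### Rotational invariance of the conformal factor and of rescaled potentials. -/

namespace Completion

variable {M : Spacetime} {C : Completion M} {x : Fin 3 → ℝ}

/-- Off the axis `Ω² h_zz = e^{2κ}`, where `h_zz` and `κ` are axisymmetric and `Ω` is positive; on
the axis the rotation fixes the point. -/
lemma factor_rot (θ : ℝ) (hx : x ∈ M.U) : C.Ω ((rot θ).mulVec x) = C.Ω x := by
  by_cases ho : x 0 ≠ 0 ∨ x 1 ≠ 0
  · have hV : x ∈ M.V := ⟨hx, by rintro rfl; simp at ho⟩
    have hRV := Spacetime.rot_mem_V θ hV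
    have hR : (rot θ).mulVec x 0 ≠ 0 ∨ (rot θ).mulVec x 1 ≠ 0 := by
      by_contra! h
      have := rot_mulVec_sq θ x
      rw [h.1, h.2] at this
      rcases ho with h | h <;> nlinarith [sq_nonneg (x 0), sq_nonneg (x 1), sq_pos_of_ne_zero h]
    have key : ∀ y ∈ M.V, (y 0 ≠ 0 ∨ y 1 ≠ 0) → C.Ω y ^ 2 * M.h y 2 2 = Real.exp (2 * C.κ y) := by
      intro y hy hy'
      have h1 := congrFun (congrFun (C.conformal y hy) 2) 2
      rw [C.metric_form y hy.1 hy'] at h1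
      simpa [axialMetric] using h1.symm
    have k1 := key x hV ho
    have k2 := key _ hRV hR
    rw [Spacetime.h_rot θ hV, C.axial_kappa θ x hV, ← k1] at k2
    have hpos : M.h x 2 2 ≠ 0 := by
      intro h0
      rw [h0, mul_zero] at k1
      exact (Real.exp_pos _).ne k1
    have k3 := mul_right_cancel₀ hpos k2
    exact (pow_left_inj₀ (C.factor_pos _ hRV).le (C.factor_pos _ hV).le two_ne_zero).1 k3
  · push Not at ho
    rw [rot_mulVec_axis θ ho.1 ho.2]

lemma rescale_rot {φ : (Fin 3 → ℝ) → ℂ} {θ : ℝ}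
    (h : ∀ᶠ y in 𝓝 0, y ∈ M.V → φ ((rot θ).mulVec y) = φ y) :
    ∀ᶠ y in 𝓝 0, rescale C.Ω φ ((rot θ).mulVec y) = rescale C.Ω φ y := by
  filter_upwards [h, M.isOpen_U.mem_nhds M.zero_mem] with y hy hU
  rcases eq_or_ne y 0 with rfl | hy0
  · simp
  rw [rescale, Function.update_of_ne (rot_mulVec_ne_zero θ hy0), Function.update_of_ne hy0,
    hy ⟨hU, hy0⟩, factor_rot θ hU]

end Completion

end Axial

/-! ### The Hansen and the Ernst potential -/

section Potentials

lemma analyticAt_sqrt_comp {E : Type} [NormedAddCommGroup E] [NormedSpace ℝ E] {f : E → ℝ} {x : E}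
    (hf : AnalyticAt ℝ f x) (hx : 0 < f x) : AnalyticAt ℝ (fun y => √(f y)) x := by
  have h : (fun y => √(f y)) =ᶠ[𝓝 x] fun y => Real.exp (Real.log (f y) / 2) := by
    filter_upwards [hf.continuousAt.eventually (lt_mem_nhds hx)] with y hy
    rw [Real.sqrt_eq_iff_eq_sq hy.le (Real.exp_pos _).le, ← Real.exp_nat_mul]
    push_cast
    rw [mul_div_cancel₀ _ two_ne_zero, Real.exp_log hy]
  refine AnalyticAt.congr ?_ h.symm
  have hl : AnalyticAt ℝ (fun y => Real.log (f y)) x := (analyticAt_log hx).comp hf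
  exact (hl.div analyticAt_const two_ne_zero).rexp

lemma analyticAt_normSq_comp {E : Type} [NormedAddCommGroup E] [NormedSpace ℝ E] {f : E → ℂ} {x : E}
    (hf : AnalyticAt ℝ f x) : AnalyticAt ℝ (fun y => Complex.normSq (f y)) x := by
  have h1 : AnalyticAt ℝ (fun y => (f y).re) x :=
    AnalyticAt.comp (g := fun z : ℂ => z.re) (Complex.reCLM.analyticAt _) hf
  have h2 : AnalyticAt ℝ (fun y => (f y).im) x :=
    AnalyticAt.comp (g := fun z : ℂ => z.im) (Complex.imCLM.analyticAt _) hf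
  simp only [Complex.normSq_apply]
  exact (h1.mul h1).add (h2.mul h2)

/-- The radicand is a perfect square, since `(λ² + ω² - 1)² + 4ω² + 4λ² = (λ² + ω² + 1)²`. -/
lemma sqrt_one_add_normSq_hansen {lam ω : (Fin 3 → ℝ) → ℝ} {x : Fin 3 → ℝ} (hl : 0 < lam x) :
    √(1 + 4 * Complex.normSq (hansen lam ω x)) = (1 + lam x ^ 2 + ω x ^ 2) / (2 * lam x) := by
  rw [Real.sqrt_eq_iff_eq_sq
    (by have := Complex.normSq_nonneg (hansen lam ω x); positivity) (by positivity)]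
  have h : hansen lam ω x = ((-(lam x ^ 2 - 1 + ω x ^ 2) / (4 * lam x) : ℝ) : ℂ)
      + ((-(2 * ω x) / (4 * lam x) : ℝ) : ℂ) * Complex.I := by
    unfold hansen
    push_cast
    ring
  rw [h, Complex.normSq_add_mul_I]
  field_simp
  ring

/-- This inverts `φ_H = φ_E / (1 - |φ_E|²)`. Only `|φ_H|² = Ω |φ̃_H|²` stands under the root, so
after division by `√Ω` the formula is still analytic at `Λ`. -/
lemma ernst_eq_hansen {lam ω : (Fin 3 → ℝ) → ℝ} {x : Fin 3 → ℝ} (hl : 0 < lam x) :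
    ernst lam ω x = 2 * hansen lam ω x
      / ((1 + √(1 + 4 * Complex.normSq (hansen lam ω x)) : ℝ) : ℂ) := by
  rw [sqrt_one_add_normSq_hansen hl]
  have h1 : (1 + (lam x : ℂ) + Complex.I * (ω x : ℂ)) ≠ 0 := by
    intro h
    have := congrArg Complex.re h
    simp at this
    linarith
  have h2 : (1 + (lam x : ℂ) - Complex.I * (ω x : ℂ)) ≠ 0 := by
    intro h
    have := congrArg Complex.re h
    simp at this
    linarith
  have hlc : (lam x : ℂ) ≠ 0 := by exact_mod_cast hl.ne'
  have hI := Complex.I_sq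
  have h3 : ((1 + (1 + lam x ^ 2 + ω x ^ 2) / (2 * lam x) : ℝ) : ℂ)
      = (1 + (lam x : ℂ) + Complex.I * (ω x : ℂ)) * (1 + (lam x : ℂ) - Complex.I * (ω x : ℂ))
        / (2 * lam x) := by
    push_cast
    field_simp
    linear_combination (ω x : ℂ) ^ 2 * hI
  rw [h3]
  unfold ernst hansen
  field_simp
  linear_combination (4 * (ω x : ℂ) ^ 2) * hI

lemma rescale_apply {Ω : (Fin 3 → ℝ) → ℝ} {φ : (Fin 3 → ℝ) → ℂ} {x : Fin 3 → ℝ}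
    (hx : x ≠ 0) : rescale Ω φ x = φ x / ((√(Ω x) : ℝ) : ℂ) := Function.update_of_ne hx _ _

/-- The value of `rescale` at `Λ` is a `limUnder`; a continuous function that agrees with it off `Λ`
shows that the limit exists and identifies it. -/
lemma rescale_eventuallyEq_of_continuousAt {Ω : (Fin 3 → ℝ) → ℝ} {φ ψ : (Fin 3 → ℝ) → ℂ}
    (hψ : ContinuousAt ψ 0) (h : ∀ᶠ y in 𝓝[≠] 0, φ y / ((√(Ω y) : ℝ) : ℂ) = ψ y) :
    rescale Ω φ =ᶠ[𝓝 0] ψ := by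
  have hlim : Filter.Tendsto (fun y => φ y / ((√(Ω y) : ℝ) : ℂ)) (𝓝[≠] 0) (𝓝 (ψ 0)) :=
    (hψ.tendsto.mono_left nhdsWithin_le_nhds).congr' (h.mono fun y hy => hy.symm)
  filter_upwards [eventually_nhdsWithin_iff.1 h] with y hy
  rcases eq_or_ne y 0 with rfl | hy0
  · rw [rescale, Function.update_self, hlim.limUnder_eq]
  · rw [rescale_apply hy0, hy hy0]

/-! ### The rescaled Ernst potential as an analytic expression in the rescaled Hansen potential. -/

namespace Completion

variable {M : Spacetime} {C : Completion M} {ω : (Fin 3 → ℝ) → ℝ}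

lemma eq_sqrt_mul_rescale {φ : (Fin 3 → ℝ) → ℂ} {x : Fin 3 → ℝ} (hx : x ∈ M.V) :
    φ x = ((√(C.Ω x) : ℝ) : ℂ) * rescale C.Ω φ x := by
  rw [rescale_apply hx.2, mul_div_cancel₀ _ (ofReal_sqrt_ne_zero (C.factor_pos x hx))]

lemma normSq_rescale {φ : (Fin 3 → ℝ) → ℂ} {x : Fin 3 → ℝ} (hx : x ∈ M.V) :
    C.Ω x * Complex.normSq (rescale C.Ω φ x) = Complex.normSq (φ x) := by
  rw [eq_sqrt_mul_rescale (C := C) (φ := φ) hx, Complex.normSq_mul, Complex.normSq_ofReal,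
    Real.mul_self_sqrt (C.factor_pos x hx).le]

/-- `√(1 + 4 |φ_H|²)` as a function on the completed space of trajectories. -/
def root (C : Completion M) (ω : (Fin 3 → ℝ) → ℝ) (y : Fin 3 → ℝ) : ℝ :=
  √(1 + 4 * (C.Ω y * Complex.normSq (rescale C.Ω (hansen M.lam ω) y)))

lemma analyticAt_root (hΩ : AnalyticAt ℝ C.Ω 0)
    (hH : AnalyticAt ℝ (rescale C.Ω (hansen M.lam ω)) 0) : AnalyticAt ℝ (C.root ω) 0 :=
  analyticAt_sqrt_comp (analyticAt_const.add (analyticAt_const.mul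
    (hΩ.mul (analyticAt_normSq_comp hH)))) (by simp [C.factor_zero])

lemma one_add_root_ne_zero (y : Fin 3 → ℝ) : ((1 + C.root ω y : ℝ) : ℂ) ≠ 0 := by
  have : 0 < 1 + C.root ω y := add_pos_of_pos_of_nonneg one_pos (Real.sqrt_nonneg _)
  exact_mod_cast this.ne'

lemma analyticAt_one_add_root (hΩ : AnalyticAt ℝ C.Ω 0)
    (hH : AnalyticAt ℝ (rescale C.Ω (hansen M.lam ω)) 0) :
    AnalyticAt ℝ (fun y => ((1 + C.root ω y : ℝ) : ℂ)) 0 :=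
  AnalyticAt.comp (g := fun r : ℝ => (r : ℂ)) (Complex.ofRealCLM.analyticAt _)
    (analyticAt_const.add (analyticAt_root hΩ hH))

lemma rescale_ernst_eventuallyEq (hΩ : AnalyticAt ℝ C.Ω 0)
    (hH : AnalyticAt ℝ (rescale C.Ω (hansen M.lam ω)) 0) :
    rescale C.Ω (ernst M.lam ω) =ᶠ[𝓝 0]
      fun y => 2 * rescale C.Ω (hansen M.lam ω) y / ((1 + C.root ω y : ℝ) : ℂ) := by
  refine rescale_eventuallyEq_of_continuousAt ((analyticAt_const.mul hH).div
    (analyticAt_one_add_root hΩ hH) (one_add_root_ne_zero 0)).continuousAt ?_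
  rw [eventually_nhdsWithin_iff]
  filter_upwards [M.isOpen_U.mem_nhds M.zero_mem] with y hy hy0
  have hV : y ∈ M.V := ⟨hy, hy0⟩
  rw [ernst_eq_hansen (Spacetime.lam_pos hV), root, normSq_rescale hV, rescale_apply hy0]
  ring

lemma analyticAt_rescale_ernst (hΩ : AnalyticAt ℝ C.Ω 0)
    (hH : AnalyticAt ℝ (rescale C.Ω (hansen M.lam ω)) 0) :
    AnalyticAt ℝ (rescale C.Ω (ernst M.lam ω)) 0 :=
  ((analyticAt_const.mul hH).div (analyticAt_one_add_root hΩ hH) (one_add_root_ne_zero 0)).congr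
    (rescale_ernst_eventuallyEq hΩ hH).symm

/-- The jets of the conformal factor along all null directions vanish. -/
lemma jetZero_factor (hω : M.IsTwist ω) (hβ : AnalyticAt ℝ C.β 0) (hκ : AnalyticAt ℝ C.κ 0)
    (hE : AnalyticAt ℝ (rescale C.Ω (ernst M.lam ω)) 0) (θ : ℝ) (m : ℕ) :
    JetZero (nullDir θ) m fun y => (C.Ω y : ℂ) := by
  refine JetZero.rotate (Complex.ofRealCLM.contDiff.contDiffAt.comp 0
    (contDiffAt_factor M.zero_mem)) ?_
    (jetZero_factor_zero hω hβ hκ hE.contDiffAt (fun y hy => eq_sqrt_mul_rescale hy) m)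
  filter_upwards [M.isOpen_U.mem_nhds M.zero_mem] with y hy
  change ((C.Ω _ : ℝ) : ℂ) = C.Ω y
  rw [factor_rot θ hy]

/-- With `r = √(1 + 4|φ_H|²)` the difference is `φ̃_H (1 - r)/(1 + r) = φ̃_H (1 - r²)/(1 + r)²`, and
`1 - r² = -4Ω |φ̃_H|²`. So it is `Ω` times an analytic function, and functions with vanishing jets
form an ideal. -/
lemma jetZero_ernst_sub_hansen (hω : M.IsTwist ω) (hΩ : AnalyticAt ℝ C.Ω 0)
    (hβ : AnalyticAt ℝ C.β 0) (hκ : AnalyticAt ℝ C.κ 0)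
    (hH : AnalyticAt ℝ (rescale C.Ω (hansen M.lam ω)) 0) (θ : ℝ) (m : ℕ) :
    JetZero (nullDir θ) m fun y =>
      rescale C.Ω (ernst M.lam ω) y - rescale C.Ω (hansen M.lam ω) y := by
  have hE := analyticAt_rescale_ernst hΩ hH
  have hN : AnalyticAt ℝ (fun y => ((Complex.normSq (rescale C.Ω (hansen M.lam ω) y) : ℝ) : ℂ)) 0 :=
    AnalyticAt.comp (g := fun r : ℝ => (r : ℂ)) (Complex.ofRealCLM.analyticAt _)
      (analyticAt_normSq_comp hH)
  have h1 := analyticAt_one_add_root hΩ hH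
  have hf : AnalyticAt ℝ (fun y => -4 * rescale C.Ω (hansen M.lam ω) y
      * ((Complex.normSq (rescale C.Ω (hansen M.lam ω) y) : ℝ) : ℂ)
      / (((1 + C.root ω y : ℝ) : ℂ) * ((1 + C.root ω y : ℝ) : ℂ))) 0 :=
    ((analyticAt_const.mul hH).mul hN).div (h1.mul h1)
      (mul_ne_zero (one_add_root_ne_zero 0) (one_add_root_ne_zero 0))
  refine ((jetZero_factor hω hβ hκ hE θ m).mul hf.contDiffAt
    (Complex.ofRealCLM.contDiff.contDiffAt.comp 0 (contDiffAt_factor M.zero_mem))).congr ?_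
  filter_upwards [rescale_ernst_eventuallyEq hΩ hH, M.isOpen_U.mem_nhds M.zero_mem] with y hy hU
  rw [hy]
  have hΩ0 : 0 ≤ C.Ω y := by
    rcases eq_or_ne y 0 with rfl | h
    · exact C.factor_zero.ge
    · exact (C.factor_pos y ⟨hU, h⟩).le
  have hr : C.root ω y * C.root ω y
      = 1 + 4 * (C.Ω y * Complex.normSq (rescale C.Ω (hansen M.lam ω) y)) :=
    Real.mul_self_sqrt (by
      have := mul_nonneg hΩ0 (Complex.normSq_nonneg (rescale C.Ω (hansen M.lam ω) y)); positivity)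
  have hrc := congrArg (fun r : ℝ => (r : ℂ)) hr
  have hne := one_add_root_ne_zero (C := C) (ω := ω) y
  push_cast at hrc hne ⊢
  field_simp
  linear_combination rescale C.Ω (hansen M.lam ω) y * hrc

end Completion

/-! ### Leading order functions -/

/-- On the holomorphic extension `G(z, ρ)` the derivative along `v` is that in the direction `(1,
-i)`, which is tangent to the complex line through the points `(r, -ir)`. If `G` vanishes at these
points for small real `r`, so does this derivative. The induction therefore passes from `D` to `vD`
and from `G` to its directional derivative. -/
lemma jetZero_of_leadingOrder {D : (Fin 3 → ℝ) → ℂ} {G : ℂ × ℂ → ℂ}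
    (cD : ContDiffAt ℝ (⊤ : ℕ∞) D 0) (hG : AnalyticAt ℂ G 0)
    (h1 : ∀ᶠ p : ℝ × ℝ in 𝓝 0, G ((p.1 : ℂ), (p.2 : ℂ)) = profile D p)
    (h2 : ∀ᶠ r : ℝ in 𝓝 0, G ((r : ℂ), -Complex.I * (r : ℂ)) = 0) (m : ℕ) :
    JetZero (nullDir 0) m D := by
  induction m generalizing D G with
  | zero => trivial
  | succ m ih =>
    refine ⟨?_, ih (G := fun p => fderiv ℂ G p (1, -Complex.I)) (contDiffAt_cderiv cD)
      (AnalyticAt.comp (g := fun L : ℂ × ℂ →L[ℂ] ℂ => L (1, -Complex.I))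
        ((ContinuousLinearMap.apply ℂ ℂ ((1 : ℂ), -Complex.I)).analyticAt _) hG.fderiv) ?_ ?_⟩
    · have e1 := h1.self_of_nhds
      have e2 := h2.self_of_nhds
      have e3 : (![0, 0, 0] : Fin 3 → ℝ) = 0 := by funext i; fin_cases i <;> rfl
      simp [profile, e3] at e1 e2
      rw [← e1]
      exact e2
    · have c1 : Filter.Tendsto (fun p : ℝ × ℝ => ((p.1 : ℂ), (p.2 : ℂ))) (𝓝 0) (𝓝 0) := by
        have : Continuous (fun p : ℝ × ℝ => ((p.1 : ℂ), (p.2 : ℂ))) := by fun_prop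
        have e := this.tendsto 0
        simpa [Prod.mk_zero_zero] using e
      have c2 : Filter.Tendsto (fun p : ℝ × ℝ => (![p.2, 0, p.1] : Fin 3 → ℝ)) (𝓝 0) (𝓝 0) := by
        have : Continuous (fun p : ℝ × ℝ => (![p.2, 0, p.1] : Fin 3 → ℝ)) := by fun_prop
        have e := this.tendsto 0
        have e3 : (![0, 0, 0] : Fin 3 → ℝ) = 0 := by funext i; fin_cases i <;> rfl
        simpa [e3] using e
      filter_upwards [h1.eventually_nhds, c1.eventually hG.eventually_analyticAt,
        c2.eventually (eventually_differentiableAt cD)] with p hp hGp hDp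
      -- In real directions both derivatives are computed along the same real line, where `G` and
      -- `D` agree; complex linearity of `fderiv ℂ G` then reaches `(1, -i)`.
      have key : ∀ a b : ℝ, fderiv ℂ G ((p.1 : ℂ), (p.2 : ℂ)) ((a : ℂ), (b : ℂ))
          = fderiv ℝ D ![p.2, 0, p.1] ![b, 0, a] := by
        intro a b
        have g1 : HasDerivAt (fun t : ℝ => G (((p.1 + t * a : ℝ) : ℂ), ((p.2 + t * b : ℝ) : ℂ)))
            (fderiv ℂ G ((p.1 : ℂ), (p.2 : ℂ)) ((a : ℂ), (b : ℂ))) 0 := by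
          have l1 : HasDerivAt (fun t : ℝ => ((p.1 + t * a : ℝ) : ℂ)) (a : ℂ) 0 := by
            have := (((hasDerivAt_id (0 : ℝ)).mul_const a).const_add p.1).ofReal_comp
            simpa using this
          have l2 : HasDerivAt (fun t : ℝ => ((p.2 + t * b : ℝ) : ℂ)) (b : ℂ) 0 := by
            have := (((hasDerivAt_id (0 : ℝ)).mul_const b).const_add p.2).ofReal_comp
            simpa using this
          have hf : HasFDerivAt G ((fderiv ℂ G ((p.1 : ℂ), (p.2 : ℂ))).restrictScalars ℝ)
              (((p.1 + (0 : ℝ) * a : ℝ) : ℂ), ((p.2 + (0 : ℝ) * b : ℝ) : ℂ)) := by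
            simpa using hGp.differentiableAt.hasFDerivAt.restrictScalars ℝ
          exact hf.comp_hasDerivAt (0 : ℝ) (l1.prodMk l2)
        have g2 : HasDerivAt (fun t : ℝ => D ![p.2 + t * b, 0, p.1 + t * a])
            (fderiv ℝ D ![p.2, 0, p.1] ![b, 0, a]) 0 := by
          have l : HasDerivAt (fun t : ℝ => (![p.2 + t * b, 0, p.1 + t * a] : Fin 3 → ℝ))
              ![b, 0, a] 0 := by
            rw [hasDerivAt_pi]
            intro i
            fin_cases i
            · simpa using ((hasDerivAt_id (0 : ℝ)).mul_const b).const_add p.2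
            · simpa using hasDerivAt_const (0 : ℝ) (0 : ℝ)
            · simpa using ((hasDerivAt_id (0 : ℝ)).mul_const a).const_add p.1
          have hf : HasFDerivAt D (fderiv ℝ D ![p.2, 0, p.1])
              ![p.2 + (0 : ℝ) * b, 0, p.1 + (0 : ℝ) * a] := by
            simpa using hDp.hasFDerivAt
          exact hf.comp_hasDerivAt (0 : ℝ) l
        refine g1.unique (g2.congr_of_eventuallyEq ?_)
        have hc : Filter.Tendsto (fun t : ℝ => (p.1 + t * a, p.2 + t * b)) (𝓝 0) (𝓝 p) := by
          have : Continuous (fun t : ℝ => (p.1 + t * a, p.2 + t * b)) := by fun_prop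
          simpa using this.tendsto 0
        filter_upwards [hc.eventually hp] with t ht
        exact ht
      have k1 := key 1 0
      have k2 := key 0 1
      rw [profile, cderiv_nullDir, Real.cos_zero, Real.sin_zero, ← k1, ← k2]
      have : ((1 : ℂ), -Complex.I) = (((1 : ℝ) : ℂ), ((0 : ℝ) : ℂ))
          + (-Complex.I) • (((0 : ℝ) : ℂ), ((1 : ℝ) : ℂ)) := by simp
      rw [this, map_add, map_smul, smul_eq_mul]
      ring
    · have c1 : Filter.Tendsto (fun r : ℝ => ((r : ℂ), -Complex.I * (r : ℂ))) (𝓝 0) (𝓝 0) := by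
        have : Continuous (fun r : ℝ => ((r : ℂ), -Complex.I * (r : ℂ))) := by fun_prop
        simpa [Prod.mk_zero_zero] using this.tendsto 0
      filter_upwards [h2.eventually_nhds, c1.eventually hG.eventually_analyticAt] with r hr hGr
      have l1 : HasDerivAt (fun t : ℝ => (t : ℂ)) 1 r := by
        simpa using (hasDerivAt_id r).ofReal_comp
      have l2 : HasDerivAt (fun t : ℝ => -Complex.I * (t : ℂ)) (-Complex.I) r := by
        simpa using l1.const_mul (-Complex.I)
      have g1 : HasDerivAt (fun t : ℝ => G ((t : ℂ), -Complex.I * (t : ℂ)))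
          (fderiv ℂ G ((r : ℂ), -Complex.I * (r : ℂ)) (1, -Complex.I)) r := by
        have hf : HasFDerivAt G ((fderiv ℂ G ((r : ℂ), -Complex.I * (r : ℂ))).restrictScalars ℝ)
            ((r : ℂ), -Complex.I * (r : ℂ)) := hGr.differentiableAt.hasFDerivAt.restrictScalars ℝ
        exact hf.comp_hasDerivAt r (l1.prodMk l2)
      exact g1.unique ((hasDerivAt_const r (0 : ℂ)).congr_of_eventuallyEq hr)

lemma hansen_rot {M : Spacetime} {ω : (Fin 3 → ℝ) → ℝ} (hω : M.IsTwist ω) (θ : ℝ) :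
    ∀ᶠ y in 𝓝 0, y ∈ M.V → hansen M.lam ω ((rot θ).mulVec y) = hansen M.lam ω y := by
  filter_upwards [Spacetime.eventually_twist_rot hω θ] with y hy hV
  simp only [hansen, hy, Spacetime.lam_rot θ hV]

end Potentials

end

end Multipole

theorem mainTheorem6 (M : Spacetime) (ω : (Fin 3 → ℝ) → ℝ) (hω : M.IsTwist ω) (C : Completion M)
    (hΩ : AnalyticAt ℝ C.Ω 0) (hβ : AnalyticAt ℝ C.β 0) (hκ : AnalyticAt ℝ C.κ 0)
    (hH : AnalyticAt ℝ (rescale C.Ω (hansen M.lam ω)) 0) :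
    (AnalyticAt ℝ (rescale C.Ω (ernst M.lam ω)) 0 ∧
      ∀ n : ℕ, multipoleTensor C.hTilde (rescale C.Ω (ernst M.lam ω)) n 0
        = multipoleTensor C.hTilde (rescale C.Ω (hansen M.lam ω)) n 0) ∧
    ∀ φ : (Fin 3 → ℝ) → ℂ, M.IsAxisymmetric φ → AnalyticAt ℝ (rescale C.Ω φ) 0 →
      (∃ y : ℝ → ℂ, IsLeadingOrder (profile (rescale C.Ω φ)) y ∧
        IsLeadingOrder (profile (rescale C.Ω (hansen M.lam ω))) y) →
      ∀ n : ℕ, multipoleTensor C.hTilde (rescale C.Ω φ) n 0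
        = multipoleTensor C.hTilde (rescale C.Ω (hansen M.lam ω)) n 0 := by
  have hE := Completion.analyticAt_rescale_ernst hΩ hH
  refine ⟨⟨hE, multipoleTensor_eq_of_jetZero hβ hκ hE.contDiffAt hH.contDiffAt
    (Completion.jetZero_ernst_sub_hansen hω hΩ hβ hκ hH)⟩, ?_⟩
  rintro φ hφ hφa ⟨y, ⟨G₁, a₁, e₁, l₁⟩, ⟨G₂, a₂, e₂, l₂⟩⟩
  have cD : ContDiffAt ℝ (⊤ : ℕ∞)
      (fun x => rescale C.Ω φ x - rescale C.Ω (hansen M.lam ω) x) 0 :=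
    hφa.contDiffAt.sub hH.contDiffAt
  -- `G₁ - G₂` extends the profile of the difference of the two rescaled potentials and vanishes at
  -- `(r, -ir)`. This settles azimuth 0, and axial symmetry of both potentials gives the remaining
  -- azimuths.
  refine multipoleTensor_eq_of_jetZero hβ hκ hφa.contDiffAt hH.contDiffAt fun θ m =>
    JetZero.rotate cD ?_ (jetZero_of_leadingOrder (G := fun p => G₁ p - G₂ p) cD (a₁.sub a₂) ?_ ?_ m)
  · filter_upwards [Completion.rescale_rot (C := C) (φ := φ) (θ := θ)
      (Filter.Eventually.of_forall fun y hy => hφ θ y hy),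
      Completion.rescale_rot (C := C) (hansen_rot hω θ)] with y h1 h2
    rw [h1, h2]
  · filter_upwards [e₁, e₂] with p h1 h2
    simp only [h1, h2, profile]
  · filter_upwards [l₁, l₂] with r h1 h2
    rw [← h1, ← h2, sub_self]
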